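/- **Theorem 1.1.** Let $a_0,b_2>0$, $a_2,b_0\ge 0$, $a_1,b_1\in\mathbb R$, put $c_i=a_i+b_i$ ($i=0,1,2$) and assume $$\Delta:=a_2b_0-a_0b_2\neq 0,\qquad c_1^2<4c_0c_2,\qquad b_1\,(a_0b_2+a_2b_0+2a_0a_2)=a_1\,(a_0b_2+a_2b_0+2b_0b_2).$$ Let $X$ be a planar vector field that is $C^3$ near the origin, leaves the coordinate axes invariant near the origin, and has the form $$X(x,y)=\begin{pmatrix} x(a_0x^2+a_1xy+a_2y^2)\\ -y(b_0x^2+b_1xy+b_2y^2)\end{pmatrix}+r(x,y),$$ where $r$ is of order four together with its derivatives of order at most two: $D^kr(z)=O(|z|^{4-k})$ as $z\to0$ for $k=0,1,2$. Define $$\beta_0=\frac{a_0+b_0}{2a_0},\qquad \beta_2=\frac{a_2+b_2}{2b_2},\qquad \beta_*=\frac12\min\Big\{1,\frac{a_2}{b_2},\frac{b_0}{a_0}\Big\}.$$ For $\zeta_0,\eta>0$ we say that $\xi$ has Dulac time $T$ and exit coordinate $\omega$ if the integral curve of $X$ starting at $(\xi,\eta)$ stays in $[0,\zeta_0]\times[0,\eta]$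 until it meets $\{x=\zeta_0\}$ for the first time, and this happens at time $T$ and at the point $(\zeta_0,\omega)$. Then there is $\rho>0$ such that for all $\zeta_0,\eta\in(0,\rho)$ there are constants $\xi_0(\eta),\omega_0(\eta)>0$ (depending also on $X$ and $\zeta_0$) with the following properties. 1. For every sufficiently large $T$ there is an entry coordinate $\xi$ with Dulac time $T$, and every such $\xi=\xi(\eta,T)$, with its exit coordinate $\omega=\omega(\eta,T)$, satisfies, as $T\to\infty$, $$\xi(\eta,T)=\xi_0(\eta)\,T^{-\beta_2}\bigl(1+O(\max\{T^{-\beta_*},T^{-1/2}\log T\})\bigr),\qquad \omega(\eta,T)=\omega_0(\eta)\,T^{-\beta_0}\bigl(1+O(\max\{T^{-\beta_*},T^{-1/2}\log T\})\bigr).$$ 2. For every sufficiently small $\xi>0$ the Dulac time and the exit coordinate $\omega=D(\xi)$ exist and are unique, and the Dulac map $D$ satisfies, as $\xi\downarrow 0$, $$D(\xi)=\omega_0(\eta)\,\xi_0(\eta)^{-\beta_0/\beta_2}\,\xi^{\beta_0/\beta_2}\Bigl(1+O\bigl(\max\{\xi^{\beta_*/\beta_2},\,-\xi^{1/(2\beta_2)}\log\xi\}\bigr)\Bigr).$$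 3. If $r$ vanishes near the origin, then, with $u=2b_2c_0/\Delta$ and $v=2a_0c_2/\Delta$, $$\xi_0(\eta)=c_2^{-1/u}\,\eta^{-a_2/b_2}\Bigl(\int_0^\infty\frac{M^{1/\beta_0-1}\,dM}{(c_0+c_1M+c_2M^2)^{\frac1{2\beta_0}+\frac1{2\beta_2}}}\Bigr)^{\beta_2},\qquad \omega_0(\eta)=c_0^{-1/v}\,\zeta_0^{-b_0/a_0}\Bigl(\int_0^\infty\frac{M^{1/\beta_2-1}\,dM}{(c_0M^2+c_1M+c_2)^{\frac1{2\beta_0}+\frac1{2\beta_2}}}\Bigr)^{\beta_0}.$$ -/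

import Mathlib

open Set Filter Topology Asymptotics

noncomputable section

/-- Coefficients of the cubic part of a planar vector field with a neutral saddle at the origin. -/
structure CubicCoeffs where
  a₀ : ℝ
  a₁ : ℝ
  a₂ : ℝ
  b₀ : ℝ
  b₁ : ℝ
  b₂ : ℝ

namespace CubicCoeffs

variable (p : CubicCoeffs)

def c₀ : ℝ := p.a₀ + p.b₀

def c₁ : ℝ := p.a₁ + p.b₁

def c₂ : ℝ := p.a₂ + p.b₂

def Δ : ℝ := p.a₂ * p.b₀ - p.a₀ * p.b₂

/-- The sign conditions on the coefficients. The exponents `β₀` and `β₂` have the denominators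
`a₀` and `b₂`, which are therefore positive. -/
structure Admissible : Prop where
  a₀_pos : 0 < p.a₀
  b₂_pos : 0 < p.b₂
  a₂_nonneg : 0 ≤ p.a₂
  b₀_nonneg : 0 ≤ p.b₀
  Δ_ne_zero : p.Δ ≠ 0
  definite : p.c₁ ^ 2 < 4 * p.c₀ * p.c₂

/-- The condition `b₁ / a₁ = (a₀b₂ + a₂b₀ + 2b₀b₂) / (a₀b₂ + a₂b₀ + 2a₀a₂)` for the explicit first
integral, cleared of denominators so that it includes the case `a₁ = b₁ = 0`. -/
def FirstIntegralCondition : Prop :=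
  p.b₁ * (p.a₀ * p.b₂ + p.a₂ * p.b₀ + 2 * p.a₀ * p.a₂) =
    p.a₁ * (p.a₀ * p.b₂ + p.a₂ * p.b₀ + 2 * p.b₀ * p.b₂)

def β₀ : ℝ := (p.a₀ + p.b₀) / (2 * p.a₀)

def β₂ : ℝ := (p.a₂ + p.b₂) / (2 * p.b₂)

/-- `β_* = ½ min {1, a₂ / b₂, b₀ / a₀}`. -/
def βstar : ℝ := 1 / 2 * min 1 (min (p.a₂ / p.b₂) (p.b₀ / p.a₀))

def u : ℝ := 2 * p.b₂ * p.c₀ / p.Δ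

def v : ℝ := 2 * p.a₀ * p.c₂ / p.Δ

/-- The cubic vector field `(x (a₀x² + a₁xy + a₂y²), -y (b₀x² + b₁xy + b₂y²))`. -/
def field (z : ℝ × ℝ) : ℝ × ℝ :=
  (z.1 * (p.a₀ * z.1 ^ 2 + p.a₁ * z.1 * z.2 + p.a₂ * z.2 ^ 2),
    -z.2 * (p.b₀ * z.1 ^ 2 + p.b₁ * z.1 * z.2 + p.b₂ * z.2 ^ 2))

/-- The constant of the entry coordinate for the cubic field without higher order terms. -/
def entryConst (η : ℝ) : ℝ :=
  p.c₂ ^ (-1 / p.u) * η ^ (-p.a₂ / p.b₂) *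
    (∫ M in Ioi (0 : ℝ), M ^ (1 / p.β₀ - 1) /
      (p.c₀ + p.c₁ * M + p.c₂ * M ^ 2) ^ (1 / (2 * p.β₀) + 1 / (2 * p.β₂))) ^ p.β₂

/-- The constant of the exit coordinate for the cubic field without higher order terms. -/
def exitConst (ζ₀ : ℝ) : ℝ :=
  p.c₀ ^ (-1 / p.v) * ζ₀ ^ (-p.b₀ / p.a₀) *
    (∫ M in Ioi (0 : ℝ), M ^ (1 / p.β₂ - 1) /
      (p.c₀ * M ^ 2 + p.c₁ * M + p.c₂) ^ (1 / (2 * p.β₀) + 1 / (2 * p.β₂))) ^ p.β₀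

end CubicCoeffs

/-- `X` is a `C³` planar vector field near the origin that equals the cubic field with
coefficients `p` up to terms of order four and higher, and the coordinate axes (the stable and
unstable manifolds of the origin) are invariant near the origin. That the remainder `r` is of
order four is understood together with its first two derivatives: `Dᵏ r(z) = O(|z|^(4-k))`. -/
structure IsCubicNeutralSaddle (p : CubicCoeffs) (X : ℝ × ℝ → ℝ × ℝ) : Prop where
  contDiffAt : ContDiffAt ℝ 3 X 0
  remainder : ∀ k : ℕ, k ≤ 2 →
    (fun z => iteratedFDeriv ℝ k (fun w => X w - p.field w) z) =O[𝓝 0] fun z => ‖z‖ ^ (4 - k)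
  vertical_axis : ∀ᶠ y in 𝓝 (0 : ℝ), (X (0, y)).1 = 0
  horizontal_axis : ∀ᶠ x in 𝓝 (0 : ℝ), (X (x, 0)).2 = 0

/-- The integral curve of `X` that starts at `(ξ, η)` runs inside the rectangle
`[0, ζ₀] × [0, η]` until it first meets the outgoing transversal `{x = ζ₀}`, which happens at
time `T` and at the point `(ζ₀, ω)`. -/
def DulacPassage (X : ℝ × ℝ → ℝ × ℝ) (ζ₀ η ξ T ω : ℝ) : Prop :=
  0 ≤ T ∧ ∃ γ : ℝ → ℝ × ℝ,
    γ 0 = (ξ, η) ∧ γ T = (ζ₀, ω) ∧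
    (∀ t ∈ Icc 0 T, HasDerivWithinAt γ (X (γ t)) (Icc 0 T) t) ∧
    (∀ t ∈ Icc 0 T, γ t ∈ Icc 0 ζ₀ ×ˢ Icc 0 η) ∧
    ∀ t ∈ Ico 0 T, (γ t).1 < ζ₀

end

/-! Write `w = log y - log x` and `Q = c₀x² + c₁xy + c₂y²`, a positive definite form. The condition
on the coefficients says that `I = x^μ y^ν Q^σ` is a first integral of the cubic field
(`Admissible.first_integral`). Since `μ + ν + 2σ = 1`, it is homogeneous of degree one; `logScale`
is `log I`. For the full field, `log I` drifts at a rate `O(|z|³)`, while `w` decreases at a rate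
comparable with `|z|²`, so that `w` serves as a clock. The quotient `|z| / I` is homogeneous of
degree zero and comparable with `e^{μw} + e^{-νw}`. Hence the derivative of `1 / I` with respect to
`w` is bounded by an explicit integrable function of `w`, and near the origin `I` stays constant up
to a factor of two along every orbit (`IsOrbit.exp_neg_logScale_le_two_mul`).

A passage is cut where it meets the diagonal; let `S` be the value of `log I` there. Exchanging the
coordinates and reversing time turns the exit half into an entry half (`IsOrbit.swap`), so only the
entry half is analysed (`Admissible.exists_entry_asymptotics`). Two facts describe it.

Coordinate: subtracting from `log I` a function `K(y)`, the drift accumulated along the vertical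
axis, leaves a drift that vanishes on the axis. Then `log I - K` changes only by `O(e^S (1 + |S|))`
up to the diagonal. At the entry `log I` is `μ log ξ + (1 - μ) log η + σ log c₂` up to `O(e^S)`,
which determines `ξ` from `S`.

Time: the ratio `m = x / y` satisfies `m' = m Q` under the cubic field, so on a level of `I` time is
`I⁻²` times an integral over `m`. The two halves together give `T e^{2S} = J + O(e^S)`, where `J` is
the integral over the half-line.

Eliminating `S` gives the power laws with `β₂ = 1 / (2μ)` and `β₀ = 1 / (2ν)`. If the remainder
vanishes, so do the corrections, and the constants become explicit. The error obtained is `T^{-1/2}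
log T`; the term with `βstar` is only slack.

Existence of a passage comes from Picard-Lindelöf for a field cut off outside a square, together
with a Lyapunov function that bounds the time. A passage of prescribed large time comes from the
intermediate value theorem, since the passage time depends continuously on `ξ` and is unbounded as
`ξ` tends to zero. -/

noncomputable section

/-! ### The first integral of the cubic field and its quadratic form -/

namespace CubicCoeffs

variable (p : CubicCoeffs)

/-- The exponent of `x` in the first integral of degree one. -/
def μ : ℝ := p.b₂ / p.c₂

/-- The exponent of `y` in the first integral of degree one. -/
def ν : ℝ := p.a₀ / p.c₀

/-- The exponent of the quadratic form in the first integral of degree one. -/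
def σ : ℝ := p.Δ / (2 * p.c₀ * p.c₂)

def quad (x y : ℝ) : ℝ := p.c₀ * x ^ 2 + p.c₁ * x * y + p.c₂ * y ^ 2

def xForm (x y : ℝ) : ℝ := p.a₀ * x ^ 2 + p.a₁ * x * y + p.a₂ * y ^ 2

def yForm (x y : ℝ) : ℝ := p.b₀ * x ^ 2 + p.b₁ * x * y + p.b₂ * y ^ 2

/-- The logarithm of the first integral of degree one of the cubic field. -/
def logScale (x y : ℝ) : ℝ :=
  p.μ * Real.log x + p.ν * Real.log y + p.σ * Real.log (p.quad x y)

/-- The coefficients after exchanging the coordinates and reversing time. -/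
def swap : CubicCoeffs := ⟨p.b₂, p.b₁, p.b₀, p.a₂, p.a₁, p.a₀⟩

lemma swap_c₀ : p.swap.c₀ = p.c₂ := by simp only [swap, c₀, c₂]; ring
lemma swap_c₁ : p.swap.c₁ = p.c₁ := by simp only [swap, c₁]; ring
lemma swap_c₂ : p.swap.c₂ = p.c₀ := by simp only [swap, c₀, c₂]; ring
lemma swap_Δ : p.swap.Δ = p.Δ := by simp only [swap, Δ]; ring
lemma swap_μ : p.swap.μ = p.ν := by simp only [μ, ν, swap_c₂]; simp [swap]
lemma swap_ν : p.swap.ν = p.μ := by simp only [μ, ν, swap_c₀]; simp [swap]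
lemma swap_σ : p.swap.σ = p.σ := by
  simp only [σ, swap_c₀, swap_c₂, swap_Δ]; congr 1; ring
lemma swap_quad (x y : ℝ) : p.swap.quad x y = p.quad y x := by
  simp only [quad, swap_c₀, swap_c₁, swap_c₂]; ring
lemma swap_xForm (x y : ℝ) : p.swap.xForm x y = p.yForm y x := by
  simp only [xForm, yForm, swap]; ring
lemma swap_yForm (x y : ℝ) : p.swap.yForm x y = p.xForm y x := by
  simp only [xForm, yForm, swap]; ring
lemma swap_logScale (x y : ℝ) : p.swap.logScale x y = p.logScale y x := by
  simp only [logScale, swap_μ, swap_ν, swap_σ, swap_quad]; ring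

lemma xForm_add_yForm (x y : ℝ) : p.xForm x y + p.yForm x y = p.quad x y := by
  simp only [xForm, yForm, quad, c₀, c₁, c₂]; ring

variable {p}

namespace Admissible

variable (hp : p.Admissible)
include hp

lemma c₀_pos : 0 < p.c₀ := add_pos_of_pos_of_nonneg hp.a₀_pos hp.b₀_nonneg

lemma c₂_pos : 0 < p.c₂ := add_pos_of_nonneg_of_pos hp.a₂_nonneg hp.b₂_pos

lemma μ_pos : 0 < p.μ := div_pos hp.b₂_pos hp.c₂_pos

lemma ν_pos : 0 < p.ν := div_pos hp.a₀_pos hp.c₀_pos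

lemma μ_le_one : p.μ ≤ 1 := by
  rw [μ, div_le_one hp.c₂_pos, c₂]; linarith [hp.a₂_nonneg]

lemma ν_le_one : p.ν ≤ 1 := by
  rw [ν, div_le_one hp.c₀_pos, c₀]; linarith [hp.b₀_nonneg]

/-- This is the homogeneity of degree one of the first integral; all comparisons of `x + y` with the
first integral rest on it. -/
lemma two_mul_σ : 2 * p.σ = 1 - p.μ - p.ν := by
  have h0 := hp.c₀_pos.ne'
  have h2 := hp.c₂_pos.ne'
  simp only [σ, μ, ν]
  field_simp
  simp only [Δ, c₀, c₂]
  ring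

lemma swap : p.swap.Admissible where
  a₀_pos := hp.b₂_pos
  b₂_pos := hp.a₀_pos
  a₂_nonneg := hp.b₀_nonneg
  b₀_nonneg := hp.a₂_nonneg
  Δ_ne_zero := by rw [swap_Δ]; exact hp.Δ_ne_zero
  definite := by
    rw [swap_c₀, swap_c₁, swap_c₂]; linarith [hp.definite]

lemma exists_quad_lower : ∃ l : ℝ, 0 < l ∧ ∀ x y : ℝ, l * (x + y) ^ 2 ≤ p.quad x y := by
  have h0 := hp.c₀_pos
  have h2 := hp.c₂_pos
  have hd := hp.definite
  have hs : 0 < p.c₀ + p.c₂ - p.c₁ := by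
    by_contra h
    push Not at h
    nlinarith [sq_nonneg (p.c₀ - p.c₂)]
  -- The constant is the minimum of the form on the line `x + y = 1`; the difference of the two
  -- sides is then a perfect square, up to a positive factor.
  refine ⟨(p.c₀ * p.c₂ - p.c₁ ^ 2 / 4) / (p.c₀ + p.c₂ - p.c₁), div_pos (by linarith) hs, ?_⟩
  intro x y
  rw [div_mul_eq_mul_div, div_le_iff₀ hs]
  simp only [quad]
  nlinarith [sq_nonneg ((p.c₀ - p.c₁ / 2) * x - (p.c₂ - p.c₁ / 2) * y)]

lemma exists_quad_upper :
    ∃ L : ℝ, 0 < L ∧ ∀ x y : ℝ, 0 ≤ x → 0 ≤ y → p.quad x y ≤ L * (x + y) ^ 2 := by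
  have h0 := hp.c₀_pos
  have h2 := hp.c₂_pos
  refine ⟨p.c₀ + |p.c₁| + p.c₂, by positivity, fun x y hx hy => ?_⟩
  have hxy := mul_nonneg hx hy
  have h1 : p.c₁ * x * y ≤ |p.c₁| * (x * y) := by
    rw [mul_assoc]; exact mul_le_mul_of_nonneg_right (le_abs_self _) hxy
  simp only [quad]
  nlinarith [mul_nonneg h0.le hxy, mul_nonneg h2.le hxy, mul_nonneg (abs_nonneg p.c₁) hxy,
    mul_nonneg h0.le (sq_nonneg y), mul_nonneg h2.le (sq_nonneg x),
    mul_nonneg (abs_nonneg p.c₁) (sq_nonneg x), mul_nonneg (abs_nonneg p.c₁) (sq_nonneg y)]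

lemma quad_pos {x y : ℝ} (h : 0 < x + y) : 0 < p.quad x y := by
  obtain ⟨l, hl, H⟩ := hp.exists_quad_lower
  exact lt_of_lt_of_le (by positivity) (H x y)

omit hp in
lemma _root_.CubicCoeffs.FirstIntegralCondition.swap (hL : p.FirstIntegralCondition) :
    p.swap.FirstIntegralCondition := by
  simp only [FirstIntegralCondition, CubicCoeffs.swap] at *
  linarith

/-- The first integral condition makes `logScale` constant along the cubic field. -/
lemma first_integral (hL : p.FirstIntegralCondition) (x y : ℝ) :
    p.xForm x y * (p.μ * p.quad x y + p.σ * (2 * p.c₀ * x ^ 2 + p.c₁ * x * y)) =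
      p.yForm x y * (p.ν * p.quad x y + p.σ * (p.c₁ * x * y + 2 * p.c₂ * y ^ 2)) := by
  have h0 := hp.c₀_pos.ne'
  have h2 := hp.c₂_pos.ne'
  simp only [FirstIntegralCondition] at hL
  simp only [σ, μ, ν]
  field_simp
  simp only [xForm, yForm, quad, Δ]
  simp only [c₀, c₁, c₂]
  -- The pure powers `x⁴` and `y⁴` cancel by the choice of the exponents; what is left is `x y`
  -- times the form times the defect in `hL`.
  linear_combination (-(x * y * ((p.a₀ + p.b₀) * x ^ 2 + (p.a₁ + p.b₁) * x * y + (p.a₂ + p.b₂) * y ^ 2))) * hL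

end Admissible

end CubicCoeffs

/-! ### Comparison of increments through derivatives -/

section Monotonicity

variable {F G F' G' : ℝ → ℝ} {a b : ℝ}

lemma antitoneOn_Icc_of_hasDerivWithinAt
    (hF : ∀ t ∈ Icc a b, HasDerivWithinAt F (F' t) (Icc a b) t)
    (h : ∀ t ∈ Icc a b, F' t ≤ 0) : AntitoneOn F (Icc a b) := by
  refine antitoneOn_of_hasDerivWithinAt_nonpos (convex_Icc a b)
    (fun t ht => (hF t ht).continuousWithinAt) (f' := F') ?_ ?_
  · intro t ht
    exact (hF t (interior_subset ht)).mono interior_subset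
  · intro t ht
    exact h t (interior_subset ht)

/-- If `F` changes at most as fast as `G` decreases, then so do the increments. -/
lemma abs_sub_le_of_abs_deriv_le
    (hF : ∀ t ∈ Icc a b, HasDerivWithinAt F (F' t) (Icc a b) t)
    (hG : ∀ t ∈ Icc a b, HasDerivWithinAt G (G' t) (Icc a b) t)
    (h : ∀ t ∈ Icc a b, |F' t| ≤ -G' t) {t u : ℝ} (ht : t ∈ Icc a b) (hu : u ∈ Icc a b)
    (htu : t ≤ u) : |F u - F t| ≤ G t - G u := by
  have h1 := antitoneOn_Icc_of_hasDerivWithinAt (fun s hs => (hG s hs).add (hF s hs))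
    (fun s hs => by linarith [h s hs, le_abs_self (F' s)]) ht hu htu
  have h2 := antitoneOn_Icc_of_hasDerivWithinAt (fun s hs => (hG s hs).sub (hF s hs))
    (fun s hs => by linarith [h s hs, neg_abs_le (F' s)]) ht hu htu
  simp only [Pi.add_apply, Pi.sub_apply] at h1 h2
  rw [abs_le]
  constructor <;> linarith

end Monotonicity

/-! ### Perturbed fields, their orbits and the time-reversing symmetry -/

/-- The relative higher order terms `f`, `g` of a vector field
`(x (a(x, y) + f(x, y)), -y (b(x, y) + g(x, y)))` on the square `[0, ρ]²`. -/
structure IsRemainder (f g : ℝ → ℝ → ℝ) (ρ C : ℝ) : Prop where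
  f_le : ∀ x ∈ Icc 0 ρ, ∀ y ∈ Icc 0 ρ, |f x y| ≤ C * (x + y) ^ 3
  g_le : ∀ x ∈ Icc 0 ρ, ∀ y ∈ Icc 0 ρ, |g x y| ≤ C * (x + y) ^ 3
  f_left : ∀ x ∈ Icc 0 ρ, ∀ y ∈ Icc 0 ρ, |f x y - f 0 y| ≤ C * x * (x + y) ^ 2
  g_left : ∀ x ∈ Icc 0 ρ, ∀ y ∈ Icc 0 ρ, |g x y - g 0 y| ≤ C * x * (x + y) ^ 2
  f_bot : ∀ x ∈ Icc 0 ρ, ∀ y ∈ Icc 0 ρ, |f x y - f x 0| ≤ C * y * (x + y) ^ 2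
  g_bot : ∀ x ∈ Icc 0 ρ, ∀ y ∈ Icc 0 ρ, |g x y - g x 0| ≤ C * y * (x + y) ^ 2
  f_left_cont : ContinuousOn (fun y => f 0 y) (Ioc 0 ρ)
  g_left_cont : ContinuousOn (fun y => g 0 y) (Ioc 0 ρ)
  f_bot_cont : ContinuousOn (fun x => f x 0) (Ioc 0 ρ)
  g_bot_cont : ContinuousOn (fun x => g x 0) (Ioc 0 ρ)

lemma IsRemainder.swap {f g : ℝ → ℝ → ℝ} {ρ C : ℝ} (h : IsRemainder f g ρ C) :
    IsRemainder (fun x y => g y x) (fun x y => f y x) ρ C where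
  f_le x hx y hy := by rw [add_comm x y]; exact h.g_le y hy x hx
  g_le x hx y hy := by rw [add_comm x y]; exact h.f_le y hy x hx
  f_left x hx y hy := by rw [add_comm x y]; exact h.g_bot y hy x hx
  g_left x hx y hy := by rw [add_comm x y]; exact h.f_bot y hy x hx
  f_bot x hx y hy := by rw [add_comm x y]; exact h.g_left y hy x hx
  g_bot x hx y hy := by rw [add_comm x y]; exact h.f_left y hy x hx
  f_left_cont := h.g_bot_cont
  g_left_cont := h.f_bot_cont
  f_bot_cont := h.g_left_cont
  g_bot_cont := h.f_left_cont

/-- `(x, y)` is an orbit of `(x (a(x, y) + f(x, y)), -y (b(x, y) + g(x, y)))` inside the square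
`(0, ρ]²` for times in `[t₁, t₂]`. -/
structure IsOrbit (p : CubicCoeffs) (f g : ℝ → ℝ → ℝ) (ρ : ℝ) (x y : ℝ → ℝ) (t₁ t₂ : ℝ) :
    Prop where
  x_pos : ∀ t ∈ Icc t₁ t₂, 0 < x t
  y_pos : ∀ t ∈ Icc t₁ t₂, 0 < y t
  x_le : ∀ t ∈ Icc t₁ t₂, x t ≤ ρ
  y_le : ∀ t ∈ Icc t₁ t₂, y t ≤ ρ
  x_deriv : ∀ t ∈ Icc t₁ t₂, HasDerivWithinAt x
    (x t * (p.xForm (x t) (y t) + f (x t) (y t))) (Icc t₁ t₂) t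
  y_deriv : ∀ t ∈ Icc t₁ t₂, HasDerivWithinAt y
    (-(y t * (p.yForm (x t) (y t) + g (x t) (y t)))) (Icc t₁ t₂) t

namespace IsOrbit

variable {p : CubicCoeffs} {f g : ℝ → ℝ → ℝ} {ρ : ℝ} {x y : ℝ → ℝ} {t₁ t₂ : ℝ}

lemma mono (h : IsOrbit p f g ρ x y t₁ t₂) {ρ' u₁ u₂ : ℝ} (hρ : ρ ≤ ρ') (h₁ : t₁ ≤ u₁)
    (h₂ : u₂ ≤ t₂) : IsOrbit p f g ρ' x y u₁ u₂ where
  x_pos t ht := h.x_pos t (Icc_subset_Icc h₁ h₂ ht)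
  y_pos t ht := h.y_pos t (Icc_subset_Icc h₁ h₂ ht)
  x_le t ht := (h.x_le t (Icc_subset_Icc h₁ h₂ ht)).trans hρ
  y_le t ht := (h.y_le t (Icc_subset_Icc h₁ h₂ ht)).trans hρ
  x_deriv t ht := (h.x_deriv t (Icc_subset_Icc h₁ h₂ ht)).mono (Icc_subset_Icc h₁ h₂)
  y_deriv t ht := (h.y_deriv t (Icc_subset_Icc h₁ h₂ ht)).mono (Icc_subset_Icc h₁ h₂)

lemma swap (h : IsOrbit p f g ρ x y t₁ t₂) :
    IsOrbit p.swap (fun x y => g y x) (fun x y => f y x) ρ (fun t => y (-t)) (fun t => x (-t))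
      (-t₂) (-t₁) := by
  have hm : ∀ t ∈ Icc (-t₂) (-t₁), -t ∈ Icc t₁ t₂ := fun t ht =>
    ⟨by linarith [ht.2], by linarith [ht.1]⟩
  have hneg : ∀ t, HasDerivWithinAt (fun s : ℝ => -s) (-1) (Icc (-t₂) (-t₁)) t := fun t =>
    (hasDerivAt_neg t).hasDerivWithinAt
  refine ⟨fun t ht => h.y_pos _ (hm t ht), fun t ht => h.x_pos _ (hm t ht),
    fun t ht => h.y_le _ (hm t ht), fun t ht => h.x_le _ (hm t ht), fun t ht => ?_, fun t ht => ?_⟩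
  · have := (h.y_deriv _ (hm t ht)).scomp t (hneg t) hm
    refine this.congr_deriv ?_
    simp only [CubicCoeffs.swap_xForm, smul_eq_mul]; ring
  · have := (h.x_deriv _ (hm t ht)).scomp t (hneg t) hm
    refine this.congr_deriv ?_
    simp only [CubicCoeffs.swap_yForm, smul_eq_mul]; ring

end IsOrbit

/-! ### The drift of the first integral under the perturbation -/

namespace CubicCoeffs

variable {p : CubicCoeffs}

variable (p) in
/-- The logarithmic derivative of the first integral in the direction of `x`. -/
def xWeight (x y : ℝ) : ℝ := p.μ + p.σ * (2 * p.c₀ * x ^ 2 + p.c₁ * x * y) / p.quad x y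

variable (p) in
/-- The derivative of `logScale` along the perturbed field. -/
def drift (f g : ℝ → ℝ → ℝ) (x y : ℝ) : ℝ :=
  f x y * p.xWeight x y - g x y * (1 - p.xWeight x y)

/-- The weight is homogeneous of degree zero and equals `μ` on the vertical axis, because its
numerator contains the factor `x`. The bound quantifies how fast it approaches `μ` there. -/
lemma Admissible.exists_xWeight_bound (hp : p.Admissible) : ∃ W : ℝ, 0 < W ∧
    ∀ x y : ℝ, 0 ≤ x → 0 ≤ y → 0 < x + y → |p.xWeight x y - p.μ| * (x + y) ≤ W * x := by
  obtain ⟨l, hl, H⟩ := hp.exists_quad_lower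
  have h0 := hp.c₀_pos
  refine ⟨(|p.σ| + 1) * (2 * p.c₀ + |p.c₁|) / l, by positivity, fun x y hx hy h => ?_⟩
  have hQ := hp.quad_pos h
  have h1 : |2 * p.c₀ * x ^ 2 + p.c₁ * x * y| ≤ (2 * p.c₀ + |p.c₁|) * (x * (x + y)) := by
    have : |p.c₁ * x * y| = |p.c₁| * (x * y) := by
      rw [abs_mul, abs_mul, abs_of_nonneg hx, abs_of_nonneg hy, mul_assoc]
    calc _ ≤ |2 * p.c₀ * x ^ 2| + |p.c₁ * x * y| := abs_add_le _ _
      _ = 2 * p.c₀ * x ^ 2 + |p.c₁| * (x * y) := by rw [this, abs_of_nonneg (by positivity)]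
      _ ≤ _ := by
        nlinarith [mul_nonneg h0.le (mul_nonneg hx hy), mul_nonneg (abs_nonneg p.c₁) (sq_nonneg x)]
  have h2 : p.xWeight x y - p.μ = p.σ * (2 * p.c₀ * x ^ 2 + p.c₁ * x * y) / p.quad x y := by
    simp only [xWeight]; ring
  rw [h2, abs_div, abs_mul, abs_of_pos hQ, div_mul_eq_mul_div, div_mul_eq_mul_div,
    div_le_div_iff₀ hQ hl]
  have hs : |p.σ| ≤ |p.σ| + 1 := by linarith
  calc |p.σ| * |2 * p.c₀ * x ^ 2 + p.c₁ * x * y| * (x + y) * l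
      ≤ (|p.σ| + 1) * ((2 * p.c₀ + |p.c₁|) * (x * (x + y))) * (x + y) * l := by gcongr
    _ = (|p.σ| + 1) * (2 * p.c₀ + |p.c₁|) * x * (l * (x + y) ^ 2) := by ring
    _ ≤ _ := by gcongr; exact H x y

/-- On the quadrant the definite form is comparable with `(x + y)²`, and `2σ = 1 - μ - ν`. -/
lemma Admissible.exists_abs_logScale_sub_le (hp : p.Admissible) : ∃ B : ℝ, 0 ≤ B ∧
    ∀ x y : ℝ, 0 < x → 0 < y →
      |p.logScale x y - (p.μ * Real.log x + p.ν * Real.log y +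
        (1 - p.μ - p.ν) * Real.log (x + y))| ≤ B := by
  obtain ⟨l, hl, H⟩ := hp.exists_quad_lower
  obtain ⟨L, hL, H'⟩ := hp.exists_quad_upper
  refine ⟨|p.σ| * (|Real.log l| + |Real.log L|), by positivity, fun x y hx hy => ?_⟩
  have hn : 0 < x + y := by positivity
  have hQ := hp.quad_pos hn
  have e : p.logScale x y - (p.μ * Real.log x + p.ν * Real.log y +
        (1 - p.μ - p.ν) * Real.log (x + y)) =
      p.σ * (Real.log (p.quad x y) - 2 * Real.log (x + y)) := by
    rw [← hp.two_mul_σ, logScale]; ring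
  rw [e, abs_mul]
  gcongr
  have h2 : Real.log ((x + y) ^ 2) = 2 * Real.log (x + y) := by
    rw [Real.log_pow]; norm_num
  have h3 : Real.log l + 2 * Real.log (x + y) ≤ Real.log (p.quad x y) := by
    rw [← h2, ← Real.log_mul hl.ne' (by positivity)]
    exact Real.log_le_log (by positivity) (H x y)
  have h4 : Real.log (p.quad x y) ≤ Real.log L + 2 * Real.log (x + y) := by
    rw [← h2, ← Real.log_mul hL.ne' (by positivity)]
    exact Real.log_le_log hQ (H' x y hx.le hy.le)
  rw [abs_le]
  constructor <;> linarith [neg_abs_le (Real.log l), le_abs_self (Real.log L),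
    abs_nonneg (Real.log l), abs_nonneg (Real.log L)]

end CubicCoeffs

namespace IsOrbit

variable {p : CubicCoeffs} {f g : ℝ → ℝ → ℝ} {ρ : ℝ} {x y : ℝ → ℝ} {t₁ t₂ : ℝ}

lemma hasDerivWithinAt_log_x (h : IsOrbit p f g ρ x y t₁ t₂) {t : ℝ} (ht : t ∈ Icc t₁ t₂) :
    HasDerivWithinAt (fun s => Real.log (x s)) (p.xForm (x t) (y t) + f (x t) (y t))
      (Icc t₁ t₂) t := by
  have hx := (h.x_pos t ht).ne'
  refine ((h.x_deriv t ht).log hx).congr_deriv ?_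
  field_simp

lemma hasDerivWithinAt_log_y (h : IsOrbit p f g ρ x y t₁ t₂) {t : ℝ} (ht : t ∈ Icc t₁ t₂) :
    HasDerivWithinAt (fun s => Real.log (y s)) (-(p.yForm (x t) (y t) + g (x t) (y t)))
      (Icc t₁ t₂) t := by
  have hy := (h.y_pos t ht).ne'
  refine ((h.y_deriv t ht).log hy).congr_deriv ?_
  field_simp

lemma hasDerivWithinAt_slope (h : IsOrbit p f g ρ x y t₁ t₂) {t : ℝ} (ht : t ∈ Icc t₁ t₂) :
    HasDerivWithinAt (fun s => Real.log (y s) - Real.log (x s))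
      (-(p.quad (x t) (y t) + (f (x t) (y t) + g (x t) (y t)))) (Icc t₁ t₂) t := by
  refine ((h.hasDerivWithinAt_log_y ht).sub (h.hasDerivWithinAt_log_x ht)).congr_deriv ?_
  rw [← p.xForm_add_yForm]; ring

/-- The cubic parts cancel by `first_integral`. By Euler's relation for degree one, the logarithmic
derivative in the direction of `y` is `1 - xWeight`, which leaves exactly `drift`. -/
lemma hasDerivWithinAt_logScale (h : IsOrbit p f g ρ x y t₁ t₂) (hp : p.Admissible)
    (hL : p.FirstIntegralCondition) {t : ℝ} (ht : t ∈ Icc t₁ t₂) :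
    HasDerivWithinAt (fun s => p.logScale (x s) (y s)) (p.drift f g (x t) (y t))
      (Icc t₁ t₂) t := by
  have hx := h.x_pos t ht
  have hy := h.y_pos t ht
  have hQ := hp.quad_pos (add_pos hx hy)
  have dQ : HasDerivWithinAt (fun s => p.quad (x s) (y s))
      ((2 * p.c₀ * x t ^ 2 + p.c₁ * x t * y t) * (p.xForm (x t) (y t) + f (x t) (y t)) -
        (p.c₁ * x t * y t + 2 * p.c₂ * y t ^ 2) * (p.yForm (x t) (y t) + g (x t) (y t)))
      (Icc t₁ t₂) t := by
    have d1 := ((h.x_deriv t ht).pow 2).const_mul p.c₀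
    have d2 := ((h.x_deriv t ht).const_mul p.c₁).mul (h.y_deriv t ht)
    have d3 := ((h.y_deriv t ht).pow 2).const_mul p.c₂
    refine ((d1.add d2).add d3).congr_deriv ?_
    simp only [Nat.cast_ofNat, Nat.add_one_sub_one, pow_one]
    ring
  have d := (((h.hasDerivWithinAt_log_x ht).const_mul p.μ).add
    ((h.hasDerivWithinAt_log_y ht).const_mul p.ν)).add ((dQ.log hQ.ne').const_mul p.σ)
  refine d.congr_deriv ?_
  have key := hp.first_integral hL (x t) (y t)
  have hs := hp.two_mul_σ
  have hν : p.ν = 1 - p.μ - 2 * p.σ := by linarith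
  have hQe : p.quad (x t) (y t) =
    p.c₀ * x t ^ 2 + p.c₁ * x t * y t + p.c₂ * y t ^ 2 := rfl
  simp only [CubicCoeffs.drift, CubicCoeffs.xWeight]
  field_simp
  rw [hν] at key ⊢
  rw [hQe] at key ⊢
  linear_combination key

end IsOrbit

/-! ### Pointwise estimates of the perturbed field -/

/-- Pointwise estimates of the perturbed field on the square `(0, ρ]²` with the constant `k`. -/
structure HasFieldBounds (p : CubicCoeffs) (f g : ℝ → ℝ → ℝ) (ρ k : ℝ) : Prop where
  one_le : 1 ≤ k
  sq_le : ∀ x ∈ Ioc 0 ρ, ∀ y ∈ Ioc 0 ρ, (x + y) ^ 2 ≤ k * (p.quad x y + (f x y + g x y))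
  sum_le : ∀ x ∈ Ioc 0 ρ, ∀ y ∈ Ioc 0 ρ, |f x y + g x y| ≤ k * (x + y) * p.quad x y
  drift_le : ∀ x ∈ Ioc 0 ρ, ∀ y ∈ Ioc 0 ρ, |p.drift f g x y| ≤ k * (x + y) ^ 3
  scale_le : ∀ x ∈ Ioc 0 ρ, ∀ y ∈ Ioc 0 ρ, (x + y) * Real.exp (-p.logScale x y) ≤
    k * (Real.exp (p.μ * (Real.log y - Real.log x)) +
      Real.exp (-(p.ν * (Real.log y - Real.log x))))
  le_scale : ∀ x ∈ Ioc 0 ρ, ∀ y ∈ Ioc 0 ρ, Real.exp (p.μ * (Real.log y - Real.log x)) +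
      Real.exp (-(p.ν * (Real.log y - Real.log x))) ≤
    k * ((x + y) * Real.exp (-p.logScale x y))
  incr_small : ∀ x ∈ Ioc 0 ρ, ∀ y ∈ Ioc 0 ρ, k ^ 4 * (1 / p.μ + 1 / p.ν) * (x + y) ≤ 1 / 3

lemma HasFieldBounds.mono {p : CubicCoeffs} {f g : ℝ → ℝ → ℝ} {ρ ρ' k : ℝ}
    (h : HasFieldBounds p f g ρ k) (hρ : ρ' ≤ ρ) : HasFieldBounds p f g ρ' k := by
  have hs : ∀ x ∈ Ioc 0 ρ', x ∈ Ioc 0 ρ := fun x hx => ⟨hx.1, hx.2.trans hρ⟩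
  exact ⟨h.one_le, fun x hx y hy => h.sq_le x (hs x hx) y (hs y hy),
    fun x hx y hy => h.sum_le x (hs x hx) y (hs y hy),
    fun x hx y hy => h.drift_le x (hs x hx) y (hs y hy),
    fun x hx y hy => h.scale_le x (hs x hx) y (hs y hy),
    fun x hx y hy => h.le_scale x (hs x hx) y (hs y hy),
    fun x hx y hy => h.incr_small x (hs x hx) y (hs y hy)⟩

namespace CubicCoeffs.Admissible

variable {p : CubicCoeffs} (hp : p.Admissible)
include hp

/-- The quotient of `x + y` by the first integral is homogeneous of degree zero, hence a function of
the slope `w = log y - log x`. It grows like `e^{μw}` near the vertical axis and like `e^{-νw}` near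
the horizontal one. -/
lemma exists_scale_bounds : ∃ k : ℝ, 0 < k ∧ ∀ x y : ℝ, 0 < x → 0 < y →
    (x + y) * Real.exp (-p.logScale x y) ≤
      k * (Real.exp (p.μ * (Real.log y - Real.log x)) +
        Real.exp (-(p.ν * (Real.log y - Real.log x)))) ∧
    Real.exp (p.μ * (Real.log y - Real.log x)) +
      Real.exp (-(p.ν * (Real.log y - Real.log x))) ≤
      k * ((x + y) * Real.exp (-p.logScale x y)) := by
  obtain ⟨B, hB, H⟩ := hp.exists_abs_logScale_sub_le
  have hμ := hp.μ_pos
  have hν := hp.ν_pos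
  have hμ1 := hp.μ_le_one
  have hν1 := hp.ν_le_one
  have hl2 : 0 ≤ Real.log 2 := Real.log_nonneg (by norm_num)
  -- The terms `log 2` come from replacing `x + y` by the larger coordinate; the factor 2 comes from
  -- estimating a sum of two exponentials.
  refine ⟨2 * Real.exp (B + 2 * Real.log 2), by positivity, fun x y hx hy => ?_⟩
  have hn : 0 < x + y := by positivity
  have h := abs_le.1 (H x y hx hy)
  have e : (x + y) * Real.exp (-p.logScale x y) =
      Real.exp (Real.log (x + y) - p.logScale x y) := by
    rw [sub_eq_add_neg, Real.exp_add, Real.exp_log hn]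
  have hxn : Real.log x ≤ Real.log (x + y) := Real.log_le_log hx (by linarith)
  have hyn : Real.log y ≤ Real.log (x + y) := Real.log_le_log hy (by linarith)
  rw [e]
  constructor
  · rcases le_total x y with hxy | hxy
    · have hny : Real.log (x + y) ≤ Real.log 2 + Real.log y := by
        rw [← Real.log_mul (by norm_num) hy.ne']
        exact Real.log_le_log hn (by linarith)
      have : Real.log (x + y) - p.logScale x y ≤
          (B + 2 * Real.log 2) + p.μ * (Real.log y - Real.log x) := by
        nlinarith
      calc _ ≤ Real.exp ((B + 2 * Real.log 2) + p.μ * (Real.log y - Real.log x)) :=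
            Real.exp_le_exp.2 this
        _ = Real.exp (B + 2 * Real.log 2) * Real.exp (p.μ * (Real.log y - Real.log x)) :=
            Real.exp_add _ _
        _ ≤ _ := by
          nlinarith [mul_pos (Real.exp_pos (B + 2 * Real.log 2))
            (Real.exp_pos (p.μ * (Real.log y - Real.log x))),
            mul_pos (Real.exp_pos (B + 2 * Real.log 2))
            (Real.exp_pos (-(p.ν * (Real.log y - Real.log x))))]
    · have hnx : Real.log (x + y) ≤ Real.log 2 + Real.log x := by
        rw [← Real.log_mul (by norm_num) hx.ne']
        exact Real.log_le_log hn (by linarith)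
      have : Real.log (x + y) - p.logScale x y ≤
          (B + 2 * Real.log 2) + -(p.ν * (Real.log y - Real.log x)) := by
        nlinarith
      calc _ ≤ Real.exp ((B + 2 * Real.log 2) + -(p.ν * (Real.log y - Real.log x))) :=
            Real.exp_le_exp.2 this
        _ = Real.exp (B + 2 * Real.log 2) * Real.exp (-(p.ν * (Real.log y - Real.log x))) :=
            Real.exp_add _ _
        _ ≤ _ := by
          nlinarith [mul_pos (Real.exp_pos (B + 2 * Real.log 2))
            (Real.exp_pos (p.μ * (Real.log y - Real.log x))),
            mul_pos (Real.exp_pos (B + 2 * Real.log 2))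
            (Real.exp_pos (-(p.ν * (Real.log y - Real.log x))))]
  · have h1 : p.μ * (Real.log y - Real.log x) ≤
        (B + 2 * Real.log 2) + (Real.log (x + y) - p.logScale x y) := by
      nlinarith
    have h2 : -(p.ν * (Real.log y - Real.log x)) ≤
        (B + 2 * Real.log 2) + (Real.log (x + y) - p.logScale x y) := by
      nlinarith
    calc _ ≤ Real.exp ((B + 2 * Real.log 2) + (Real.log (x + y) - p.logScale x y)) +
          Real.exp ((B + 2 * Real.log 2) + (Real.log (x + y) - p.logScale x y)) :=
          add_le_add (Real.exp_le_exp.2 h1) (Real.exp_le_exp.2 h2)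
      _ = _ := by rw [Real.exp_add]; ring

lemma exists_fieldBounds {f g : ℝ → ℝ → ℝ} {ρ₀ C : ℝ} (hρ₀ : 0 < ρ₀)
    (h : IsRemainder f g ρ₀ C) :
    ∃ ρ k : ℝ, 0 < ρ ∧ ρ ≤ ρ₀ ∧ HasFieldBounds p f g ρ k := by
  obtain ⟨l, hl, H⟩ := hp.exists_quad_lower
  obtain ⟨W, hW, HW⟩ := hp.exists_xWeight_bound
  obtain ⟨k₀, hk₀, Hk⟩ := hp.exists_scale_bounds
  have hμ := hp.μ_pos
  have hν := hp.ν_pos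
  obtain ⟨D, hD, hCD⟩ : ∃ D : ℝ, 0 < D ∧ C ≤ D := ⟨|C| + 1, by positivity, by
    linarith [le_abs_self C]⟩
  obtain ⟨k, hk1, hkl, hkD, hkW, hkk⟩ : ∃ k : ℝ, 1 ≤ k ∧ 2 / l ≤ k ∧ 2 * D / l ≤ k ∧
      D * (2 * (p.μ + W) + 1) ≤ k ∧ k₀ ≤ k :=
    ⟨max 1 (max (2 / l) (max (2 * D / l) (max (D * (2 * (p.μ + W) + 1)) k₀))), by simp⟩
  have hk0 : 0 < k := by linarith
  obtain ⟨E, hE⟩ : ∃ E : ℝ, E = k ^ 4 * (1 / p.μ + 1 / p.ν) := ⟨_, rfl⟩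
  have hE0 : 0 < E := by rw [hE]; positivity
  -- As `x + y ≤ 2ρ`, the bound `l / (8D)` keeps `f + g` below half of the lower bound of the form,
  -- and `1 / (6E)` yields the value `1 / 3` in `incr_small`.
  obtain ⟨ρ, hρ0, hρ1, hρ2, hρ3⟩ : ∃ ρ : ℝ, 0 < ρ ∧ ρ ≤ ρ₀ ∧ ρ ≤ l / (8 * D) ∧
      ρ ≤ 1 / (6 * E) :=
    ⟨min ρ₀ (min (l / (8 * D)) (1 / (6 * E))),
      lt_min hρ₀ (lt_min (by positivity) (by positivity)), by simp, by simp, by simp⟩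
  have hIcc : ∀ x ∈ Ioc 0 ρ, x ∈ Icc 0 ρ₀ := fun x hx => ⟨hx.1.le, hx.2.trans hρ1⟩
  have hf : ∀ x ∈ Ioc 0 ρ, ∀ y ∈ Ioc 0 ρ, |f x y| ≤ D * (x + y) ^ 3 := fun x hx y hy =>
    (h.f_le x (hIcc x hx) y (hIcc y hy)).trans (by
      have := add_pos hx.1 hy.1
      gcongr)
  have hg : ∀ x ∈ Ioc 0 ρ, ∀ y ∈ Ioc 0 ρ, |g x y| ≤ D * (x + y) ^ 3 := fun x hx y hy =>
    (h.g_le x (hIcc x hx) y (hIcc y hy)).trans (by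
      have := add_pos hx.1 hy.1
      gcongr)
  refine ⟨ρ, k, hρ0, hρ1, hk1, ?_, ?_, ?_, ?_, ?_, ?_⟩
  · intro x hx y hy
    have hn : 0 < x + y := add_pos hx.1 hy.1
    have h1 := (abs_le.1 (hf x hx y hy)).1
    have h2 := (abs_le.1 (hg x hx y hy)).1
    have h3 : 4 * D * (x + y) ≤ l := by
      have : x + y ≤ l / (8 * D) + l / (8 * D) := add_le_add (hx.2.trans hρ2) (hy.2.trans hρ2)
      calc 4 * D * (x + y) ≤ 4 * D * (l / (8 * D) + l / (8 * D)) := by gcongr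
        _ = l := by field_simp; norm_num
    have h4 : l / 2 * (x + y) ^ 2 ≤ p.quad x y + (f x y + g x y) := by
      have := H x y
      nlinarith [mul_le_mul_of_nonneg_right h3 (sq_nonneg (x + y))]
    calc (x + y) ^ 2 = 2 / l * (l / 2 * (x + y) ^ 2) := by field_simp
      _ ≤ k * (p.quad x y + (f x y + g x y)) := by gcongr
  · intro x hx y hy
    have hn : 0 < x + y := add_pos hx.1 hy.1
    calc |f x y + g x y| ≤ |f x y| + |g x y| := abs_add_le _ _
      _ ≤ D * (x + y) ^ 3 + D * (x + y) ^ 3 := add_le_add (hf x hx y hy) (hg x hx y hy)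
      _ = 2 * D / l * (x + y) * (l * (x + y) ^ 2) := by field_simp; ring
      _ ≤ k * (x + y) * p.quad x y := by gcongr; exact H x y
  · intro x hx y hy
    have hn : 0 < x + y := add_pos hx.1 hy.1
    have hw : |p.xWeight x y - p.μ| ≤ W := by
      have := HW x y hx.1.le hy.1.le hn
      have h2 : W * x ≤ W * (x + y) := by
        gcongr; linarith [hy.1]
      exact le_of_mul_le_mul_right (this.trans h2) hn
    have hw1 : |p.xWeight x y| ≤ p.μ + W := by
      have := abs_le.1 hw
      rw [abs_le]; constructor <;> linarith
    have hw2 : |1 - p.xWeight x y| ≤ p.μ + W + 1 := by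
      have := abs_le.1 hw1
      rw [abs_le]; constructor <;> linarith
    calc |p.drift f g x y| ≤ |f x y| * |p.xWeight x y| + |g x y| * |1 - p.xWeight x y| := by
          rw [drift, ← abs_mul, ← abs_mul]; exact abs_sub _ _
      _ ≤ D * (x + y) ^ 3 * (p.μ + W) + D * (x + y) ^ 3 * (p.μ + W + 1) := by
          gcongr
          · exact hf x hx y hy
          · exact hg x hx y hy
      _ = D * (2 * (p.μ + W) + 1) * (x + y) ^ 3 := by ring
      _ ≤ k * (x + y) ^ 3 := by gcongr
  · intro x hx y hy
    refine (Hk x y hx.1 hy.1).1.trans ?_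
    gcongr
  · intro x hx y hy
    refine (Hk x y hx.1 hy.1).2.trans ?_
    have := add_pos hx.1 hy.1
    gcongr
  · intro x hx y hy
    rw [← hE]
    have : x + y ≤ 1 / (6 * E) + 1 / (6 * E) := add_le_add (hx.2.trans hρ3) (hy.2.trans hρ3)
    calc E * (x + y) ≤ E * (1 / (6 * E) + 1 / (6 * E)) := by gcongr
      _ = 1 / 3 := by field_simp; norm_num

end CubicCoeffs.Admissible

/-! ### Near constancy of the first integral along orbits -/

namespace IsOrbit

variable {p : CubicCoeffs} {f g : ℝ → ℝ → ℝ} {ρ k : ℝ} {x y : ℝ → ℝ} {t₁ t₂ : ℝ}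

lemma x_mem (h : IsOrbit p f g ρ x y t₁ t₂) {t : ℝ} (ht : t ∈ Icc t₁ t₂) : x t ∈ Ioc 0 ρ :=
  ⟨h.x_pos t ht, h.x_le t ht⟩

lemma y_mem (h : IsOrbit p f g ρ x y t₁ t₂) {t : ℝ} (ht : t ∈ Icc t₁ t₂) : y t ∈ Ioc 0 ρ :=
  ⟨h.y_pos t ht, h.y_le t ht⟩

lemma rate_pos (h : IsOrbit p f g ρ x y t₁ t₂) (hb : HasFieldBounds p f g ρ k) {t : ℝ}
    (ht : t ∈ Icc t₁ t₂) :
    0 < p.quad (x t) (y t) + (f (x t) (y t) + g (x t) (y t)) := by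
  have h1 := hb.sq_le _ (h.x_mem ht) _ (h.y_mem ht)
  have h2 := hb.one_le
  have h3 : 0 < (x t + y t) ^ 2 := by
    have := h.x_pos t ht
    have := h.y_pos t ht
    positivity
  by_contra h4
  push Not at h4
  nlinarith

lemma slope_antitoneOn (h : IsOrbit p f g ρ x y t₁ t₂) (hb : HasFieldBounds p f g ρ k) :
    AntitoneOn (fun t => Real.log (y t) - Real.log (x t)) (Icc t₁ t₂) :=
  antitoneOn_Icc_of_hasDerivWithinAt (fun _ ht => h.hasDerivWithinAt_slope ht)
    (fun _ ht => by linarith [h.rate_pos hb ht])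

/-- The inverse of the first integral varies by at most the increment of a function of the
slope. -/
lemma abs_exp_neg_logScale_sub_le (h : IsOrbit p f g ρ x y t₁ t₂)
    (hb : HasFieldBounds p f g ρ k) (hp : p.Admissible) (hL : p.FirstIntegralCondition)
    {t u : ℝ} (ht : t ∈ Icc t₁ t₂) (hu : u ∈ Icc t₁ t₂) (htu : t ≤ u) :
    |Real.exp (-p.logScale (x u) (y u)) - Real.exp (-p.logScale (x t) (y t))| ≤
      k ^ 3 * (Real.exp (p.μ * (Real.log (y t) - Real.log (x t))) / p.μ -
        Real.exp (-(p.ν * (Real.log (y t) - Real.log (x t)))) / p.ν) -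
      k ^ 3 * (Real.exp (p.μ * (Real.log (y u) - Real.log (x u))) / p.μ -
        Real.exp (-(p.ν * (Real.log (y u) - Real.log (x u)))) / p.ν) := by
  have hμ := hp.μ_pos.ne'
  have hν := hp.ν_pos.ne'
  have hk := hb.one_le
  refine abs_sub_le_of_abs_deriv_le
    (F := fun s => Real.exp (-p.logScale (x s) (y s)))
    (G := fun s => k ^ 3 * (Real.exp (p.μ * (Real.log (y s) - Real.log (x s))) / p.μ -
        Real.exp (-(p.ν * (Real.log (y s) - Real.log (x s)))) / p.ν))
    (fun s hs => (h.hasDerivWithinAt_logScale hp hL hs).fun_neg.exp)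
    (fun s hs => (((((h.hasDerivWithinAt_slope hs).const_mul p.μ).exp.div_const p.μ).sub
      ((((h.hasDerivWithinAt_slope hs).const_mul p.ν).fun_neg.exp).div_const p.ν)).const_mul (k ^ 3)))
    (fun s hs => ?_) ht hu htu
  have hn : 0 < x s + y s := add_pos (h.x_pos s hs) (h.y_pos s hs)
  have h1 := hb.drift_le _ (h.x_mem hs) _ (h.y_mem hs)
  have h2 := hb.sq_le _ (h.x_mem hs) _ (h.y_mem hs)
  have h3 := hb.scale_le _ (h.x_mem hs) _ (h.y_mem hs)
  have h4 := h.rate_pos hb hs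
  set P := Real.exp (-p.logScale (x s) (y s))
  set w := Real.log (y s) - Real.log (x s)
  set N := p.quad (x s) (y s) + (f (x s) (y s) + g (x s) (y s))
  have hP : 0 < P := Real.exp_pos _
  -- Two of the three factors `x + y` are paid for by the rate of the slope. The remaining `(x + y)
  -- P` has degree zero and is bounded by exponentials of the slope, whose product with the rate is
  -- an exact derivative.
  calc |P * -p.drift f g (x s) (y s)| = P * |p.drift f g (x s) (y s)| := by
        rw [abs_mul, abs_neg, abs_of_pos hP]
    _ ≤ P * (k * (x s + y s) ^ 3) := by gcongr
    _ = k * (x s + y s) ^ 2 * ((x s + y s) * P) := by ring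
    _ ≤ k * (k * N) * (k * (Real.exp (p.μ * w) + Real.exp (-(p.ν * w)))) := by gcongr
    _ = _ := by field_simp; ring

/-- The first integral is constant along an orbit up to a factor of two. -/
lemma exp_neg_logScale_le_two_mul (h : IsOrbit p f g ρ x y t₁ t₂)
    (hb : HasFieldBounds p f g ρ k) (hp : p.Admissible) (hL : p.FirstIntegralCondition)
    {t u : ℝ} (ht : t ∈ Icc t₁ t₂) (hu : u ∈ Icc t₁ t₂) :
    Real.exp (-p.logScale (x u) (y u)) ≤ 2 * Real.exp (-p.logScale (x t) (y t)) := by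
  have hμ := hp.μ_pos
  have hν := hp.ν_pos
  have hk := hb.one_le
  -- Two of the four boundary terms have the favourable sign. Each of the others is at most a third
  -- of the value of `P` at its own end, by `incr_small`. A difference of at most a third of the sum
  -- means a ratio of at most two.
  have key : ∀ {t u : ℝ}, t ∈ Icc t₁ t₂ → u ∈ Icc t₁ t₂ → t ≤ u →
      |Real.exp (-p.logScale (x u) (y u)) - Real.exp (-p.logScale (x t) (y t))| ≤
      1 / 3 * (Real.exp (-p.logScale (x u) (y u)) + Real.exp (-p.logScale (x t) (y t))) := by
    intro t u ht hu htu
    refine (h.abs_exp_neg_logScale_sub_le hb hp hL ht hu htu).trans ?_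
    have e1 := hb.le_scale _ (h.x_mem ht) _ (h.y_mem ht)
    have e2 := hb.le_scale _ (h.x_mem hu) _ (h.y_mem hu)
    have i1 := hb.incr_small _ (h.x_mem ht) _ (h.y_mem ht)
    have i2 := hb.incr_small _ (h.x_mem hu) _ (h.y_mem hu)
    set P := Real.exp (-p.logScale (x t) (y t))
    set P' := Real.exp (-p.logScale (x u) (y u))
    have hP : 0 < P := Real.exp_pos _
    have hP' : 0 < P' := Real.exp_pos _
    set a := Real.exp (p.μ * (Real.log (y t) - Real.log (x t)))
    set b := Real.exp (-(p.ν * (Real.log (y t) - Real.log (x t))))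
    set a' := Real.exp (p.μ * (Real.log (y u) - Real.log (x u)))
    set b' := Real.exp (-(p.ν * (Real.log (y u) - Real.log (x u))))
    have ha : 0 < a := Real.exp_pos _
    have hb0 : 0 < b := Real.exp_pos _
    have ha' : 0 < a' := Real.exp_pos _
    have hb' : 0 < b' := Real.exp_pos _
    have f1 : k ^ 3 * (a / p.μ) ≤ 1 / 3 * P := by
      have hle : a ≤ k * ((x t + y t) * P) := by linarith
      calc k ^ 3 * (a / p.μ) ≤ k ^ 3 * ((k * ((x t + y t) * P)) / p.μ +
              (k * ((x t + y t) * P)) / p.ν) := by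
            have : 0 ≤ (k * ((x t + y t) * P)) / p.ν := by
              have := h.x_pos t ht
              have := h.y_pos t ht
              positivity
            have : a / p.μ ≤ (k * ((x t + y t) * P)) / p.μ := by gcongr
            gcongr
            linarith
        _ = k ^ 4 * (1 / p.μ + 1 / p.ν) * (x t + y t) * P := by ring
        _ ≤ 1 / 3 * P := by gcongr
    have f2 : k ^ 3 * (b' / p.ν) ≤ 1 / 3 * P' := by
      have hle : b' ≤ k * ((x u + y u) * P') := by linarith
      calc k ^ 3 * (b' / p.ν) ≤ k ^ 3 * ((k * ((x u + y u) * P')) / p.μ +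
              (k * ((x u + y u) * P')) / p.ν) := by
            have : 0 ≤ (k * ((x u + y u) * P')) / p.μ := by
              have := h.x_pos u hu
              have := h.y_pos u hu
              positivity
            have : b' / p.ν ≤ (k * ((x u + y u) * P')) / p.ν := by gcongr
            gcongr
            linarith
        _ = k ^ 4 * (1 / p.μ + 1 / p.ν) * (x u + y u) * P' := by ring
        _ ≤ 1 / 3 * P' := by gcongr
    have f3 : 0 ≤ k ^ 3 * (b / p.ν) := by positivity
    have f4 : 0 ≤ k ^ 3 * (a' / p.μ) := by positivity
    linarith
  rcases le_total t u with htu | htu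
  · have := (abs_le.1 (key ht hu htu)).2
    linarith
  · have := (abs_le.1 (key hu ht htu)).1
    linarith

end IsOrbit

/-! ### Time as an integral over the slope, and the correction near the axis -/

namespace CubicCoeffs

variable (p : CubicCoeffs)

/-- The density of the passage time of the cubic field with respect to the slope `x / y`. -/
def timeDensity (m : ℝ) : ℝ := m ^ (2 * p.μ - 1) / p.quad m 1 ^ (p.μ + p.ν)

/-- The passage time on the unit level of the first integral up to the slope `x / y = m`. -/
def timeIntegral (m : ℝ) : ℝ := ∫ z in (0 : ℝ)..m, p.timeDensity z

variable {p}

namespace Admissible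

variable (hp : p.Admissible)
include hp

lemma timeDensity_nonneg {m : ℝ} (hm : 0 ≤ m) : 0 ≤ p.timeDensity m := by
  have : 0 < p.quad m 1 := hp.quad_pos (by linarith)
  unfold timeDensity
  positivity

lemma continuousOn_quad_rpow (e : ℝ) :
    ContinuousOn (fun m => (p.quad m 1 ^ e)⁻¹) (Ici 0) := by
  have hc : Continuous fun m => p.quad m 1 := by unfold quad; fun_prop
  have hq : ∀ m ∈ Ici (0 : ℝ), 0 < p.quad m 1 := fun m hm => hp.quad_pos (by
    have : (0 : ℝ) ≤ m := hm
    linarith)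
  refine ContinuousOn.inv₀ (hc.continuousOn.rpow_const fun m hm => Or.inl (hq m hm).ne') ?_
  exact fun m hm => (Real.rpow_pos_of_pos (hq m hm) _).ne'

lemma intervalIntegrable_timeDensity {m : ℝ} (hm : 0 ≤ m) :
    IntervalIntegrable p.timeDensity MeasureTheory.volume 0 m := by
  have h1 : IntervalIntegrable (fun z : ℝ => z ^ (2 * p.μ - 1)) MeasureTheory.volume 0 m :=
    intervalIntegral.intervalIntegrable_rpow' (by linarith [hp.μ_pos])
  refine h1.mul_continuousOn ((hp.continuousOn_quad_rpow (p.μ + p.ν)).mono ?_)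
  rw [uIcc_of_le hm]
  exact Icc_subset_Ici_self

lemma continuousAt_timeDensity {m : ℝ} (hm : 0 < m) : ContinuousAt p.timeDensity m :=
  (Real.continuousAt_rpow_const m _ (Or.inl hm.ne')).mul
    ((hp.continuousOn_quad_rpow (p.μ + p.ν)).continuousAt (Ici_mem_nhds hm))

lemma hasDerivAt_timeIntegral {m : ℝ} (hm : 0 < m) :
    HasDerivAt p.timeIntegral (p.timeDensity m) m := by
  refine intervalIntegral.integral_hasDerivAt_right (hp.intervalIntegrable_timeDensity hm.le) ?_
    (hp.continuousAt_timeDensity hm)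
  refine ContinuousAt.stronglyMeasurableAtFilter isOpen_Ioi (s := Ioi 0) ?_ m hm
  exact fun z hz => hp.continuousAt_timeDensity hz

/-- The form is bounded below by a positive constant on `[0, ∞) × {1}`, which leaves the integrable
power `z^(2μ - 1)`. The bound controls the piece of the time integral below the entry ratio. -/
lemma exists_timeIntegral_bound : ∃ k : ℝ, 0 < k ∧ ∀ m : ℝ, 0 < m →
    0 ≤ p.timeIntegral m ∧ p.timeIntegral m ≤ k * m ^ (2 * p.μ) := by
  obtain ⟨l, hl, H⟩ := hp.exists_quad_lower
  have hμ := hp.μ_pos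
  have hν := hp.ν_pos
  refine ⟨(l ^ (p.μ + p.ν))⁻¹ / (2 * p.μ), by positivity, fun m hm => ⟨?_, ?_⟩⟩
  · exact intervalIntegral.integral_nonneg hm.le fun z hz => hp.timeDensity_nonneg hz.1
  · have h1 : IntervalIntegrable (fun z : ℝ => z ^ (2 * p.μ - 1)) MeasureTheory.volume 0 m :=
      intervalIntegral.intervalIntegrable_rpow' (by linarith)
    have h2 : p.timeIntegral m ≤ ∫ z in (0 : ℝ)..m, z ^ (2 * p.μ - 1) * (l ^ (p.μ + p.ν))⁻¹ := by
      refine intervalIntegral.integral_mono_on hm.le (hp.intervalIntegrable_timeDensity hm.le)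
        (h1.mul_const _) fun z hz => ?_
      have hz0 : 0 ≤ z := hz.1
      have : l ≤ p.quad z 1 := le_trans (by nlinarith [mul_nonneg hl.le hz0, mul_nonneg hl.le (sq_nonneg z)]) (H z 1)
      rw [timeDensity, div_eq_mul_inv]
      gcongr
    refine h2.trans (le_of_eq ?_)
    rw [intervalIntegral.integral_mul_const, integral_rpow (Or.inl (by linarith))]
    rw [sub_add_cancel, Real.zero_rpow (by positivity)]
    ring

/-- Under the cubic field `m = x / y` has the derivative `m Q`. The identity therefore says that
`timeDensity m dm` is the square of the first integral times `dt`. -/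
lemma timeDensity_mul {x y : ℝ} (hx : 0 < x) (hy : 0 < y) :
    p.timeDensity (x / y) * (x / y) * p.quad x y = Real.exp (2 * p.logScale x y) := by
  have hQ := hp.quad_pos (add_pos hx hy)
  have e1 : p.quad (x / y) 1 = p.quad x y / y ^ 2 := by
    simp only [quad]; field_simp
  have hm : 0 < x / y := by positivity
  have e2 : Real.log (x / y) = Real.log x - Real.log y := Real.log_div hx.ne' hy.ne'
  have e3 : Real.log (p.quad x y / y ^ 2) = Real.log (p.quad x y) - 2 * Real.log y := by
    rw [Real.log_div hQ.ne' (by positivity), Real.log_pow]; norm_num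
  have e4 : p.timeDensity (x / y) * (x / y) * p.quad x y =
      Real.exp (Real.log (x / y) * (2 * p.μ - 1)) /
        Real.exp (Real.log (p.quad x y / y ^ 2) * (p.μ + p.ν)) *
        Real.exp (Real.log (x / y)) * Real.exp (Real.log (p.quad x y)) := by
    rw [timeDensity, e1, Real.rpow_def_of_pos hm, Real.rpow_def_of_pos (by positivity),
      Real.exp_log hm, Real.exp_log hQ]
  rw [e4, ← Real.exp_sub, ← Real.exp_add, ← Real.exp_add, e2, e3]
  congr 1
  have := hp.two_mul_σ
  rw [logScale]
  linear_combination (-Real.log (p.quad x y)) * this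

/-- Relative to `c₂ y²`, the other two terms of the form are of order `x / y`. At the entry this
replaces the form by its value on the axis. -/
lemma exists_abs_log_quad_sub_le : ∃ k : ℝ, 0 < k ∧ ∀ x y : ℝ, 0 < x → x ≤ y →
    |Real.log (p.quad x y) - Real.log p.c₂ - 2 * Real.log y| ≤ k * (x / y) := by
  obtain ⟨l, hl, H⟩ := hp.exists_quad_lower
  have h0 := hp.c₀_pos
  have h2 := hp.c₂_pos
  refine ⟨(p.c₀ + |p.c₁|) / l, by positivity, fun x y hx hxy => ?_⟩
  have hy : 0 < y := hx.trans_le hxy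
  have hQ := hp.quad_pos (add_pos hx hy)
  have e : Real.log p.c₂ + 2 * Real.log y = Real.log (p.c₂ * y ^ 2) := by
    rw [Real.log_mul h2.ne' (by positivity), Real.log_pow]; norm_num
  have hB : 0 < p.c₂ * y ^ 2 := by positivity
  have hA1 : l * y ^ 2 ≤ p.quad x y := le_trans (by gcongr; linarith) (H x y)
  have hB1 : l * y ^ 2 ≤ p.c₂ * y ^ 2 := by
    have := H 0 y
    simpa [quad] using this
  have hd : |p.quad x y - p.c₂ * y ^ 2| ≤ (p.c₀ + |p.c₁|) * (x * y) := by
    have : p.quad x y - p.c₂ * y ^ 2 = p.c₀ * (x * x) + p.c₁ * (x * y) := by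
      simp only [quad]; ring
    rw [this]
    calc _ ≤ |p.c₀ * (x * x)| + |p.c₁ * (x * y)| := abs_add_le _ _
      _ = p.c₀ * (x * x) + |p.c₁| * (x * y) := by
        rw [abs_of_nonneg (by positivity), abs_mul, abs_of_nonneg (mul_pos hx hy).le]
      _ ≤ p.c₀ * (x * y) + |p.c₁| * (x * y) := by gcongr
      _ = _ := by ring
  have hlog : ∀ A B : ℝ, l * y ^ 2 ≤ A → l * y ^ 2 ≤ B → |A - B| ≤ (p.c₀ + |p.c₁|) * (x * y) →
      Real.log A - Real.log B ≤ (p.c₀ + |p.c₁|) / l * (x / y) := by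
    intro A B hA hB hAB
    have hly : 0 < l * y ^ 2 := by positivity
    have hA0 : 0 < A := by linarith
    have hB0 : 0 < B := by linarith
    rw [← Real.log_div hA0.ne' hB0.ne']
    calc Real.log (A / B) ≤ A / B - 1 := Real.log_le_sub_one_of_pos (by positivity)
      _ = (A - B) / B := by field_simp
      _ ≤ (p.c₀ + |p.c₁|) * (x * y) / B := by gcongr; exact (le_abs_self _).trans hAB
      _ ≤ (p.c₀ + |p.c₁|) * (x * y) / (l * y ^ 2) := by gcongr
      _ = _ := by field_simp
  rw [sub_sub, e, abs_le]
  constructor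
  · have := hlog _ _ hB1 hA1 (by rwa [abs_sub_comm])
    linarith
  · exact hlog _ _ hA1 hB1 hd

/-- Near the vertical axis, subtracting a function of `y` from `logScale` makes its derivative
along the perturbed field vanish on the axis. -/
lemma exists_correction {f g : ℝ → ℝ → ℝ} {ρ₀ C : ℝ} (hρ₀ : 0 < ρ₀) (h : IsRemainder f g ρ₀ C) :
    ∃ ρ C' : ℝ, 0 < ρ ∧ ρ ≤ ρ₀ ∧ 0 < C' ∧ ∃ K κ : ℝ → ℝ,
      (∀ y ∈ Ioc 0 ρ, HasDerivAt K (κ y) y) ∧ (∀ y ∈ Ioc 0 ρ, |K y| ≤ C' * y) ∧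
      (∀ x y : ℝ, 0 < x → x ≤ y → y ≤ ρ →
        |p.drift f g x y + κ y * (y * (p.yForm x y + g x y))| ≤ C' * x * y ^ 2) ∧
      ((∀ x ∈ Icc 0 ρ₀, ∀ y ∈ Icc 0 ρ₀, f x y = 0 ∧ g x y = 0) → ∀ y ∈ Ioc 0 ρ, K y = 0) := by
  obtain ⟨W, hW, HW⟩ := hp.exists_xWeight_bound
  have hμ := hp.μ_pos
  have hμ1 := hp.μ_le_one
  have hb := hp.b₂_pos
  obtain ⟨D, hD, hCD⟩ : ∃ D : ℝ, 0 < D ∧ C ≤ D := ⟨|C| + 1, by positivity, by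
    linarith [le_abs_self C]⟩
  obtain ⟨r, hr0, hr1, hr2⟩ : ∃ r : ℝ, 0 < r ∧ r ≤ ρ₀ ∧ r ≤ p.b₂ / (2 * D) :=
    ⟨min ρ₀ (p.b₂ / (2 * D)), lt_min hρ₀ (by positivity), by simp, by simp⟩
  set h₀ : ℝ → ℝ := fun y => p.μ * f 0 y - (1 - p.μ) * g 0 y with hh₀
  -- On the axis `xWeight = μ`, so the drift is `h₀`, and `y` decreases at the rate in the
  -- denominator. This `κ` makes the derivative of `logScale - K` vanish there. Both `h₀` and the
  -- denominator are of order `y³`, so `κ` is bounded and `K` is its integral from zero.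
  set κ : ℝ → ℝ := fun y => -(h₀ y) / (y * (p.b₂ * y ^ 2 + g 0 y)) with hκ
  have h00 : (0 : ℝ) ∈ Icc 0 ρ₀ := ⟨le_rfl, hρ₀.le⟩
  have hIcc : ∀ y ∈ Ioc 0 r, y ∈ Icc 0 ρ₀ := fun y hy => ⟨hy.1.le, hy.2.trans hr1⟩
  have hf0 : ∀ y ∈ Ioc 0 r, |f 0 y| ≤ D * y ^ 3 := fun y hy => by
    have h1 := h.f_le 0 h00 y (hIcc y hy)
    rw [zero_add] at h1
    have := hy.1
    exact h1.trans (by gcongr)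
  have hg0 : ∀ y ∈ Ioc 0 r, |g 0 y| ≤ D * y ^ 3 := fun y hy => by
    have h1 := h.g_le 0 h00 y (hIcc y hy)
    rw [zero_add] at h1
    have := hy.1
    exact h1.trans (by gcongr)
  have hden : ∀ y ∈ Ioc 0 r, p.b₂ / 2 * y ^ 2 ≤ p.b₂ * y ^ 2 + g 0 y := fun y hy => by
    have h1 := (abs_le.1 (hg0 y hy)).1
    have h2 : D * y ≤ p.b₂ / 2 := by
      calc D * y ≤ D * (p.b₂ / (2 * D)) := by gcongr; exact hy.2.trans hr2
        _ = p.b₂ / 2 := by field_simp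
    nlinarith [mul_le_mul_of_nonneg_right h2 (sq_nonneg y)]
  have hden0 : ∀ y ∈ Ioc 0 r, 0 < y * (p.b₂ * y ^ 2 + g 0 y) := fun y hy => by
    have hy0 := hy.1
    exact mul_pos hy0 (lt_of_lt_of_le (by positivity) (hden y hy))
  have hh0 : ∀ y ∈ Ioc 0 r, |h₀ y| ≤ D * y ^ 3 := fun y hy => by
    have hy0 := hy.1
    calc |h₀ y| ≤ |p.μ * f 0 y| + |(1 - p.μ) * g 0 y| := abs_sub _ _
      _ = p.μ * |f 0 y| + (1 - p.μ) * |g 0 y| := by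
        rw [abs_mul, abs_mul, abs_of_pos hμ, abs_of_nonneg (sub_nonneg.2 hμ1)]
      _ ≤ p.μ * (D * y ^ 3) + (1 - p.μ) * (D * y ^ 3) := by
        have := sub_nonneg.2 hμ1
        gcongr
        · exact hf0 y hy
        · exact hg0 y hy
      _ = _ := by ring
  obtain ⟨E, hE⟩ : ∃ E : ℝ, E = 2 * D / p.b₂ := ⟨_, rfl⟩
  have hE0 : 0 < E := by rw [hE]; positivity
  have hκb : ∀ y ∈ Ioc 0 r, |κ y| ≤ E := fun y hy => by
    have hy0 := hy.1
    rw [hκ]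
    simp only
    rw [abs_div, abs_neg, abs_of_pos (hden0 y hy), div_le_iff₀ (hden0 y hy)]
    calc |h₀ y| ≤ D * y ^ 3 := hh0 y hy
      _ = E * (y * (p.b₂ / 2 * y ^ 2)) := by rw [hE]; field_simp
      _ ≤ _ := by gcongr; exact hden y hy
  have hκc : ContinuousOn κ (Ioc 0 r) := by
    have hs : Ioc 0 r ⊆ Ioc 0 ρ₀ := Ioc_subset_Ioc_right hr1
    have c1 := h.f_left_cont.mono hs
    have c2 := h.g_left_cont.mono hs
    refine ContinuousOn.div ?_ ?_ fun y hy => (hden0 y hy).ne'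
    · exact ((c1.const_mul _).sub (c2.const_mul _)).neg
    · exact continuousOn_id.mul (((continuousOn_id.pow 2).const_mul _).add c2)
  have hκi : ∀ y ∈ Ioc 0 r, IntervalIntegrable κ MeasureTheory.volume 0 y := fun y hy => by
    rw [intervalIntegrable_iff_integrableOn_Ioc_of_le hy.1.le]
    have hs : Ioc 0 y ⊆ Ioc 0 r := Ioc_subset_Ioc_right hy.2
    refine MeasureTheory.IntegrableOn.of_bound (by simp)
      ((hκc.mono hs).aestronglyMeasurable measurableSet_Ioc) E ?_
    filter_upwards [MeasureTheory.ae_restrict_mem measurableSet_Ioc] with z hz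
    exact hκb z (hs hz)
  have hhalf : r / 2 ≤ r := by linarith
  have hIoc : ∀ y ∈ Ioc 0 (r / 2), y ∈ Ioc 0 r := fun y hy => ⟨hy.1, hy.2.trans hhalf⟩
  obtain ⟨V, hV⟩ : ∃ V : ℝ, V = 8 * D + 2 * D * W * 4 + E * (p.b₀ + |p.b₁| + 4 * D * r) :=
    ⟨_, rfl⟩
  have hV0 : 0 < V := by
    have := hp.b₀_nonneg
    rw [hV]; positivity
  -- Halving `r` places the right endpoint inside the interval on which `κ` is continuous, so that
  -- `K` has a two-sided derivative there too.
  refine ⟨r / 2, max E (V + 8 * D * W), by positivity, hhalf.trans hr1, lt_max_of_lt_left hE0,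
    fun y => ∫ z in (0 : ℝ)..y, κ z, κ, ?_, ?_, ?_, ?_⟩
  · intro y hy
    have hyr : y ∈ Ioo 0 r := ⟨hy.1, lt_of_le_of_lt hy.2 (by linarith)⟩
    have hca : ∀ z ∈ Ioo 0 r, ContinuousAt κ z := fun z hz =>
      hκc.continuousAt (mem_of_superset (isOpen_Ioo.mem_nhds hz) Ioo_subset_Ioc_self)
    exact intervalIntegral.integral_hasDerivAt_right (hκi y (hIoc y hy))
      (ContinuousAt.stronglyMeasurableAtFilter isOpen_Ioo hca y hyr) (hca y hyr)
  · intro y hy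
    have := intervalIntegral.norm_integral_le_of_norm_le_const (a := 0) (b := y) (f := κ)
      (C := E) (fun z hz => by
        rw [uIoc_of_le hy.1.le] at hz
        exact hκb z ⟨hz.1, hz.2.trans (hIoc y hy).2⟩)
    rw [sub_zero, abs_of_pos hy.1] at this
    refine this.trans ?_
    have := hy.1
    gcongr
    exact le_max_left _ _
  · intro x y hx hxy hy
    have hy0 : 0 < y := hx.trans_le hxy
    have hyr : y ∈ Ioc 0 r := hIoc y ⟨hy0, hy⟩
    have hxr : x ∈ Ioc 0 r := ⟨hx, hxy.trans hyr.2⟩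
    have hn : 0 < x + y := by positivity
    have hn2 : x + y ≤ 2 * y := by linarith
    have hfx : |f x y| ≤ 8 * D * y ^ 3 := by
      calc |f x y| ≤ C * (x + y) ^ 3 := h.f_le x (hIcc x hxr) y (hIcc y hyr)
        _ ≤ D * (2 * y) ^ 3 := by gcongr
        _ = _ := by ring
    have hgx : |g x y| ≤ 8 * D * y ^ 3 := by
      calc |g x y| ≤ C * (x + y) ^ 3 := h.g_le x (hIcc x hxr) y (hIcc y hyr)
        _ ≤ D * (2 * y) ^ 3 := by gcongr
        _ = _ := by ring
    have hfd : |f x y - f 0 y| ≤ 4 * D * (x * y ^ 2) := by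
      calc |f x y - f 0 y| ≤ C * x * (x + y) ^ 2 := h.f_left x (hIcc x hxr) y (hIcc y hyr)
        _ ≤ D * x * (2 * y) ^ 2 := by gcongr
        _ = _ := by ring
    have hgd : |g x y - g 0 y| ≤ 4 * D * (x * y ^ 2) := by
      calc |g x y - g 0 y| ≤ C * x * (x + y) ^ 2 := h.g_left x (hIcc x hxr) y (hIcc y hyr)
        _ ≤ D * x * (2 * y) ^ 2 := by gcongr
        _ = _ := by ring
    have hw : |p.xWeight x y - p.μ| * y ≤ W * x :=
      le_trans (by gcongr; linarith) (HW x y hx.le hy0.le hn)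
    have hκ0 : h₀ y + κ y * (y * (p.b₂ * y ^ 2 + g 0 y)) = 0 := by
      rw [hκ]
      simp only
      rw [div_mul_cancel₀ _ (hden0 y hyr).ne']
      ring
    -- Subtracting the identity on the axis leaves only differences, each of which carries a factor
    -- `x`.
    have hsplit : p.drift f g x y + κ y * (y * (p.yForm x y + g x y)) =
        p.μ * (f x y - f 0 y) - (1 - p.μ) * (g x y - g 0 y) +
        (f x y + g x y) * (p.xWeight x y - p.μ) +
        κ y * (y * (p.b₀ * x ^ 2 + p.b₁ * x * y + (g x y - g 0 y))) := by
      have : p.drift f g x y + κ y * (y * (p.yForm x y + g x y)) =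
        p.drift f g x y + κ y * (y * (p.yForm x y + g x y)) -
          (h₀ y + κ y * (y * (p.b₂ * y ^ 2 + g 0 y))) := by rw [hκ0, sub_zero]
      rw [this, drift, hh₀, yForm]
      ring
    have b1 : |p.μ * (f x y - f 0 y) - (1 - p.μ) * (g x y - g 0 y)| ≤ 4 * D * (x * y ^ 2) := by
      calc _ ≤ |p.μ * (f x y - f 0 y)| + |(1 - p.μ) * (g x y - g 0 y)| := abs_sub _ _
        _ = p.μ * |f x y - f 0 y| + (1 - p.μ) * |g x y - g 0 y| := by
          rw [abs_mul, abs_mul, abs_of_pos hμ, abs_of_nonneg (sub_nonneg.2 hμ1)]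
        _ ≤ p.μ * (4 * D * (x * y ^ 2)) + (1 - p.μ) * (4 * D * (x * y ^ 2)) := by
          have := sub_nonneg.2 hμ1
          gcongr
        _ = _ := by ring
    have b2 : |(f x y + g x y) * (p.xWeight x y - p.μ)| ≤ 16 * D * W * (x * y ^ 2) := by
      calc _ = |f x y + g x y| * |p.xWeight x y - p.μ| := abs_mul _ _
        _ ≤ (8 * D * y ^ 3 + 8 * D * y ^ 3) * |p.xWeight x y - p.μ| := by
          gcongr
          exact (abs_add_le _ _).trans (add_le_add hfx hgx)
        _ = 16 * D * y ^ 2 * (|p.xWeight x y - p.μ| * y) := by ring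
        _ ≤ 16 * D * y ^ 2 * (W * x) := by gcongr
        _ = _ := by ring
    have b3 : |κ y * (y * (p.b₀ * x ^ 2 + p.b₁ * x * y + (g x y - g 0 y)))| ≤
        E * (p.b₀ + |p.b₁| + 4 * D * r) * (x * y ^ 2) := by
      have hb0 := hp.b₀_nonneg
      have i1 : |p.b₀ * x ^ 2 + p.b₁ * x * y + (g x y - g 0 y)| ≤
          (p.b₀ + |p.b₁| + 4 * D * r) * (x * y) := by
        calc _ ≤ |p.b₀ * x ^ 2| + |p.b₁ * x * y| + |g x y - g 0 y| := abs_add_three _ _ _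
          _ ≤ p.b₀ * (x * y) + |p.b₁| * (x * y) + 4 * D * (x * y ^ 2) := by
            gcongr
            · rw [abs_of_nonneg (by positivity), sq]; gcongr
            · rw [abs_mul, abs_mul, abs_of_pos hx, abs_of_pos hy0, mul_assoc]
          _ ≤ p.b₀ * (x * y) + |p.b₁| * (x * y) + 4 * D * (x * (r * y)) := by
            gcongr
            rw [sq]; gcongr; exact hyr.2
          _ = _ := by ring
      calc _ = |κ y| * (y * |p.b₀ * x ^ 2 + p.b₁ * x * y + (g x y - g 0 y)|) := by
            rw [abs_mul, abs_mul, abs_of_pos hy0]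
        _ ≤ E * (y * ((p.b₀ + |p.b₁| + 4 * D * r) * (x * y))) := by
            gcongr; exact hκb y hyr
        _ = _ := by ring
    rw [hsplit]
    have hxy0 : 0 < x * y ^ 2 := by positivity
    calc _ ≤ |p.μ * (f x y - f 0 y) - (1 - p.μ) * (g x y - g 0 y)| +
          |(f x y + g x y) * (p.xWeight x y - p.μ)| +
          |κ y * (y * (p.b₀ * x ^ 2 + p.b₁ * x * y + (g x y - g 0 y)))| := abs_add_three _ _ _
      _ ≤ 4 * D * (x * y ^ 2) + 16 * D * W * (x * y ^ 2) +
          E * (p.b₀ + |p.b₁| + 4 * D * r) * (x * y ^ 2) := by gcongr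
      _ ≤ (V + 8 * D * W) * (x * y ^ 2) := by
          rw [hV]
          nlinarith [mul_pos hD hxy0]
      _ ≤ max E (V + 8 * D * W) * (x * y ^ 2) := by gcongr; exact le_max_right _ _
      _ = _ := by ring
  · intro hfg y hy
    have : ∀ z ∈ uIcc 0 y, κ z = 0 := by
      intro z hz
      rw [uIcc_of_le hy.1.le] at hz
      have := hfg 0 h00 z ⟨hz.1, hz.2.trans (hIcc y (hIoc y hy)).2⟩
      simp [hκ, hh₀, this.1, this.2]
    simp only
    rw [intervalIntegral.integral_congr this]
    simp

end Admissible

end CubicCoeffs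

/-! ### The half of a passage between the entry and the diagonal -/

namespace IsOrbit

variable {p : CubicCoeffs} {f g : ℝ → ℝ → ℝ} {ρ k : ℝ} {x y : ℝ → ℝ} {t₁ t₂ : ℝ}

section Diagonal

variable (h : IsOrbit p f g ρ x y t₁ t₂) (hb : HasFieldBounds p f g ρ k) (hp : p.Admissible)
  (h12 : t₁ ≤ t₂) (hd : x t₂ = y t₂)
include h hb h12 hd

lemma slope_nonneg_of_diagonal {t : ℝ} (ht : t ∈ Icc t₁ t₂) :
    0 ≤ Real.log (y t) - Real.log (x t) := by
  have := h.slope_antitoneOn hb ht (right_mem_Icc.2 h12) ht.2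
  simpa [hd] using this

lemma x_le_y_of_diagonal {t : ℝ} (ht : t ∈ Icc t₁ t₂) : x t ≤ y t := by
  have := h.slope_nonneg_of_diagonal hb h12 hd ht
  exact (Real.log_le_log_iff (h.x_pos t ht) (h.y_pos t ht)).1 (by linarith)

include hp

lemma scale_le_of_diagonal {t : ℝ} (ht : t ∈ Icc t₁ t₂) :
    (x t + y t) * Real.exp (-p.logScale (x t) (y t)) ≤
      2 * k * Real.exp (p.μ * (Real.log (y t) - Real.log (x t))) := by
  have h0 := h.slope_nonneg_of_diagonal hb h12 hd ht
  have h1 := hb.scale_le _ (h.x_mem ht) _ (h.y_mem ht)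
  have hk := hb.one_le
  have : Real.exp (-(p.ν * (Real.log (y t) - Real.log (x t)))) ≤
      Real.exp (p.μ * (Real.log (y t) - Real.log (x t))) := by
    rw [Real.exp_le_exp]
    nlinarith [hp.μ_pos, hp.ν_pos]
  calc _ ≤ _ := h1
    _ ≤ k * (Real.exp (p.μ * (Real.log (y t) - Real.log (x t))) +
      Real.exp (p.μ * (Real.log (y t) - Real.log (x t)))) := by gcongr
    _ = _ := by ring

variable (hL : p.FirstIntegralCondition)
include hL

/-- With `P` the inverse of the first integral, `x P ≤ (x + y) P e^{-w}`, which is of order `e^{-(1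
- μ)w}`. This is bounded because `μ ≤ 1` and `w ≥ 0`; near constancy then replaces `P` by its value
on the diagonal. -/
lemma x_le_of_diagonal {t : ℝ} (ht : t ∈ Icc t₁ t₂) :
    x t ≤ 4 * k * Real.exp (p.logScale (x t₂) (y t₂)) := by
  have h0 := h.slope_nonneg_of_diagonal hb h12 hd ht
  have h1 := h.scale_le_of_diagonal hb hp h12 hd ht
  have h2 := h.exp_neg_logScale_le_two_mul hb hp hL ht (right_mem_Icc.2 h12)
  have hx := h.x_pos t ht
  have hy := h.y_pos t ht
  have hk := hb.one_le
  rw [Real.exp_neg (p.logScale (x t₂) (y t₂))] at h2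
  set D := Real.exp (p.logScale (x t₂) (y t₂))
  set P := Real.exp (-p.logScale (x t) (y t))
  have hP : 0 < P := Real.exp_pos _
  have hD : 0 < D := Real.exp_pos _
  have hw : x t = y t * Real.exp (-(Real.log (y t) - Real.log (x t))) := by
    rw [neg_sub, Real.exp_sub, Real.exp_log hx, Real.exp_log hy]; field_simp
  have h3 : x t * P ≤ 2 * k := by
    calc x t * P = y t * Real.exp (-(Real.log (y t) - Real.log (x t))) * P := by rw [← hw]
      _ ≤ (x t + y t) * Real.exp (-(Real.log (y t) - Real.log (x t))) * P := by
        gcongr; linarith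
      _ = (x t + y t) * P * Real.exp (-(Real.log (y t) - Real.log (x t))) := by ring
      _ ≤ 2 * k * Real.exp (p.μ * (Real.log (y t) - Real.log (x t))) *
          Real.exp (-(Real.log (y t) - Real.log (x t))) := by gcongr
      _ = 2 * k * Real.exp (-((1 - p.μ) * (Real.log (y t) - Real.log (x t)))) := by
        rw [mul_assoc, ← Real.exp_add]; ring_nf
      _ ≤ 2 * k * 1 := by
        gcongr
        rw [Real.exp_le_one_iff, neg_nonpos]
        exact mul_nonneg (sub_nonneg.2 hp.μ_le_one) h0
      _ = 2 * k := mul_one _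
  have h4 : 1 ≤ 2 * P * D := by
    have := mul_le_mul_of_nonneg_right h2 hD.le
    rwa [inv_mul_cancel₀ hD.ne'] at this
  calc x t = x t * 1 := (mul_one _).symm
    _ ≤ x t * (2 * P * D) := by gcongr
    _ = 2 * (x t * P) * D := by ring
    _ ≤ 2 * (2 * k) * D := by gcongr
    _ = _ := by ring

omit hd in
-- The length of the slope interval is only logarithmic in the first integral. This is the origin of
-- the logarithm in the error terms.
lemma slope_le_of_end {t : ℝ} (ht : t ∈ Icc t₁ t₂) :
    p.μ * (Real.log (y t) - Real.log (x t)) ≤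
      Real.log (4 * k * ρ) - p.logScale (x t₂) (y t₂) := by
  have h1 := hb.le_scale _ (h.x_mem ht) _ (h.y_mem ht)
  have h2 := h.exp_neg_logScale_le_two_mul hb hp hL (right_mem_Icc.2 h12) ht
  have hx := h.x_pos t ht
  have hy := h.y_pos t ht
  have hk := hb.one_le
  have hρ : 0 < ρ := hx.trans_le (h.x_le t ht)
  have h3 : Real.exp (p.μ * (Real.log (y t) - Real.log (x t))) ≤
      (4 * k * ρ) * Real.exp (-p.logScale (x t₂) (y t₂)) := by
    calc _ ≤ k * ((x t + y t) * Real.exp (-p.logScale (x t) (y t))) := by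
          linarith [Real.exp_pos (-(p.ν * (Real.log (y t) - Real.log (x t))))]
      _ ≤ k * ((ρ + ρ) * (2 * Real.exp (-p.logScale (x t₂) (y t₂)))) := by
          gcongr
          · exact h.x_le t ht
          · exact h.y_le t ht
      _ = _ := by ring
  rw [← Real.exp_log (by positivity : 0 < 4 * k * ρ), ← Real.exp_add, Real.exp_le_exp] at h3
  linarith

/-- Above the diagonal the increment is governed by `e^{μw}`, and `e^{μw} ≥ 1` absorbs the boundary
terms on the diagonal. -/
lemma abs_exp_neg_logScale_sub_le_of_diagonal {t : ℝ} (ht : t ∈ Icc t₁ t₂) :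
    |Real.exp (-p.logScale (x t) (y t)) - Real.exp (-p.logScale (x t₂) (y t₂))| ≤
      k ^ 3 * (1 / p.μ + 1 / p.ν) * Real.exp (p.μ * (Real.log (y t) - Real.log (x t))) := by
  have h0 := h.slope_nonneg_of_diagonal hb h12 hd ht
  have h1 := h.abs_exp_neg_logScale_sub_le hb hp hL ht (right_mem_Icc.2 h12) ht.2
  have hμ := hp.μ_pos
  have hν := hp.ν_pos
  have hk := hb.one_le
  rw [abs_sub_comm]
  refine h1.trans ?_
  simp only [hd, sub_self, mul_zero, neg_zero, Real.exp_zero]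
  set w := Real.log (y t) - Real.log (x t)
  have h2 : 1 ≤ Real.exp (p.μ * w) := Real.one_le_exp (by positivity)
  have h3 := Real.exp_pos (-(p.ν * w))
  have h4 : Real.exp (p.μ * w) / p.μ - Real.exp (-(p.ν * w)) / p.ν - (1 / p.μ - 1 / p.ν) ≤
      (1 / p.μ + 1 / p.ν) * Real.exp (p.μ * w) := by
    have a1 : 0 ≤ Real.exp (-(p.ν * w)) / p.ν := by positivity
    have a2 : 0 ≤ 1 / p.μ := by positivity
    have a3 : 1 / p.ν ≤ 1 / p.ν * Real.exp (p.μ * w) :=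
      le_mul_of_one_le_right (by positivity) h2
    have a4 : Real.exp (p.μ * w) / p.μ = 1 / p.μ * Real.exp (p.μ * w) := by ring
    rw [a4, add_mul]
    linarith
  calc _ = k ^ 3 * (Real.exp (p.μ * w) / p.μ - Real.exp (-(p.ν * w)) / p.ν -
        (1 / p.μ - 1 / p.ν)) := by ring
    _ ≤ k ^ 3 * ((1 / p.μ + 1 / p.ν) * Real.exp (p.μ * w)) := by gcongr
    _ = _ := by ring

/-- The change of the first integral between the entry and the diagonal. -/
lemma abs_logScale_sub_le_of_diagonal {C : ℝ} (hC : 0 < C) {K κ : ℝ → ℝ}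
    (hK : ∀ y ∈ Ioc 0 ρ, HasDerivAt K (κ y) y)
    (hE : ∀ x y : ℝ, 0 < x → x ≤ y → y ≤ ρ →
        |p.drift f g x y + κ y * (y * (p.yForm x y + g x y))| ≤ C * x * y ^ 2) :
    |(p.logScale (x t₂) (y t₂) - K (y t₂)) - (p.logScale (x t₁) (y t₁) - K (y t₁))| ≤
      C * (4 * k * Real.exp (p.logScale (x t₂) (y t₂))) * k *
        (Real.log (y t₁) - Real.log (x t₁)) := by
  have hk := hb.one_le
  set D := Real.exp (p.logScale (x t₂) (y t₂)) with hDdef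
  have hD : 0 < D := Real.exp_pos _
  -- The corrected drift is at most `C x y²`, where `x ≤ 4kD` and `y²` is at most `k` times the rate
  -- of the slope; so a multiple of the slope dominates.
  have key := abs_sub_le_of_abs_deriv_le
    (F := fun s => p.logScale (x s) (y s) - K (y s))
    (G := fun s => C * (4 * k * D) * k * (Real.log (y s) - Real.log (x s)))
    (fun s hs => (h.hasDerivWithinAt_logScale hp hL hs).sub
      ((hK (y s) (h.y_mem hs)).comp_hasDerivWithinAt s (h.y_deriv s hs)))
    (fun s hs => (h.hasDerivWithinAt_slope hs).const_mul (C * (4 * k * D) * k))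
    (fun s hs => ?_) (left_mem_Icc.2 h12) (right_mem_Icc.2 h12) h12
  · refine key.trans ?_
    simp [hd]
  · have hx := h.x_pos s hs
    have hy := h.y_pos s hs
    have h1 := hE (x s) (y s) hx (h.x_le_y_of_diagonal hb h12 hd hs) (h.y_le s hs)
    have h2 := hb.sq_le _ (h.x_mem hs) _ (h.y_mem hs)
    have h3 := h.x_le_of_diagonal hb hp h12 hd hL hs
    rw [← hDdef] at h3
    calc _ = |p.drift f g (x s) (y s) +
          κ (y s) * (y s * (p.yForm (x s) (y s) + g (x s) (y s)))| := by congr 1; ring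
      _ ≤ C * x s * y s ^ 2 := h1
      _ ≤ C * x s * (x s + y s) ^ 2 := by gcongr; linarith
      _ ≤ C * (4 * k * D) * (k * (p.quad (x s) (y s) + (f (x s) (y s) + g (x s) (y s)))) := by
        gcongr
      _ = _ := by ring

/-- The time between the entry and the diagonal. -/
lemma abs_time_sub_le_of_diagonal :
    |(t₂ - t₁) * Real.exp (2 * p.logScale (x t₂) (y t₂)) -
      (p.timeIntegral 1 - p.timeIntegral (x t₁ / y t₁))| ≤
      2 * k ^ 3 * (3 * (k ^ 3 * (1 / p.μ + 1 / p.ν)) + 8 * k ^ 2) / p.μ *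
        Real.exp (p.logScale (x t₂) (y t₂)) := by
  have hk := hb.one_le
  have hμ := hp.μ_pos
  have hν := hp.ν_pos
  obtain ⟨k₄, hk₄⟩ : ∃ k₄, k₄ = k ^ 3 * (1 / p.μ + 1 / p.ν) := ⟨_, rfl⟩
  have hk₄0 : 0 < k₄ := by rw [hk₄]; positivity
  obtain ⟨S, hS⟩ : ∃ S, S = p.logScale (x t₂) (y t₂) := ⟨_, rfl⟩
  rw [← hk₄, ← hS]
  -- `F` compares the true time with the time predicted on the level `S` of the first integral. Its
  -- derivative is of order `e^{-S} e^{-μw}` times the rate of `w`, so the total defect is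
  -- `O(e^{-S})`; multiplication by `e^{2S}` gives the claim.
  have key := abs_sub_le_of_abs_deriv_le
    (F := fun s => s - Real.exp (-(2 * S)) * p.timeIntegral (x s / y s))
    (G := fun s => -(2 * k ^ 3 * (3 * k₄ + 8 * k ^ 2) / p.μ * Real.exp (-S) *
      Real.exp (-(p.μ * (Real.log (y s) - Real.log (x s))))))
    (fun s hs => (hasDerivWithinAt_id s _).sub
      (((hp.hasDerivAt_timeIntegral (div_pos (h.x_pos s hs) (h.y_pos s hs))).comp_hasDerivWithinAt
        s ((h.x_deriv s hs).div (h.y_deriv s hs) (h.y_pos s hs).ne')).const_mul _))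
    (fun s hs => ((((h.hasDerivWithinAt_slope hs).const_mul p.μ).fun_neg.exp).const_mul
      (2 * k ^ 3 * (3 * k₄ + 8 * k ^ 2) / p.μ * Real.exp (-S))).fun_neg)
    (fun s hs => ?_) (left_mem_Icc.2 h12) (right_mem_Icc.2 h12) h12
  · have h2 : y t₂ / y t₂ = 1 := div_self (h.y_pos t₂ (right_mem_Icc.2 h12)).ne'
    have e2 : Real.exp (2 * S) = Real.exp S * Real.exp S := by rw [← Real.exp_add]; ring_nf
    have e3 : Real.exp (-S) = (Real.exp S)⁻¹ := Real.exp_neg _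
    have hD : 0 < Real.exp S := Real.exp_pos _
    have e4 : Real.exp (-(2 * S)) = (Real.exp S * Real.exp S)⁻¹ := by rw [Real.exp_neg, e2]
    simp only [hd, h2, sub_self, mul_zero, neg_zero, Real.exp_zero, mul_one] at key
    rw [e4, e3] at key
    rw [e2]
    set D := Real.exp S
    have e5 : (t₂ - t₁) * (D * D) - (p.timeIntegral 1 - p.timeIntegral (x t₁ / y t₁)) =
        (t₂ - (D * D)⁻¹ * p.timeIntegral 1 - (t₁ - (D * D)⁻¹ * p.timeIntegral (x t₁ / y t₁))) *
          (D * D) := by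
      field_simp
      ring
    have e6 : 0 ≤ 2 * k ^ 3 * (3 * k₄ + 8 * k ^ 2) / p.μ * D⁻¹ *
      Real.exp (-(p.μ * (Real.log (y t₁) - Real.log (x t₁)))) := by positivity
    rw [e5, abs_mul, abs_of_pos (mul_pos hD hD)]
    calc _ ≤ (2 * k ^ 3 * (3 * k₄ + 8 * k ^ 2) / p.μ * D⁻¹) * (D * D) := by
          gcongr
          linarith
      _ = _ := by field_simp
  · have hx := h.x_pos s hs
    have hy := h.y_pos s hs
    have hn : 0 < x s + y s := by positivity
    have hQ := hp.quad_pos hn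
    have hN := h.rate_pos hb hs
    have b1 := hb.sq_le _ (h.x_mem hs) _ (h.y_mem hs)
    have b2 := hb.sum_le _ (h.x_mem hs) _ (h.y_mem hs)
    have b3 := h.scale_le_of_diagonal hb hp h12 hd hs
    have b4 := hb.le_scale _ (h.x_mem hs) _ (h.y_mem hs)
    have b5 := h.abs_exp_neg_logScale_sub_le_of_diagonal hb hp h12 hd hL hs
    have b6 := h.exp_neg_logScale_le_two_mul hb hp hL hs (right_mem_Icc.2 h12)
    have b7 := h.exp_neg_logScale_le_two_mul hb hp hL (right_mem_Icc.2 h12) hs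
    have e1 := hp.timeDensity_mul hx hy
    rw [← hk₄] at b5
    rw [← hS] at b5 b6 b7
    set τ := p.timeDensity (x s / y s)
    set E := Real.exp (p.μ * (Real.log (y s) - Real.log (x s)))
    have hE : 0 < E := Real.exp_pos _
    have eE : Real.exp (-(p.μ * (Real.log (y s) - Real.log (x s)))) = E⁻¹ := Real.exp_neg _
    have hE' := Real.exp_pos (-(p.ν * (Real.log (y s) - Real.log (x s))))
    have e2 : Real.exp (2 * p.logScale (x s) (y s)) =
        (Real.exp (-p.logScale (x s) (y s)) ^ 2)⁻¹ := by
      rw [sq, ← Real.exp_add, ← Real.exp_neg]; ring_nf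
    have e3 : Real.exp (-(2 * S)) = Real.exp (-S) ^ 2 := by
      rw [sq, ← Real.exp_add]; ring_nf
    rw [e2] at e1
    rw [e3, eE]
    set P := Real.exp (-p.logScale (x s) (y s))
    set P₂ := Real.exp (-S)
    have hP : 0 < P := Real.exp_pos _
    have hP₂ : 0 < P₂ := Real.exp_pos _
    set q := p.quad (x s) (y s)
    set F := f (x s) (y s)
    set G := g (x s) (y s)
    have hr : |(F + G) / q| ≤ k * (2 * k * (E / P)) := by
      rw [abs_div, abs_of_pos hQ, div_le_iff₀ hQ]
      refine b2.trans ?_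
      have : x s + y s ≤ 2 * k * (E / P) := by
        rw [← mul_div_assoc, le_div_iff₀ hP]; exact b3
      gcongr
    -- There are two sources of defect: the first integral differs from its value on the diagonal,
    -- and the ratio `x / y` moves with `q + F + G` instead of `q`. Both are of relative order `E /
    -- P`, which also bounds `x + y` up to a factor.
    have main : |1 - (P₂ / P) ^ 2 * (1 + (F + G) / q)| ≤ (3 * k₄ + 8 * k ^ 2) * (E / P) := by
      have i1 : |1 - (P₂ / P) ^ 2| ≤ 3 * k₄ * (E / P) := by
        have : 1 - (P₂ / P) ^ 2 = (P - P₂) * (P + P₂) / P ^ 2 := by field_simp; ring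
        rw [this, abs_div, abs_mul, abs_of_pos (add_pos hP hP₂), abs_of_pos (pow_pos hP 2),
          div_le_iff₀ (by positivity)]
        calc |P - P₂| * (P + P₂) ≤ k₄ * E * (3 * P) := by gcongr; linarith
          _ = _ := by field_simp
      have i2 : (P₂ / P) ^ 2 ≤ 4 := by
        have : P₂ / P ≤ 2 := by rw [div_le_iff₀ hP]; exact b6
        calc (P₂ / P) ^ 2 ≤ 2 ^ 2 := by gcongr
          _ = 4 := by norm_num
      calc _ = |(1 - (P₂ / P) ^ 2) - (P₂ / P) ^ 2 * ((F + G) / q)| := by congr 1; ring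
        _ ≤ |1 - (P₂ / P) ^ 2| + |(P₂ / P) ^ 2 * ((F + G) / q)| := abs_sub _ _
        _ = |1 - (P₂ / P) ^ 2| + (P₂ / P) ^ 2 * |(F + G) / q| := by
          rw [abs_mul, abs_of_nonneg (sq_nonneg (P₂ / P))]
        _ ≤ 3 * k₄ * (E / P) + 4 * (k * (2 * k * (E / P))) := by gcongr
        _ = _ := by ring
    -- Squaring `E ≤ k (x + y) P` produces `(x + y)²`, and with it the rate of the slope. This turns
    -- the growing `E` into the integrable `E⁻¹`.
    have hEP : E / P ≤ 2 * k ^ 3 * P₂ * E⁻¹ * (q + (F + G)) := by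
      have j1 : E ≤ k * ((x s + y s) * P) := by linarith
      have j2 : E * E ≤ k ^ 3 * P ^ 2 * (q + (F + G)) := by
        calc E * E ≤ (k * ((x s + y s) * P)) * (k * ((x s + y s) * P)) := by gcongr
          _ = k ^ 2 * P ^ 2 * (x s + y s) ^ 2 := by ring
          _ ≤ k ^ 2 * P ^ 2 * (k * (q + (F + G))) := by gcongr
          _ = _ := by ring
      rw [div_le_iff₀ hP]
      calc E = E * E * E⁻¹ := by field_simp
        _ ≤ k ^ 3 * P ^ 2 * (q + (F + G)) * E⁻¹ := by gcongr
        _ = k ^ 3 * P * P * (q + (F + G)) * E⁻¹ := by ring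
        _ ≤ k ^ 3 * (2 * P₂) * P * (q + (F + G)) * E⁻¹ := by gcongr
        _ = _ := by ring
    have eτ : τ * (x s / y s) = (P ^ 2)⁻¹ / q := by
      rw [eq_div_iff hQ.ne']; exact e1
    calc _ = |1 - (P₂ / P) ^ 2 * (1 + (F + G) / q)| := by
          congr 1
          have : (x s * (p.xForm (x s) (y s) + F) * y s -
              x s * -(y s * (p.yForm (x s) (y s) + G))) / y s ^ 2 =
              (x s / y s) * (q + (F + G)) := by
            rw [show q = p.xForm (x s) (y s) + p.yForm (x s) (y s) from
              (p.xForm_add_yForm _ _).symm]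
            field_simp
            ring
          rw [this, ← mul_assoc τ, eτ]
          field_simp
      _ ≤ (3 * k₄ + 8 * k ^ 2) * (E / P) := main
      _ ≤ (3 * k₄ + 8 * k ^ 2) * (2 * k ^ 3 * P₂ * E⁻¹ * (q + (F + G))) := by gcongr
      _ = _ := by field_simp

end Diagonal

end IsOrbit

set_option maxHeartbeats 800000 in
/-- The asymptotics of the entry coordinate and of the time for the part of a passage between the
entry `y = η` and the diagonal, in terms of the first integral on the diagonal. -/
lemma CubicCoeffs.Admissible.exists_entry_asymptotics {p : CubicCoeffs} (hp : p.Admissible)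
    (hL : p.FirstIntegralCondition) {f g : ℝ → ℝ → ℝ} {ρ₀ C : ℝ} (hρ₀ : 0 < ρ₀)
    (hR : IsRemainder f g ρ₀ C) :
    ∃ ρ : ℝ, 0 < ρ ∧ ρ ≤ ρ₀ ∧ ∃ K : ℝ → ℝ,
      ((∀ x ∈ Icc 0 ρ₀, ∀ y ∈ Icc 0 ρ₀, f x y = 0 ∧ g x y = 0) → ∀ y ∈ Ioc 0 ρ, K y = 0) ∧
      ∀ η ∈ Ioc 0 ρ, ∃ C' : ℝ, 0 < C' ∧ ∀ (x y : ℝ → ℝ) (t₁ t₂ : ℝ), t₁ ≤ t₂ →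
        IsOrbit p f g ρ x y t₁ t₂ → y t₁ = η → x t₂ = y t₂ →
        |p.μ * Real.log (x t₁) + (1 - p.μ) * Real.log η + p.σ * Real.log p.c₂ - K η -
            p.logScale (x t₂) (y t₂)| ≤
          C' * (Real.exp (p.logScale (x t₂) (y t₂)) * (1 + |p.logScale (x t₂) (y t₂)|)) ∧
        |(t₂ - t₁) * Real.exp (2 * p.logScale (x t₂) (y t₂)) - p.timeIntegral 1| ≤
          C' * Real.exp (p.logScale (x t₂) (y t₂)) := by
  obtain ⟨ρ₁, k, hρ₁, hρ₁₀, hb⟩ := hp.exists_fieldBounds hρ₀ hR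
  obtain ⟨ρ₂, C₂, hρ₂, hρ₂₀, hC₂, K, κ, hK, hKb, hE, hK0⟩ := hp.exists_correction hρ₀ hR
  obtain ⟨k₃, hk₃, hq⟩ := hp.exists_abs_log_quad_sub_le
  obtain ⟨k₅, hk₅, hI⟩ := hp.exists_timeIntegral_bound
  have hμ := hp.μ_pos
  have hν := hp.ν_pos
  have hk := hb.one_le
  obtain ⟨ρ, hρ, h1, h2⟩ : ∃ ρ : ℝ, 0 < ρ ∧ ρ ≤ ρ₁ ∧ ρ ≤ ρ₂ :=
    ⟨min ρ₁ ρ₂, lt_min hρ₁ hρ₂, min_le_left _ _, min_le_right _ _⟩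
  have hIoc : ∀ y ∈ Ioc 0 ρ, y ∈ Ioc 0 ρ₂ := fun y hy => ⟨hy.1, hy.2.trans h2⟩
  refine ⟨ρ, hρ, h1.trans hρ₁₀, K, fun h0 y hy => hK0 h0 y (hIoc y hy), fun η hη => ?_⟩
  have hη0 := hη.1
  -- The three terms of `c₁` account for the corrected drift over the slope interval, for `K` on the
  -- diagonal, and for the form at the entry. Those of `c₂` account for the time defect and for the
  -- part of the time integral below the entry ratio.
  obtain ⟨c₁, hc₁⟩ : ∃ c, c = C₂ * (4 * k) * k * (1 / p.μ) * (|Real.log (4 * k * ρ)| + 1) +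
    C₂ * (4 * k) + |p.σ| * (k₃ * (4 * k / η)) := ⟨_, rfl⟩
  obtain ⟨c₂, hc₂⟩ : ∃ c, c =
    2 * k ^ 3 * (3 * (k ^ 3 * (1 / p.μ + 1 / p.ν)) + 8 * k ^ 2) / p.μ + k₅ * (4 * k / η) :=
    ⟨_, rfl⟩
  have hc₁0 : 0 < c₁ := by rw [hc₁]; positivity
  have hc₂0 : 0 < c₂ := by rw [hc₂]; positivity
  refine ⟨c₁ + c₂, by positivity, fun x y t₁ t₂ h12 h hyη hd => ?_⟩
  replace hb := hb.mono h1
  have m1 := left_mem_Icc.2 h12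
  have m2 := right_mem_Icc.2 h12
  have a1 := h.abs_logScale_sub_le_of_diagonal hb hp h12 hd hL hC₂
    (fun y hy => hK y (hIoc y hy)) (fun x y hx hxy hy => hE x y hx hxy (hy.trans h2))
  have a2 := h.abs_time_sub_le_of_diagonal hb hp h12 hd hL
  have a3 := h.x_le_of_diagonal hb hp h12 hd hL m1
  have a4 := h.x_le_of_diagonal hb hp h12 hd hL m2
  have a5 := h.slope_le_of_end hb hp h12 hL m1
  have a6 := h.scale_le_of_diagonal hb hp h12 hd m1
  have a7 := h.exp_neg_logScale_le_two_mul hb hp hL m1 m2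
  have a8 := hKb (y t₂) (hIoc _ (h.y_mem m2))
  have a9 := hq (x t₁) (y t₁) (h.x_pos t₁ m1) (h.x_le_y_of_diagonal hb h12 hd m1)
  have a10 := h.slope_nonneg_of_diagonal hb h12 hd m1
  have hx1 := h.x_pos t₁ m1
  have hy1 := h.y_pos t₁ m1
  have a11 := hI (x t₁ / y t₁) (by positivity)
  have es : p.logScale (x t₁) (y t₁) = p.μ * Real.log (x t₁) + (1 - p.μ) * Real.log (y t₁) +
      p.σ * Real.log p.c₂ +
      p.σ * (Real.log (p.quad (x t₁) (y t₁)) - Real.log p.c₂ - 2 * Real.log (y t₁)) := by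
    rw [CubicCoeffs.logScale]
    linear_combination Real.log (y t₁) * hp.two_mul_σ
  obtain ⟨S, hS⟩ : ∃ S, S = p.logScale (x t₂) (y t₂) := ⟨_, rfl⟩
  rw [← hS] at a1 a2 a3 a4 a5 a7 ⊢
  obtain ⟨D, hDS⟩ : ∃ D, D = Real.exp S := ⟨_, rfl⟩
  have hD : 0 < D := by rw [hDS]; exact Real.exp_pos _
  have a7' := a7
  rw [Real.exp_neg S] at a7'
  rw [← hDS] at a1 a2 a3 a4 a7' ⊢
  have hxη : x t₁ / y t₁ ≤ 4 * k / η * D := by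
    rw [hyη, div_mul_eq_mul_div]
    gcongr
  constructor
  · have b1 : Real.log (y t₁) - Real.log (x t₁) ≤
        1 / p.μ * ((|Real.log (4 * k * ρ)| + 1) * (1 + |S|)) := by
      have : p.μ * (Real.log (y t₁) - Real.log (x t₁)) ≤
          (|Real.log (4 * k * ρ)| + 1) * (1 + |S|) := by
        nlinarith [le_abs_self (Real.log (4 * k * ρ)), neg_abs_le S, abs_nonneg S,
          mul_nonneg (abs_nonneg (Real.log (4 * k * ρ))) (abs_nonneg S)]
      rw [one_div, inv_mul_eq_div, le_div_iff₀ hμ]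
      linarith
    have b2 : |K (y t₂)| ≤ C₂ * (4 * k) * D * (1 + |S|) := by
      have hC4 : C₂ * y t₂ ≤ C₂ * (4 * k * D) := by
        rw [← hd]; gcongr
      have : C₂ * (4 * k) * D * 1 ≤ C₂ * (4 * k) * D * (1 + |S|) := by
        gcongr; linarith [abs_nonneg S]
      linarith
    have b3 : |p.σ * (Real.log (p.quad (x t₁) (y t₁)) - Real.log p.c₂ - 2 * Real.log (y t₁))| ≤
        |p.σ| * (k₃ * (4 * k / η)) * D * (1 + |S|) := by
      rw [abs_mul]
      calc _ ≤ |p.σ| * (k₃ * (4 * k / η * D)) := by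
            gcongr
            exact a9.trans (by gcongr)
        _ = |p.σ| * (k₃ * (4 * k / η)) * D * 1 := by ring
        _ ≤ _ := by gcongr; linarith [abs_nonneg S]
    have b4 := a1.trans (mul_le_mul_of_nonneg_left b1 (by positivity))
    have e : p.μ * Real.log (x t₁) + (1 - p.μ) * Real.log η + p.σ * Real.log p.c₂ - K η - S =
        -((S - K (y t₂)) - (p.logScale (x t₁) (y t₁) - K (y t₁))) - K (y t₂) -
        p.σ * (Real.log (p.quad (x t₁) (y t₁)) - Real.log p.c₂ - 2 * Real.log (y t₁)) := by
      rw [es, hyη]; ring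
    rw [e]
    calc _ ≤ |-((S - K (y t₂)) - (p.logScale (x t₁) (y t₁) - K (y t₁)))| + |K (y t₂)| +
          |p.σ * (Real.log (p.quad (x t₁) (y t₁)) - Real.log p.c₂ - 2 * Real.log (y t₁))| :=
          (abs_sub _ _).trans (by gcongr; exact abs_sub _ _)
      _ ≤ C₂ * (4 * k * D) * k * (1 / p.μ * ((|Real.log (4 * k * ρ)| + 1) * (1 + |S|))) +
          C₂ * (4 * k) * D * (1 + |S|) + |p.σ| * (k₃ * (4 * k / η)) * D * (1 + |S|) := by
          rw [abs_neg]
          gcongr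
      _ = c₁ * (D * (1 + |S|)) := by rw [hc₁]; ring
      _ ≤ (c₁ + c₂) * (D * (1 + |S|)) := by gcongr; linarith
  · have b1 : Real.exp (-(p.μ * (Real.log (y t₁) - Real.log (x t₁)))) ≤ 4 * k / η * D := by
      set E := Real.exp (p.μ * (Real.log (y t₁) - Real.log (x t₁))) with hEdef
      have hE0 : 0 < E := Real.exp_pos _
      rw [Real.exp_neg, ← hEdef]
      set P := Real.exp (-p.logScale (x t₁) (y t₁))
      have hP : 0 < P := Real.exp_pos _
      have c1 : η * P ≤ 2 * k * E := by
        rw [hyη] at a6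
        refine le_trans ?_ a6
        have : η ≤ x t₁ + η := by linarith
        gcongr
      have c2 : 1 ≤ 2 * P * D := by
        have := mul_le_mul_of_nonneg_right a7' hD.le
        rwa [inv_mul_cancel₀ hD.ne'] at this
      have c3 : 1 ≤ 4 * k / η * D * E := by
        calc (1 : ℝ) ≤ 2 * P * D := c2
          _ = 2 / η * D * (η * P) := by field_simp
          _ ≤ 2 / η * D * (2 * k * E) := by gcongr
          _ = _ := by ring
      rw [inv_le_iff_one_le_mul₀ hE0]
      linarith
    -- The left side is `e^{-2μw}`; since `w ≥ 0`, half of the exponent suffices to reach order `D`.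
    have b2 : (x t₁ / y t₁) ^ (2 * p.μ) ≤
        Real.exp (-(p.μ * (Real.log (y t₁) - Real.log (x t₁)))) := by
      rw [Real.rpow_def_of_pos (by positivity), Real.exp_le_exp,
        Real.log_div hx1.ne' hy1.ne']
      linarith [mul_nonneg hμ.le a10]
    have b3 : p.timeIntegral (x t₁ / y t₁) ≤ k₅ * (4 * k / η) * D := by
      calc _ ≤ k₅ * (x t₁ / y t₁) ^ (2 * p.μ) := a11.2
        _ ≤ k₅ * (4 * k / η * D) := by gcongr; exact b2.trans b1
        _ = _ := by ring
    have e : (t₂ - t₁) * Real.exp (2 * S) - p.timeIntegral 1 =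
        ((t₂ - t₁) * Real.exp (2 * S) - (p.timeIntegral 1 - p.timeIntegral (x t₁ / y t₁))) -
          p.timeIntegral (x t₁ / y t₁) := by ring
    rw [e]
    calc _ ≤ _ := abs_sub _ _
      _ ≤ 2 * k ^ 3 * (3 * (k ^ 3 * (1 / p.μ + 1 / p.ν)) + 8 * k ^ 2) / p.μ * D +
          k₅ * (4 * k / η) * D := by
          rw [abs_of_nonneg a11.1]
          exact add_le_add a2 b3
      _ = c₂ * D := by rw [hc₂]; ring
      _ ≤ (c₁ + c₂) * D := by gcongr; linarith

/-! ### Control of whole passages -/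

namespace IsOrbit

variable {p : CubicCoeffs} {f g : ℝ → ℝ → ℝ} {ρ k : ℝ} {x y : ℝ → ℝ} {t₁ t₂ : ℝ}

/-- At the entry `e^{μw} = (y / x)^μ` is at most of the order of `1 / I`; near constancy carries
this along the orbit. It forces the whole orbit to low levels when the entry is close to the axis.
-/
lemma exp_logScale_le (h : IsOrbit p f g ρ x y t₁ t₂) (hb : HasFieldBounds p f g ρ k)
    (hp : p.Admissible) (hL : p.FirstIntegralCondition) {t : ℝ} (ht : t ∈ Icc t₁ t₂) :
    Real.exp (p.logScale (x t) (y t)) ≤ 4 * k * ρ * (x t₁ / y t₁) ^ p.μ := by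
  have m1 : t₁ ∈ Icc t₁ t₂ := left_mem_Icc.2 (ht.1.trans ht.2)
  have hx := h.x_pos t₁ m1
  have hy := h.y_pos t₁ m1
  have hk := hb.one_le
  have hρ : 0 < ρ := hx.trans_le (h.x_le t₁ m1)
  have h1 := hb.le_scale _ (h.x_mem m1) _ (h.y_mem m1)
  have h2 := h.exp_neg_logScale_le_two_mul hb hp hL ht m1
  have h3 : Real.exp (p.μ * (Real.log (y t₁) - Real.log (x t₁))) ≤
      4 * k * ρ * Real.exp (-p.logScale (x t) (y t)) := by
    calc _ ≤ k * ((x t₁ + y t₁) * Real.exp (-p.logScale (x t₁) (y t₁))) := by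
          linarith [Real.exp_pos (-(p.ν * (Real.log (y t₁) - Real.log (x t₁))))]
      _ ≤ k * ((ρ + ρ) * (2 * Real.exp (-p.logScale (x t) (y t)))) := by
          gcongr
          · exact h.x_le t₁ m1
          · exact h.y_le t₁ m1
      _ = _ := by ring
  have e : (x t₁ / y t₁) ^ p.μ =
      (Real.exp (p.μ * (Real.log (y t₁) - Real.log (x t₁))))⁻¹ := by
    rw [Real.rpow_def_of_pos (by positivity), Real.log_div hx.ne' hy.ne', ← Real.exp_neg]
    ring_nf
  rw [Real.exp_neg] at h3
  rw [e, ← div_eq_mul_inv, le_div_iff₀ (Real.exp_pos _)]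
  have := mul_le_mul_of_nonneg_left h3 (Real.exp_pos (p.logScale (x t) (y t))).le
  refine this.trans (le_of_eq ?_)
  field_simp

/-- For slopes in `[0, w]` the degree-zero quotient is bounded. For negative slopes the factor `y /
x = e^s` compensates the growth of `e^{-νs}` because `ν ≤ 1`. -/
lemma y_le_mul_exp_logScale (h : IsOrbit p f g ρ x y t₁ t₂) (hb : HasFieldBounds p f g ρ k)
    (hp : p.Admissible) {t : ℝ} (ht : t ∈ Icc t₁ t₂) {w : ℝ} (hw : 0 ≤ w)
    (htw : Real.log (y t) - Real.log (x t) ≤ w) :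
    y t ≤ 2 * k * Real.exp w * Real.exp (p.logScale (x t) (y t)) := by
  have hx := h.x_pos t ht
  have hy := h.y_pos t ht
  have hk := hb.one_le
  have hμ := hp.μ_pos
  have hμ1 := hp.μ_le_one
  have hν := hp.ν_pos
  have hν1 := hp.ν_le_one
  have h1 := hb.scale_le _ (h.x_mem ht) _ (h.y_mem ht)
  have e : y t = x t * Real.exp (Real.log (y t) - Real.log (x t)) := by
    rw [Real.exp_sub, Real.exp_log hx, Real.exp_log hy]; field_simp
  set s := Real.log (y t) - Real.log (x t)
  set P := Real.exp (-p.logScale (x t) (y t)) with hPdef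
  have hP : 0 < P := Real.exp_pos _
  have key : y t * P ≤ 2 * k * Real.exp w := by
    rcases le_total 0 s with hs | hs
    · calc y t * P ≤ (x t + y t) * P := by gcongr; linarith
        _ ≤ k * (Real.exp (p.μ * s) + Real.exp (-(p.ν * s))) := h1
        _ ≤ k * (Real.exp w + Real.exp w) := by
          gcongr
          · nlinarith
          · nlinarith
        _ = _ := by ring
    · calc y t * P = x t * P * Real.exp s := by rw [e]; ring
        _ ≤ (x t + y t) * P * Real.exp s := by gcongr; linarith
        _ ≤ k * (Real.exp (p.μ * s) + Real.exp (-(p.ν * s))) * Real.exp s := by gcongr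
        _ = k * (Real.exp (p.μ * s + s) + Real.exp (-(p.ν * s) + s)) := by
          rw [Real.exp_add, Real.exp_add]; ring
        _ ≤ k * (Real.exp w + Real.exp w) := by
          gcongr
          · nlinarith
          · nlinarith
        _ = _ := by ring
  have : y t = y t * P * Real.exp (p.logScale (x t) (y t)) := by
    rw [mul_assoc, hPdef, ← Real.exp_add]; simp
  calc y t = y t * P * Real.exp (p.logScale (x t) (y t)) := this
    _ ≤ _ := by gcongr

end IsOrbit

namespace CubicCoeffs.Admissible

variable {p : CubicCoeffs} (hp : p.Admissible) (hL : p.FirstIntegralCondition)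
  {f g : ℝ → ℝ → ℝ} {ρ ρ₀ C k : ℝ}
include hp

/-- A passage that starts away from the vertical axis takes a bounded time. -/
lemma exists_time_bound (hρ₀ : 0 < ρ₀) (hR : IsRemainder f g ρ₀ C) :
    ∃ ρ : ℝ, 0 < ρ ∧ ρ ≤ ρ₀ ∧ ∀ ξ : ℝ, 0 < ξ → ∃ T : ℝ, ∀ (x y : ℝ → ℝ) (t₁ t₂ : ℝ), t₁ ≤ t₂ →
      IsOrbit p f g ρ x y t₁ t₂ → ξ ≤ x t₁ → t₂ - t₁ ≤ T := by
  obtain ⟨ρ₁, k, hρ₁, hρ₁₀, hb⟩ := hp.exists_fieldBounds hρ₀ hR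
  have ha := hp.a₀_pos
  have hk := hb.one_le
  obtain ⟨D, hD, hCD⟩ : ∃ D : ℝ, 0 < D ∧ C ≤ D := ⟨|C| + 1, by positivity, by
    linarith [le_abs_self C]⟩
  obtain ⟨ρ, hρ, h1, h2⟩ : ∃ ρ : ℝ, 0 < ρ ∧ ρ ≤ ρ₁ ∧ ρ ≤ p.a₀ / (8 * D) :=
    ⟨min ρ₁ (p.a₀ / (8 * D)), lt_min hρ₁ (by positivity), min_le_left _ _, min_le_right _ _⟩
  replace hb := hb.mono h1
  obtain ⟨c, hc⟩ : ∃ c, c = k * (p.a₀ + |p.a₁|) := ⟨_, rfl⟩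
  have hc0 : 0 < c := by rw [hc]; positivity
  obtain ⟨d, hd⟩ : ∃ d, d = p.a₀ / 4 := ⟨_, rfl⟩
  have hd0 : 0 < d := by rw [hd]; positivity
  refine ⟨ρ, hρ, h1.trans hρ₁₀, fun ξ hξ => ?_⟩
  obtain ⟨l, hl⟩ : ∃ l, l = Real.log ξ - c * (Real.log (2 * ρ) - Real.log ξ) := ⟨_, rfl⟩
  refine ⟨(Real.log ρ - l) / (d * Real.exp (2 * l)), fun x y t₁ t₂ h12 h hx1 => ?_⟩
  have m1 := left_mem_Icc.2 h12
  have m2 := right_mem_Icc.2 h12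
  -- The coordinate `x` itself may decrease where `a₁ < 0`. The subtracted term is `c log (1 + y /
  -- x)`, which decreases along the orbit; `c` is chosen so that its decrease pays for the mixed
  -- term and supplies `a₀ y²`. Thus `Λ` grows at a rate of at least `d (x + y)²`, which keeps `x`
  -- above `e^l` and bounds the time.
  set Λ : ℝ → ℝ := fun s => Real.log (x s) - c * (Real.log (x s + y s) - Real.log (x s)) with hΛ
  have dΛ : ∀ s ∈ Icc t₁ t₂, HasDerivWithinAt Λ
      ((p.xForm (x s) (y s) + f (x s) (y s)) + c * (y s / (x s + y s)) *
        (p.quad (x s) (y s) + (f (x s) (y s) + g (x s) (y s)))) (Icc t₁ t₂) s := by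
    intro s hs
    have hx := h.x_pos s hs
    have hy := h.y_pos s hs
    have hn : 0 < x s + y s := by positivity
    have d1 := ((h.x_deriv s hs).add (h.y_deriv s hs)).log (by simpa using hn.ne')
    refine ((h.hasDerivWithinAt_log_x hs).sub
      ((d1.sub (h.hasDerivWithinAt_log_x hs)).const_mul c)).congr_deriv ?_
    rw [← p.xForm_add_yForm]
    simp only [Pi.add_apply]
    field_simp
    ring
  have bΛ : ∀ s ∈ Icc t₁ t₂, d * (x s + y s) ^ 2 ≤
      (p.xForm (x s) (y s) + f (x s) (y s)) + c * (y s / (x s + y s)) *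
        (p.quad (x s) (y s) + (f (x s) (y s) + g (x s) (y s))) := by
    intro s hs
    have hx := h.x_pos s hs
    have hy := h.y_pos s hs
    have hn : 0 < x s + y s := by positivity
    have hxy := mul_pos hx hy
    have b1 := hb.sq_le _ (h.x_mem hs) _ (h.y_mem hs)
    have b2 : |f (x s) (y s)| ≤ D * (x s + y s) ^ 3 :=
      (hR.f_le _ ⟨hx.le, (h.x_le s hs).trans (h1.trans hρ₁₀)⟩ _
        ⟨hy.le, (h.y_le s hs).trans (h1.trans hρ₁₀)⟩).trans (by gcongr)
    have b3 : (p.a₀ + |p.a₁|) * (y s * (x s + y s)) ≤ c * (y s / (x s + y s)) *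
        (p.quad (x s) (y s) + (f (x s) (y s) + g (x s) (y s))) := by
      calc _ = (p.a₀ + |p.a₁|) * (y s / (x s + y s)) * (x s + y s) ^ 2 := by field_simp
        _ ≤ (p.a₀ + |p.a₁|) * (y s / (x s + y s)) *
            (k * (p.quad (x s) (y s) + (f (x s) (y s) + g (x s) (y s)))) := by gcongr
        _ = _ := by rw [hc]; ring
    have b4 : D * (x s + y s) ^ 3 ≤ p.a₀ / 4 * (x s + y s) ^ 2 := by
      have : x s + y s ≤ p.a₀ / (8 * D) + p.a₀ / (8 * D) :=
        add_le_add ((h.x_le s hs).trans h2) ((h.y_le s hs).trans h2)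
      calc D * (x s + y s) ^ 3 = D * (x s + y s) * (x s + y s) ^ 2 := by ring
        _ ≤ D * (p.a₀ / (8 * D) + p.a₀ / (8 * D)) * (x s + y s) ^ 2 := by gcongr
        _ = _ := by field_simp; norm_num
    have b5 : p.a₀ * x s ^ 2 - |p.a₁| * (x s * y s) ≤ p.xForm (x s) (y s) := by
      have : -|p.a₁| * (x s * y s) ≤ p.a₁ * (x s * y s) := by
        gcongr; exact neg_abs_le _
      have h2 := mul_nonneg hp.a₂_nonneg (sq_nonneg (y s))
      simp only [xForm]
      linarith
    have b6 := (abs_le.1 b2).1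
    rw [hd]
    nlinarith [mul_nonneg ha.le (sq_nonneg (x s)), mul_nonneg ha.le (sq_nonneg (y s)),
      mul_nonneg (abs_nonneg p.a₁) (sq_nonneg (y s)), mul_pos ha hxy,
      mul_nonneg ha.le (sq_nonneg (x s - y s))]
  have mono : ∀ s ∈ Icc t₁ t₂, Λ t₁ ≤ Λ s := by
    intro s hs
    have := antitoneOn_Icc_of_hasDerivWithinAt (fun s hs => (dΛ s hs).neg)
      (fun s hs => by
        have := bΛ s hs
        have : 0 ≤ d * (x s + y s) ^ 2 := by positivity
        linarith) m1 hs hs.1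
    simp only [Pi.neg_apply] at this
    linarith
  have hΛx : ∀ s ∈ Icc t₁ t₂, Λ s ≤ Real.log (x s) := by
    intro s hs
    have hx := h.x_pos s hs
    have hy := h.y_pos s hs
    have : Real.log (x s) ≤ Real.log (x s + y s) := Real.log_le_log hx (by linarith)
    have : 0 ≤ c * (Real.log (x s + y s) - Real.log (x s)) :=
      mul_nonneg hc0.le (by linarith)
    simp only [hΛ]
    linarith
  have hl1 : l ≤ Λ t₁ := by
    have hx := h.x_pos t₁ m1
    have hy := h.y_pos t₁ m1
    have i1 : Real.log ξ ≤ Real.log (x t₁) := Real.log_le_log hξ hx1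
    have i2 : Real.log (x t₁ + y t₁) ≤ Real.log (2 * ρ) :=
      Real.log_le_log (by positivity) (by linarith [h.x_le t₁ m1, h.y_le t₁ m1])
    rw [hl, hΛ]
    simp only
    have : c * (Real.log (x t₁ + y t₁) - Real.log (x t₁)) ≤
        c * (Real.log (2 * ρ) - Real.log ξ) := by gcongr
    linarith
  have hrate : ∀ s ∈ Icc t₁ t₂, d * Real.exp (2 * l) ≤ d * (x s + y s) ^ 2 := by
    intro s hs
    have hx := h.x_pos s hs
    have hy := h.y_pos s hs
    have : Real.exp l ≤ x s := by
      rw [← Real.le_log_iff_exp_le hx]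
      linarith [mono s hs, hΛx s hs]
    have e : Real.exp (2 * l) = Real.exp l ^ 2 := by rw [sq, ← Real.exp_add]; ring_nf
    rw [e]
    gcongr
    linarith
  have fin := antitoneOn_Icc_of_hasDerivWithinAt
    (fun s hs => ((hasDerivWithinAt_id s (Icc t₁ t₂)).const_mul (d * Real.exp (2 * l))).sub
      (dΛ s hs)) (fun s hs => by linarith [bΛ s hs, hrate s hs]) m1 m2 h12
  simp only [Pi.sub_apply, id] at fin
  have hlast : Λ t₂ ≤ Real.log ρ :=
    (hΛx t₂ m2).trans (Real.log_le_log (h.x_pos t₂ m2) (h.x_le t₂ m2))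
  rw [le_div_iff₀ (by positivity)]
  linarith

include hL

/-- An orbit that starts close to the vertical axis is close to the horizontal axis once its slope
is bounded. -/
lemma exists_y_lt (hb : HasFieldBounds p f g ρ k) (η w : ℝ) {ε : ℝ}
    (hε : 0 < ε) :
    ∃ ξ : ℝ, 0 < ξ ∧ ∀ (x y : ℝ → ℝ) (t₁ t₂ : ℝ), IsOrbit p f g ρ x y t₁ t₂ → y t₁ = η →
      x t₁ < ξ → ∀ t ∈ Icc t₁ t₂, Real.log (y t) - Real.log (x t) ≤ w → y t < ε := by
  have hk := hb.one_le
  have hμ := hp.μ_pos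
  have hlim : Tendsto (fun z : ℝ => 2 * k * Real.exp (max w 0) * (4 * k * ρ * (z / η) ^ p.μ))
      (𝓝 0) (𝓝 0) := by
    have : ContinuousAt (fun z : ℝ =>
        2 * k * Real.exp (max w 0) * (4 * k * ρ * (z / η) ^ p.μ)) 0 := by
      refine ContinuousAt.mul continuousAt_const (ContinuousAt.mul continuousAt_const ?_)
      exact (continuousAt_id.div_const η).rpow_const (Or.inr hμ.le)
    simpa [ContinuousAt, Real.zero_rpow hμ.ne'] using this
  obtain ⟨ξ, hξ, H⟩ := Metric.eventually_nhds_iff.1 (hlim.eventually (gt_mem_nhds hε))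
  refine ⟨ξ, hξ, fun x y t₁ t₂ h hy1 hx1 t ht htw => ?_⟩
  have m1 : t₁ ∈ Icc t₁ t₂ := left_mem_Icc.2 (ht.1.trans ht.2)
  have hx := h.x_pos t₁ m1
  have h1 := h.y_le_mul_exp_logScale hb hp ht (le_max_right w 0) (htw.trans (le_max_left w 0))
  have h2 := h.exp_logScale_le hb hp hL ht
  have h3 := H (y := x t₁) (by rw [Real.dist_eq, sub_zero, abs_of_pos hx]; exact hx1)
  rw [hy1] at h2
  calc y t ≤ _ := h1
    _ ≤ 2 * k * Real.exp (max w 0) * (4 * k * ρ * (x t₁ / η) ^ p.μ) := by gcongr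
    _ < ε := h3

/-- An orbit that starts close to the vertical axis does not rise above its starting height. -/
lemma exists_y_le_entry (hρ₀ : 0 < ρ₀) (hR : IsRemainder f g ρ₀ C) :
    ∃ ρ : ℝ, 0 < ρ ∧ ρ ≤ ρ₀ ∧ ∀ η : ℝ, 0 < η → ∃ ξ : ℝ, 0 < ξ ∧
      ∀ (x y : ℝ → ℝ) (t₁ t₂ : ℝ), IsOrbit p f g ρ x y t₁ t₂ → y t₁ = η →
        x t₁ < ξ → ∀ t ∈ Icc t₁ t₂, y t ≤ η := by
  obtain ⟨ρ₁, k, hρ₁, hρ₁₀, hb⟩ := hp.exists_fieldBounds hρ₀ hR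
  have hb2 := hp.b₂_pos
  obtain ⟨D, hD, hCD⟩ : ∃ D : ℝ, 0 < D ∧ C ≤ D := ⟨|C| + 1, by positivity, by
    linarith [le_abs_self C]⟩
  obtain ⟨ρ, hρ, h1, h2⟩ : ∃ ρ : ℝ, 0 < ρ ∧ ρ ≤ ρ₁ ∧ ρ ≤ p.b₂ / (16 * D) :=
    ⟨min ρ₁ (p.b₂ / (16 * D)), lt_min hρ₁ (by positivity), min_le_left _ _, min_le_right _ _⟩
  replace hb := hb.mono h1
  -- In the sector `x ≤ m y` the terms with `b₁` and with `g` each cost at most half of `b₂ y²`, so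
  -- `y` decreases there. Once the orbit has left the sector, `exists_y_lt` keeps `y` below `η`.
  obtain ⟨m, hm, hm1, hm2⟩ : ∃ m : ℝ, 0 < m ∧ m ≤ 1 ∧ |p.b₁| * m ≤ p.b₂ / 2 := by
    refine ⟨min 1 (p.b₂ / (2 * (|p.b₁| + 1))), lt_min one_pos (by positivity), min_le_left _ _, ?_⟩
    calc |p.b₁| * min 1 (p.b₂ / (2 * (|p.b₁| + 1))) ≤ (|p.b₁| + 1) * (p.b₂ / (2 * (|p.b₁| + 1))) := by
          gcongr
          · linarith
          · exact min_le_right _ _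
      _ = p.b₂ / 2 := by field_simp
  refine ⟨ρ, hρ, h1.trans hρ₁₀, fun η hη => ?_⟩
  obtain ⟨ξ, hξ, H⟩ := hp.exists_y_lt hL hb η (-Real.log m) hη
  refine ⟨ξ, hξ, fun x y t₁ t₂ h hy1 hx1 t ht => ?_⟩
  rcases le_total (Real.log (y t) - Real.log (x t)) (-Real.log m) with hw | hw
  · exact (H x y t₁ t₂ h hy1 hx1 t ht hw).le
  · have h' := h.mono le_rfl le_rfl ht.2
    have hanti := antitoneOn_Icc_of_hasDerivWithinAt (fun s hs => h'.y_deriv s hs)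
      (fun s hs => ?_) (left_mem_Icc.2 ht.1) (right_mem_Icc.2 ht.1) ht.1
    · rw [hy1] at hanti
      exact hanti
    · have hx := h'.x_pos s hs
      have hy := h'.y_pos s hs
      have hxm : x s ≤ m * y s := by
        have := h'.slope_antitoneOn hb hs (right_mem_Icc.2 ht.1) hs.2
        simp only at this
        have i : Real.log (x s) ≤ Real.log (m * y s) := by
          rw [Real.log_mul hm.ne' hy.ne']; linarith
        exact (Real.log_le_log_iff hx (by positivity)).1 i
      have hxy : x s ≤ y s := hxm.trans (by nlinarith)
      have b2 : |g (x s) (y s)| ≤ D * (x s + y s) ^ 3 :=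
        (hR.g_le _ ⟨hx.le, (h'.x_le s hs).trans (h1.trans hρ₁₀)⟩ _
          ⟨hy.le, (h'.y_le s hs).trans (h1.trans hρ₁₀)⟩).trans (by gcongr)
      have b3 : D * (x s + y s) ^ 3 ≤ p.b₂ / 2 * y s ^ 2 := by
        calc D * (x s + y s) ^ 3 ≤ D * (y s + y s) ^ 3 := by gcongr
          _ = 8 * D * y s * y s ^ 2 := by ring
          _ ≤ 8 * D * (p.b₂ / (16 * D)) * y s ^ 2 := by
            gcongr; exact (h'.y_le s hs).trans h2
          _ = _ := by field_simp; norm_num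
      have b4 : -(p.b₂ / 2 * y s ^ 2) ≤ p.b₁ * x s * y s := by
        have i1 : |p.b₁ * x s * y s| ≤ p.b₂ / 2 * y s ^ 2 := by
          rw [abs_mul, abs_mul, abs_of_pos hx, abs_of_pos hy]
          calc |p.b₁| * x s * y s ≤ |p.b₁| * (m * y s) * y s := by gcongr
            _ = |p.b₁| * m * y s ^ 2 := by ring
            _ ≤ _ := by gcongr
        exact (abs_le.1 i1).1
      have b5 : 0 ≤ p.yForm (x s) (y s) + g (x s) (y s) := by
        have := mul_nonneg hp.b₀_nonneg (sq_nonneg (x s))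
        have := (abs_le.1 b2).1
        simp only [yForm]
        linarith
      linarith [mul_nonneg hy.le b5]

set_option maxHeartbeats 800000 in
/-- The asymptotics of a whole passage in terms of the value of the first integral on the
diagonal. -/
lemma exists_passage_asymptotics (hρ₀ : 0 < ρ₀) (hR : IsRemainder f g ρ₀ C) :
    ∃ ρ : ℝ, 0 < ρ ∧ ρ ≤ ρ₀ ∧ ∃ K₁ K₂ : ℝ → ℝ,
      ((∀ x ∈ Icc 0 ρ₀, ∀ y ∈ Icc 0 ρ₀, f x y = 0 ∧ g x y = 0) →
        ∀ z ∈ Ioc 0 ρ, K₁ z = 0 ∧ K₂ z = 0) ∧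
      ∀ ζ ∈ Ioc 0 ρ, ∀ η ∈ Ioc 0 ρ, ∃ C' ξ₁ : ℝ, 0 < C' ∧ 0 < ξ₁ ∧
        ∀ (x y : ℝ → ℝ) (t₁ t₂ : ℝ), t₁ ≤ t₂ → IsOrbit p f g ρ x y t₁ t₂ → y t₁ = η →
          x t₂ = ζ → x t₁ < ξ₁ → ∃ S : ℝ,
            Real.exp S ≤ C' * x t₁ ^ p.μ ∧
            |p.μ * Real.log (x t₁) + (1 - p.μ) * Real.log η + p.σ * Real.log p.c₂ - K₂ η - S| ≤
              C' * (Real.exp S * (1 + |S|)) ∧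
            |p.ν * Real.log (y t₂) + (1 - p.ν) * Real.log ζ + p.σ * Real.log p.c₀ - K₁ ζ - S| ≤
              C' * (Real.exp S * (1 + |S|)) ∧
            |(t₂ - t₁) * Real.exp (2 * S) - (p.timeIntegral 1 + p.swap.timeIntegral 1)| ≤
              C' * Real.exp S := by
  obtain ⟨ρ₁, k, hρ₁, hρ₁₀, hb⟩ := hp.exists_fieldBounds hρ₀ hR
  obtain ⟨ρ₂, hρ₂, hρ₂₀, K₂, hK₂, H₂⟩ := hp.exists_entry_asymptotics hL hρ₀ hR
  obtain ⟨ρ₃, hρ₃, hρ₃₀, K₁, hK₁, H₁⟩ := hp.swap.exists_entry_asymptotics hL.swap hρ₀ hR.swap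
  obtain ⟨ρ, hρ, h1, h2, h3⟩ : ∃ ρ : ℝ, 0 < ρ ∧ ρ ≤ ρ₁ ∧ ρ ≤ ρ₂ ∧ ρ ≤ ρ₃ :=
    ⟨min ρ₁ (min ρ₂ ρ₃), lt_min hρ₁ (lt_min hρ₂ hρ₃), by simp, by simp, by simp⟩
  replace hb := hb.mono h1
  have hk := hb.one_le
  refine ⟨ρ, hρ, h1.trans hρ₁₀, K₁, K₂, fun h0 z hz => ⟨?_, ?_⟩, fun ζ hζ η hη => ?_⟩
  · exact hK₁ (fun x hx y hy => ⟨(h0 y hy x hx).2, (h0 y hy x hx).1⟩) z ⟨hz.1, hz.2.trans h3⟩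
  · exact hK₂ h0 z ⟨hz.1, hz.2.trans h2⟩
  obtain ⟨C₂, hC₂, A₂⟩ := H₂ η ⟨hη.1, hη.2.trans h2⟩
  obtain ⟨C₁, hC₁, A₁⟩ := H₁ ζ ⟨hζ.1, hζ.2.trans h3⟩
  -- At the exit the slope is at most `log ρ - log ζ`, so the exit point lies below the diagonal.
  -- Taking `ξ < η` puts the entry above it, and the orbit must cross.
  obtain ⟨ξ₂, hξ₂, B⟩ := hp.exists_y_lt hL hb η (Real.log ρ - Real.log ζ) hζ.1
  have hη0 := hη.1
  refine ⟨C₁ + C₂ + 4 * k * ρ * (1 / η) ^ p.μ, min ξ₂ η, by positivity, lt_min hξ₂ hη.1,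
    fun x y t₁ t₂ h12 h hy1 hx2 hx1 => ?_⟩
  have m1 := left_mem_Icc.2 h12
  have m2 := right_mem_Icc.2 h12
  have hx1p := h.x_pos t₁ m1
  have hy2 : y t₂ < x t₂ := by
    rw [hx2]
    refine B x y t₁ t₂ h hy1 (hx1.trans_le (min_le_left _ _)) t₂ m2 ?_
    rw [hx2]
    linarith [Real.log_le_log (h.y_pos t₂ m2) (h.y_le t₂ m2)]
  have hxy1 : x t₁ < y t₁ := by rw [hy1]; exact hx1.trans_le (min_le_right _ _)
  obtain ⟨t, ht, htw⟩ : ∃ t ∈ Icc t₁ t₂, y t - x t = 0 := by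
    have hcont : ContinuousOn (fun s => y s - x s) (Icc t₁ t₂) := fun s hs =>
      ((h.y_deriv s hs).continuousWithinAt).sub (h.x_deriv s hs).continuousWithinAt
    have := intermediate_value_Icc' h12 hcont
    obtain ⟨t, ht, e⟩ := this (⟨by linarith, by linarith⟩ : (0 : ℝ) ∈ Icc (y t₂ - x t₂) (y t₁ - x t₁))
    exact ⟨t, ht, e⟩
  have hd : x t = y t := by linarith
  have a2 := A₂ x y t₁ t ht.1 (h.mono h2 le_rfl ht.2) hy1 hd
  -- The exit half, run backwards with exchanged coordinates, is an entry half ending at the same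
  -- point of the diagonal, hence at the same `S`.
  have a1 := A₁ (fun s => y (-s)) (fun s => x (-s)) (-t₂) (-t) (by linarith [ht.2])
    (h.mono h3 ht.1 le_rfl).swap (by simpa using hx2) (by simpa using hd.symm)
  simp only [neg_neg, swap_logScale, swap_μ, swap_σ, swap_c₂] at a1
  have a3 := h.exp_logScale_le hb hp hL ht
  rw [hy1] at a3
  obtain ⟨S, hS⟩ : ∃ S, S = p.logScale (x t) (y t) := ⟨_, rfl⟩
  rw [← hS] at a1 a2 a3
  have hkη : 0 < 4 * k * ρ * (1 / η) ^ p.μ := by positivity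
  have hE := Real.exp_pos S
  refine ⟨S, ?_, ?_, ?_, ?_⟩
  · calc Real.exp S ≤ 4 * k * ρ * (x t₁ / η) ^ p.μ := a3
      _ = 4 * k * ρ * (1 / η) ^ p.μ * x t₁ ^ p.μ := by
        rw [div_eq_mul_one_div, Real.mul_rpow hx1p.le (by positivity)]; ring
      _ ≤ _ := by gcongr; linarith
  · exact a2.1.trans (by gcongr; linarith)
  · exact a1.1.trans (by gcongr; linarith)
  · have e : (t₂ - t₁) * Real.exp (2 * S) - (p.timeIntegral 1 + p.swap.timeIntegral 1) =
        ((t - t₁) * Real.exp (2 * S) - p.timeIntegral 1) +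
        ((-t - -t₂) * Real.exp (2 * S) - p.swap.timeIntegral 1) := by ring
    rw [e]
    calc _ ≤ _ := abs_add_le _ _
      _ ≤ C₂ * Real.exp S + C₁ * Real.exp S := add_le_add a2.2 a1.2
      _ ≤ _ := by nlinarith

end CubicCoeffs.Admissible

/-! ### Elimination of the first integral from the asymptotics -/

section Asymptotic

lemma abs_exp_sub_one_le_mul_exp (v : ℝ) : |Real.exp v - 1| ≤ |v| * Real.exp |v| := by
  rcases le_total 0 v with hv | hv
  · have h1 : 1 - v ≤ Real.exp (-v) := by linarith [Real.add_one_le_exp (-v)]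
    have h2 : Real.exp v * Real.exp (-v) = 1 := by rw [← Real.exp_add]; simp
    rw [abs_of_nonneg hv, abs_of_nonneg (by linarith [Real.add_one_le_exp v])]
    nlinarith [Real.exp_pos v]
  · have h1 := Real.add_one_le_exp v
    have h2 : Real.exp v ≤ 1 := Real.exp_le_one_iff.2 hv
    rw [abs_of_nonpos hv, abs_of_nonpos (by linarith)]
    have h3 : 1 ≤ Real.exp (-v) := Real.one_le_exp (by linarith)
    nlinarith

lemma exp_mul_one_add_abs_le_one {S : ℝ} (hS : S ≤ 0) : Real.exp S * (1 + |S|) ≤ 1 := by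
  have h1 := Real.add_one_le_exp (-S)
  have h2 : Real.exp S * Real.exp (-S) = 1 := by rw [← Real.exp_add]; simp
  rw [abs_of_nonpos hS]
  nlinarith [Real.exp_pos S]

variable {J C : ℝ}

lemma exists_abs_log_time_le (hJ : 0 < J) (hC : 0 < C) : ∃ δ C' : ℝ, 0 < δ ∧ δ ≤ 1 ∧ 0 < C' ∧
    ∀ S T : ℝ, Real.exp S ≤ δ → |T * Real.exp (2 * S) - J| ≤ C * Real.exp S →
      0 < T ∧ |2 * S + Real.log T - Real.log J| ≤ C' * Real.exp S := by
  -- This `δ` keeps `T e^{2S}` above `J / 2`, so that the logarithm of its quotient by `J` is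
  -- controlled from both sides.
  refine ⟨min 1 (J / (2 * C)), 2 * (C / J), lt_min one_pos (by positivity), min_le_left _ _,
    by positivity, fun S T hS h => ?_⟩
  have hE := Real.exp_pos (2 * S)
  have hS' : C * Real.exp S ≤ J / 2 := by
    calc C * Real.exp S ≤ C * (J / (2 * C)) := by
          gcongr; exact hS.trans (min_le_right _ _)
      _ = J / 2 := by field_simp
  have h1 := abs_le.1 h
  have hTE : J / 2 ≤ T * Real.exp (2 * S) := by linarith
  have hT : 0 < T := by
    by_contra hn
    push Not at hn
    nlinarith
  refine ⟨hT, ?_⟩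
  have hR : 0 < T * Real.exp (2 * S) := by positivity
  have e : 2 * S + Real.log T - Real.log J = Real.log (T * Real.exp (2 * S) / J) := by
    rw [Real.log_div hR.ne' hJ.ne', Real.log_mul hT.ne' hE.ne', Real.log_exp]; ring
  have e' : -(2 * S + Real.log T - Real.log J) = Real.log (J / (T * Real.exp (2 * S))) := by
    rw [Real.log_div hJ.ne' hR.ne', Real.log_mul hT.ne' hE.ne', Real.log_exp]; ring
  have hp : 0 ≤ C * Real.exp S := by positivity
  rw [abs_le']
  constructor
  · rw [e]
    calc _ ≤ T * Real.exp (2 * S) / J - 1 := Real.log_le_sub_one_of_pos (by positivity)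
      _ = (T * Real.exp (2 * S) - J) / J := by field_simp
      _ ≤ (2 * (C * Real.exp S)) / J := by gcongr; linarith
      _ = _ := by ring
  · rw [e']
    calc _ ≤ J / (T * Real.exp (2 * S)) - 1 := Real.log_le_sub_one_of_pos (by positivity)
      _ = (J - T * Real.exp (2 * S)) / (T * Real.exp (2 * S)) := by field_simp
      _ ≤ (C * Real.exp S) / (T * Real.exp (2 * S)) := by gcongr; linarith
      _ ≤ (C * Real.exp S) / (J / 2) := by gcongr
      _ = _ := by field_simp

/-- Since `2S = -log T + O(1)`, the factor `e^S` contributes `T^{-1/2}` and `1 + |S|` contributes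
`log T`; for `T ≥ 3` the logarithm is at least one and absorbs the constants. -/
lemma exists_exp_mul_le_of_time (J : ℝ) (hC : 0 < C) : ∃ C' : ℝ, 0 < C' ∧ ∀ S T : ℝ, S ≤ 0 →
    3 ≤ T → |2 * S + Real.log T - Real.log J| ≤ C * Real.exp S →
      Real.exp S * (1 + |S|) ≤ C' * (T ^ (-(1 / 2) : ℝ) * Real.log T) := by
  refine ⟨Real.exp ((Real.log J + C) / 2) * (2 + |Real.log J| + C), by positivity,
    fun S T hS hT h => ?_⟩
  have hT0 : 0 < T := by linarith
  have hlog : 1 ≤ Real.log T := by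
    rw [Real.le_log_iff_exp_le hT0]
    linarith [Real.exp_one_lt_d9]
  have hE1 : Real.exp S ≤ 1 := Real.exp_le_one_iff.2 hS
  have h' := abs_le.1 (h.trans (mul_le_of_le_one_right hC.le hE1))
  have h1 : Real.exp S ≤ Real.exp ((Real.log J + C) / 2) * T ^ (-(1 / 2) : ℝ) := by
    rw [Real.rpow_def_of_pos hT0, ← Real.exp_add, Real.exp_le_exp]
    linarith
  have h2 : 1 + |S| ≤ (2 + |Real.log J| + C) * Real.log T := by
    rw [abs_of_nonpos hS]
    have := neg_abs_le (Real.log J)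
    nlinarith [abs_nonneg (Real.log J)]
  calc Real.exp S * (1 + |S|) ≤ Real.exp ((Real.log J + C) / 2) * T ^ (-(1 / 2) : ℝ) *
        ((2 + |Real.log J| + C) * Real.log T) := by gcongr
    _ = _ := by ring

/-- A coordinate with a given asymptotics in terms of the first integral `exp S` has the
corresponding asymptotics in terms of the time. -/
lemma exists_coordinate_asymptotics (hJ : 0 < J) (hC : 0 < C) {m : ℝ} (hm : 0 < m) (A : ℝ) :
    ∃ δ C' : ℝ, 0 < δ ∧ 0 < C' ∧ ∀ S T z : ℝ, 0 < z → Real.exp S ≤ δ → 3 ≤ T →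
      |T * Real.exp (2 * S) - J| ≤ C * Real.exp S →
      |m * Real.log z - A - S| ≤ C * (Real.exp S * (1 + |S|)) →
      ∃ e : ℝ, |e| ≤ C' * (T ^ (-(1 / 2) : ℝ) * Real.log T) ∧
        z = Real.exp ((A + Real.log J / 2) / m) * T ^ (-(1 / (2 * m))) * (1 + e) := by
  obtain ⟨δ, C₁, hδ, hδ1, hC₁, H₁⟩ := exists_abs_log_time_le hJ hC
  obtain ⟨C₂, hC₂, H₂⟩ := exists_exp_mul_le_of_time J hC₁
  refine ⟨δ, (C + C₁) / m * Real.exp ((C + C₁) / m) * C₂, hδ, by positivity,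
    fun S T z hz hS hT hTJ hzS => ?_⟩
  have hS0 : S ≤ 0 := Real.exp_le_one_iff.1 (hS.trans hδ1)
  obtain ⟨hT0, h1⟩ := H₁ S T hS hTJ
  have h2 := H₂ S T hS0 hT h1
  -- `v` is the logarithm of the quotient of `z` by its leading term. It is estimated linearly and
  -- then exponentiated.
  obtain ⟨v, hv⟩ : ∃ v, v = Real.log z - (A + Real.log J / 2) / m + Real.log T / (2 * m) :=
    ⟨_, rfl⟩
  have hmv : m * v = (m * Real.log z - A - S) + (2 * S + Real.log T - Real.log J) / 2 := by
    rw [hv]; field_simp; ring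
  have hE := Real.exp_pos S
  have hES : Real.exp S ≤ Real.exp S * (1 + |S|) :=
    le_mul_of_one_le_right hE.le (by linarith [abs_nonneg S])
  have hv1 : |v| ≤ (C + C₁) / m * (Real.exp S * (1 + |S|)) := by
    have : m * |v| ≤ (C + C₁) * (Real.exp S * (1 + |S|)) := by
      calc m * |v| = |m * v| := by rw [abs_mul, abs_of_pos hm]
        _ ≤ |m * Real.log z - A - S| + |(2 * S + Real.log T - Real.log J) / 2| := by
          rw [hmv]; exact abs_add_le _ _
        _ ≤ C * (Real.exp S * (1 + |S|)) + C₁ * (Real.exp S * (1 + |S|)) := by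
          refine add_le_add hzS ?_
          rw [abs_div, abs_two]
          have : C₁ * Real.exp S ≤ C₁ * (Real.exp S * (1 + |S|)) := by gcongr
          linarith [abs_nonneg (2 * S + Real.log T - Real.log J)]
        _ = _ := by ring
    rw [div_mul_eq_mul_div, le_div_iff₀ hm]
    linarith
  have hv2 : |v| ≤ (C + C₁) / m :=
    hv1.trans (mul_le_of_le_one_right (by positivity) (exp_mul_one_add_abs_le_one hS0))
  refine ⟨Real.exp v - 1, ?_, ?_⟩
  · calc |Real.exp v - 1| ≤ |v| * Real.exp |v| := abs_exp_sub_one_le_mul_exp v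
      _ ≤ ((C + C₁) / m * (Real.exp S * (1 + |S|))) * Real.exp ((C + C₁) / m) := by gcongr
      _ ≤ ((C + C₁) / m * (C₂ * (T ^ (-(1 / 2) : ℝ) * Real.log T))) *
          Real.exp ((C + C₁) / m) := by gcongr
      _ = _ := by ring
  · rw [Real.rpow_def_of_pos hT0, ← Real.exp_add, add_sub_cancel, ← Real.exp_add, hv]
    conv_lhs => rw [← Real.exp_log hz]
    congr 1
    field_simp
    ring

/-- Two coordinates with given asymptotics in terms of the first integral `exp S` are related by
a power law. -/
lemma exists_power_law (hC : 0 < C) {m n : ℝ} (hm : 0 < m) (hn : 0 < n) (A B : ℝ) :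
    ∃ δ C' : ℝ, 0 < δ ∧ 0 < C' ∧ ∀ S z ω : ℝ, 0 < z → 0 < ω → z ≤ Real.exp (-1) →
      Real.exp S ≤ δ → Real.exp S ≤ C * z ^ m →
      |m * Real.log z - A - S| ≤ C * (Real.exp S * (1 + |S|)) →
      |n * Real.log ω - B - S| ≤ C * (Real.exp S * (1 + |S|)) →
      ∃ e : ℝ, |e| ≤ C' * (-z ^ m * Real.log z) ∧
        ω = Real.exp ((B - A) / n) * z ^ (m / n) * (1 + e) := by
  -- With `C e^S ≤ 1 / 2` the error in the relation between `S` and `log z` is at most `(1 + |S|) /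
  -- 2`, and the `|S|` in it can be absorbed to bound `|S|` by a multiple of `-log z`.
  refine ⟨min 1 (1 / (2 * C)),
    2 * C / n * Real.exp (2 * C / n) * (C * (2 + 2 * |A| + 2 * m)), lt_min one_pos (by positivity),
    by positivity, fun S z ω hz hω hz1 hS hSz h1 h2 => ?_⟩
  have hS0 : S ≤ 0 := Real.exp_le_one_iff.1 (hS.trans (min_le_left _ _))
  have hCS : C * Real.exp S ≤ 1 / 2 := by
    calc C * Real.exp S ≤ C * (1 / (2 * C)) := by
          gcongr; exact hS.trans (min_le_right _ _)
      _ = 1 / 2 := by field_simp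
  have hlog : Real.log z ≤ -1 := by
    rw [Real.log_le_iff_le_exp hz]; exact hz1
  have hE := Real.exp_pos S
  have hSb : 1 + |S| ≤ (2 + 2 * |A| + 2 * m) * (-Real.log z) := by
    have i1 : C * (Real.exp S * (1 + |S|)) ≤ 1 / 2 * (1 + |S|) := by
      rw [← mul_assoc]; gcongr
    have i2 := abs_le.1 (h1.trans i1)
    have i3 : |S| = -S := abs_of_nonpos hS0
    rw [i3] at i2 ⊢
    have := neg_abs_le A
    have := le_abs_self A
    nlinarith [abs_nonneg A]
  have hbig : Real.exp S * (1 + |S|) ≤ C * (2 + 2 * |A| + 2 * m) * (-z ^ m * Real.log z) := by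
    calc Real.exp S * (1 + |S|) ≤ C * z ^ m * ((2 + 2 * |A| + 2 * m) * (-Real.log z)) := by
          gcongr
      _ = _ := by ring
  obtain ⟨v, hv⟩ : ∃ v, v = Real.log ω - (B - A) / n - m / n * Real.log z := ⟨_, rfl⟩
  have hnv : n * v = (n * Real.log ω - B - S) - (m * Real.log z - A - S) := by
    rw [hv]; field_simp; ring
  have hv1 : |v| ≤ 2 * C / n * (Real.exp S * (1 + |S|)) := by
    have : n * |v| ≤ 2 * C * (Real.exp S * (1 + |S|)) := by
      calc n * |v| = |n * v| := by rw [abs_mul, abs_of_pos hn]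
        _ ≤ |n * Real.log ω - B - S| + |m * Real.log z - A - S| := by
          rw [hnv]; exact abs_sub _ _
        _ ≤ _ := by linarith
    rw [div_mul_eq_mul_div, le_div_iff₀ hn]
    linarith
  have hv2 : |v| ≤ 2 * C / n :=
    hv1.trans (mul_le_of_le_one_right (by positivity) (exp_mul_one_add_abs_le_one hS0))
  refine ⟨Real.exp v - 1, ?_, ?_⟩
  · calc |Real.exp v - 1| ≤ |v| * Real.exp |v| := abs_exp_sub_one_le_mul_exp v
      _ ≤ (2 * C / n * (Real.exp S * (1 + |S|))) * Real.exp (2 * C / n) := by gcongr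
      _ ≤ (2 * C / n * (C * (2 + 2 * |A| + 2 * m) * (-z ^ m * Real.log z))) *
          Real.exp (2 * C / n) := by gcongr
      _ = _ := by ring
  · rw [Real.rpow_def_of_pos hz, ← Real.exp_add, add_sub_cancel, ← Real.exp_add, hv]
    conv_lhs => rw [← Real.exp_log hω]
    congr 1
    field_simp
    ring

end Asymptotic

/-! ### The constants of the unperturbed cubic field -/

namespace CubicCoeffs

variable {p : CubicCoeffs}

lemma swap_swap : p.swap.swap = p := rfl

namespace Admissible

variable (hp : p.Admissible)
include hp

/-- The substitution `m = 1 / z` exchanges the two coordinates, hence the two halves of the passage.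
The left side is the integrand produced by the change of variables for powers. -/
lemma timeDensity_inv {z : ℝ} (hz : 0 < z) :
    |(-1 : ℝ)| * z ^ ((-1 : ℝ) - 1) * p.timeDensity (z ^ (-1 : ℝ)) = p.swap.timeDensity z := by
  have hq := hp.quad_pos (x := 1) (y := z) (by linarith)
  have e1 : p.quad (z ^ (-1 : ℝ)) 1 = p.quad 1 z / z ^ (2 : ℝ) := by
    rw [Real.rpow_neg_one, Real.rpow_two]; simp only [quad]; field_simp
  simp only [timeDensity, swap_μ, swap_ν, swap_quad]
  rw [e1, ← Real.rpow_mul hz.le, Real.div_rpow hq.le (by positivity), ← Real.rpow_mul hz.le,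
    abs_neg, abs_one, one_mul, div_div_eq_mul_div, ← Real.rpow_add hz, ← mul_div_assoc,
    ← Real.rpow_add hz, add_comm p.ν p.μ]
  congr 2
  ring

lemma integral_timeDensity :
    ∫ M in Ioi (0 : ℝ), p.timeDensity M = p.timeIntegral 1 + p.swap.timeIntegral 1 := by
  have h1 := hp.intervalIntegrable_timeDensity zero_le_one
  have h2 := hp.swap.intervalIntegrable_timeDensity zero_le_one
  rw [intervalIntegrable_iff_integrableOn_Ioo_of_le zero_le_one] at h2
  rw [intervalIntegrable_iff_integrableOn_Ioc_of_le zero_le_one] at h1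
  -- The indicator lets a substitution on the whole half-line map `(1, ∞)` to `(0, 1)`.
  set G : ℝ → ℝ := (Ioi 1).indicator p.timeDensity with hG
  have hcongr : EqOn (fun z : ℝ => (|(-1 : ℝ)| * z ^ ((-1 : ℝ) - 1)) • G (z ^ (-1 : ℝ)))
      ((Ioo 0 1).indicator p.swap.timeDensity) (Ioi 0) := by
    intro z hz
    have hz0 : 0 < z := hz
    simp only [smul_eq_mul]
    by_cases hz1 : z < 1
    · have : z ^ (-1 : ℝ) ∈ Ioi (1 : ℝ) := by
        rw [Real.rpow_neg_one]; exact (one_lt_inv₀ hz0).2 hz1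
      rw [indicator_of_mem (show z ∈ Ioo 0 1 from ⟨hz0, hz1⟩), hG, indicator_of_mem this]
      exact hp.timeDensity_inv hz0
    · have : z ^ (-1 : ℝ) ∉ Ioi (1 : ℝ) := by
        rw [Real.rpow_neg_one]
        exact not_lt.2 (inv_le_one_of_one_le₀ (not_lt.1 hz1))
      rw [indicator_of_notMem (fun h => hz1 h.2), hG, indicator_of_notMem this, mul_zero]
  have hi : MeasureTheory.IntegrableOn p.timeDensity (Ioi 1) := by
    have := (MeasureTheory.integrableOn_Ioi_comp_rpow_iff G (p := -1) (by norm_num)).1 (by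
      refine MeasureTheory.IntegrableOn.congr_fun ?_ hcongr.symm measurableSet_Ioi
      exact (h2.integrable_indicator measurableSet_Ioo).integrableOn)
    rw [hG, MeasureTheory.integrableOn_indicator_iff measurableSet_Ioi] at this
    exact this.mono_set fun z hz => ⟨hz, mem_Ioi.2 (lt_trans one_pos (mem_Ioi.1 hz))⟩
  have hs : ∫ M in Ioi (1 : ℝ), p.timeDensity M = p.swap.timeIntegral 1 := by
    have e := MeasureTheory.integral_comp_rpow_Ioi G (p := -1) (by norm_num)
    rw [MeasureTheory.setIntegral_congr_fun measurableSet_Ioi hcongr, hG,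
      MeasureTheory.setIntegral_indicator measurableSet_Ioo,
      MeasureTheory.setIntegral_indicator measurableSet_Ioi] at e
    rw [inter_eq_self_of_subset_right Ioo_subset_Ioi_self,
      inter_eq_self_of_subset_right (Ioi_subset_Ioi zero_le_one)] at e
    rw [← e, timeIntegral, intervalIntegral.integral_of_le zero_le_one,
      MeasureTheory.integral_Ioc_eq_integral_Ioo]
  rw [← Ioc_union_Ioi_eq_Ioi zero_le_one,
    MeasureTheory.setIntegral_union (Ioc_disjoint_Ioi le_rfl) measurableSet_Ioi h1 hi, hs,
    ← intervalIntegral.integral_of_le zero_le_one]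
  rfl

lemma timeIntegral_one_pos : 0 < p.timeIntegral 1 := by
  refine intervalIntegral.intervalIntegral_pos_of_pos_on
    (hp.intervalIntegrable_timeDensity zero_le_one) (fun z hz => ?_) one_pos
  have hz0 := hz.1
  have := hp.quad_pos (x := z) (y := 1) (by linarith)
  unfold timeDensity
  positivity

lemma one_div_two_β₂ : 1 / (2 * p.β₂) = p.μ := by
  have := hp.c₂_pos.ne'
  have := hp.b₂_pos.ne'
  rw [β₂, μ, ← c₂]; field_simp

lemma one_div_two_β₀ : 1 / (2 * p.β₀) = p.ν := by
  have := hp.c₀_pos.ne'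
  have := hp.a₀_pos.ne'
  rw [β₀, ν, ← c₀]; field_simp

lemma β₂_eq : p.β₂ = 1 / (2 * p.μ) := by
  have := hp.c₂_pos.ne'
  have := hp.b₂_pos.ne'
  rw [β₂, μ, ← c₂]; field_simp

lemma β₀_eq : p.β₀ = 1 / (2 * p.ν) := by
  have := hp.c₀_pos.ne'
  have := hp.a₀_pos.ne'
  rw [β₀, ν, ← c₀]; field_simp

/-- The right side is the leading constant that eliminating `S` produces when the correction `K` is
zero. -/
lemma exitConst_eq {ζ : ℝ} (hζ : 0 < ζ) : p.exitConst ζ =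
    Real.exp ((-((1 - p.ν) * Real.log ζ + p.σ * Real.log p.c₀) +
      Real.log (p.timeIntegral 1 + p.swap.timeIntegral 1) / 2) / p.ν) := by
  have hJ := add_pos hp.timeIntegral_one_pos hp.swap.timeIntegral_one_pos
  have hν := hp.ν_pos.ne'
  have hi : (∫ M in Ioi (0 : ℝ), M ^ (1 / p.β₂ - 1) /
      (p.c₀ * M ^ 2 + p.c₁ * M + p.c₂) ^ (1 / (2 * p.β₀) + 1 / (2 * p.β₂))) =
      p.timeIntegral 1 + p.swap.timeIntegral 1 := by
    rw [← hp.integral_timeDensity]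
    have e : 1 / p.β₂ = 2 * p.μ := by rw [← hp.one_div_two_β₂]; ring
    rw [hp.one_div_two_β₀, hp.one_div_two_β₂, e, add_comm p.ν p.μ]
    simp only [timeDensity, quad, mul_one, one_pow]
  have ev : -1 / p.v = -(p.σ / p.ν) := by
    have := hp.c₀_pos.ne'
    have := hp.c₂_pos.ne'
    have := hp.a₀_pos.ne'
    have := hp.Δ_ne_zero
    rw [v, σ, ν]; field_simp
  have eb : -p.b₀ / p.a₀ = -((1 - p.ν) / p.ν) := by
    have := hp.c₀_pos.ne'
    have := hp.a₀_pos.ne'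
    rw [ν]; field_simp; rw [c₀]; ring
  rw [exitConst, hi, ev, eb, hp.β₀_eq, Real.rpow_def_of_pos hp.c₀_pos, Real.rpow_def_of_pos hζ,
    Real.rpow_def_of_pos hJ, ← Real.exp_add, ← Real.exp_add]
  congr 1
  field_simp
  ring

lemma entryConst_eq {η : ℝ} (hη : 0 < η) : p.entryConst η =
    Real.exp ((-((1 - p.μ) * Real.log η + p.σ * Real.log p.c₂) +
      Real.log (p.timeIntegral 1 + p.swap.timeIntegral 1) / 2) / p.μ) := by
  have h := hp.swap.exitConst_eq hη
  rw [swap_swap, swap_ν, swap_σ, swap_c₀, add_comm (p.swap.timeIntegral 1)] at h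
  rw [← h]
  have eu : p.swap.v = p.u := by
    simp only [v, u, swap_c₂, swap_Δ]; rfl
  have e0 : p.swap.β₀ = p.β₂ := by simp only [β₀, β₂]; rw [add_comm]; rfl
  have e2 : p.swap.β₂ = p.β₀ := by simp only [β₀, β₂]; rw [add_comm]; rfl
  simp only [entryConst, exitConst, eu, swap_c₀, swap_c₁, swap_c₂, e0, e2]
  rw [add_comm (1 / (2 * p.β₂))]
  congr 3
  funext M
  congr 2
  ring

end Admissible

end CubicCoeffs

/-! ### Division of the remainder by the coordinates -/

/-- The quotient of a function that vanishes for `x = 0` by `x`, with its limit for `x = 0`. -/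
def axisQuotient (φ ψ : ℝ → ℝ → ℝ) (x y : ℝ) : ℝ := if x = 0 then ψ 0 y else φ x y / x

section AxisQuotient

variable {φ ψ : ℝ → ℝ → ℝ} {ρ C : ℝ}

lemma mul_axisQuotient (h0 : ∀ y ∈ Icc 0 ρ, φ 0 y = 0) {x y : ℝ} (hy : y ∈ Icc 0 ρ) :
    x * axisQuotient φ ψ x y = φ x y := by
  unfold axisQuotient
  split_ifs with hx
  · rw [hx, zero_mul, h0 y hy]
  · field_simp

variable (hC : 0 ≤ C) (h0 : ∀ y ∈ Icc 0 ρ, φ 0 y = 0)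
  (hd : ∀ x ∈ Icc 0 ρ, ∀ y ∈ Icc 0 ρ, HasDerivAt (fun s => φ s y) (ψ x y) x)
include hd

/-- The mean value theorem is applied to the difference `φ · y - φ · y'`, so that one intermediate
point serves both heights; separate points would lose the factor `y - y'`. -/
lemma exists_partial_sub_eq_slope {x y y' : ℝ} (hx : 0 < x) (hxρ : x ≤ ρ) (hy : y ∈ Icc 0 ρ)
    (hy' : y' ∈ Icc 0 ρ) (h00 : φ 0 y = φ 0 y') :
    ∃ c ∈ Ioo 0 x, ψ c y - ψ c y' = φ x y / x - φ x y' / x := by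
  have hd' : ∀ s ∈ Icc 0 x, HasDerivAt (fun s => φ s y - φ s y') (ψ s y - ψ s y') s :=
    fun s hs => (hd s ⟨hs.1, hs.2.trans hxρ⟩ y hy).sub (hd s ⟨hs.1, hs.2.trans hxρ⟩ y' hy')
  obtain ⟨c, hc, e⟩ := exists_hasDerivAt_eq_slope (fun s => φ s y - φ s y')
    (fun s => ψ s y - ψ s y') hx (fun s hs => (hd' s hs).continuousAt.continuousWithinAt)
    (fun s hs => hd' s (Ioo_subset_Icc_self hs))
  refine ⟨c, hc, e.trans ?_⟩
  rw [h00]; ring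

include h0

lemma exists_partial_eq_axisQuotient {x y : ℝ} (hx : 0 < x) (hxρ : x ≤ ρ) (hy : y ∈ Icc 0 ρ) :
    ∃ c ∈ Ioo 0 x, ψ c y = axisQuotient φ ψ x y := by
  have hd' : ∀ s ∈ Icc 0 x, HasDerivAt (fun s => φ s y) (ψ s y) s :=
    fun s hs => hd s ⟨hs.1, hs.2.trans hxρ⟩ y hy
  obtain ⟨c, hc, e⟩ := exists_hasDerivAt_eq_slope (fun s => φ s y)
    (fun s => ψ s y) hx (fun s hs => (hd' s hs).continuousAt.continuousWithinAt)
    (fun s hs => hd' s (Ioo_subset_Icc_self hs))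
  refine ⟨c, hc, e.trans ?_⟩
  rw [axisQuotient, if_neg hx.ne', h0 y hy, sub_zero, sub_zero]

include hC

lemma abs_axisQuotient_le
    (hb : ∀ x ∈ Icc 0 ρ, ∀ y ∈ Icc 0 ρ, |ψ x y| ≤ C * (x + y) ^ 3) :
    ∀ x ∈ Icc 0 ρ, ∀ y ∈ Icc 0 ρ, |axisQuotient φ ψ x y| ≤ C * (x + y) ^ 3 := by
  intro x hx y hy
  rcases hx.1.eq_or_lt with rfl | hx0
  · rw [axisQuotient, if_pos rfl]
    exact hb 0 hx y hy
  · obtain ⟨c, hc, e⟩ := exists_partial_eq_axisQuotient h0 hd hx0 hx.2 hy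
    rw [← e]
    have hc0 := hc.1
    have hcx := hc.2
    have hy0 := hy.1
    exact (hb c ⟨hc0.le, hcx.le.trans hx.2⟩ y hy).trans (by gcongr)

variable (hl : ∀ x ∈ Icc 0 ρ, ∀ y ∈ Icc 0 ρ, ∀ x' ∈ Icc 0 x, ∀ y' ∈ Icc 0 y,
  |ψ x y - ψ x' y'| ≤ C * ((x - x') + (y - y')) * (x + y) ^ 2)
include hl

lemma abs_axisQuotient_sub_left_le :
    ∀ x ∈ Icc 0 ρ, ∀ y ∈ Icc 0 ρ,
      |axisQuotient φ ψ x y - axisQuotient φ ψ 0 y| ≤ C * x * (x + y) ^ 2 := by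
  intro x hx y hy
  rcases hx.1.eq_or_lt with rfl | hx0
  · simp
  · obtain ⟨c, hc, e⟩ := exists_partial_eq_axisQuotient h0 hd hx0 hx.2 hy
    rw [← e, axisQuotient, if_pos rfl]
    have hc0 := hc.1
    have hcx := hc.2
    have hy0 := hy.1
    have := hl c ⟨hc0.le, hcx.le.trans hx.2⟩ y hy 0 ⟨le_rfl, hc0.le⟩ y ⟨hy0, le_rfl⟩
    rw [sub_self, add_zero, sub_zero] at this
    exact this.trans (by gcongr)

lemma abs_axisQuotient_sub_bot_le :
    ∀ x ∈ Icc 0 ρ, ∀ y ∈ Icc 0 ρ,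
      |axisQuotient φ ψ x y - axisQuotient φ ψ x 0| ≤ C * y * (x + y) ^ 2 := by
  intro x hx y hy
  have hy0 := hy.1
  have hρ0 : (0 : ℝ) ∈ Icc 0 ρ := ⟨le_rfl, hy.1.trans hy.2⟩
  rcases hx.1.eq_or_lt with rfl | hx0
  · simp only [axisQuotient, if_pos]
    simpa using hl 0 hx y hy 0 ⟨le_rfl, le_rfl⟩ 0 ⟨le_rfl, hy0⟩
  · obtain ⟨c, hc, e⟩ := exists_partial_sub_eq_slope hd hx0 hx.2 hy hρ0
      (by rw [h0 y hy, h0 0 hρ0])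
    simp only [axisQuotient, if_neg hx0.ne']
    rw [← e]
    have hc0 := hc.1
    have hcx := hc.2
    have := hl c ⟨hc0.le, hcx.le.trans hx.2⟩ y hy c ⟨hc0.le, le_rfl⟩ 0 ⟨le_rfl, hy0⟩
    rw [sub_self, zero_add, sub_zero] at this
    exact this.trans (by gcongr)

end AxisQuotient

lemma norm_prod_le_add {x y : ℝ} (hx : 0 ≤ x) (hy : 0 ≤ y) : ‖((x, y) : ℝ × ℝ)‖ ≤ x + y := by
  rw [Prod.norm_mk, Real.norm_of_nonneg hx, Real.norm_of_nonneg hy]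
  exact max_le (by linarith) (by linarith)

lemma CubicCoeffs.contDiff_field (p : CubicCoeffs) {n : WithTop ℕ∞} : ContDiff ℝ n p.field := by
  unfold CubicCoeffs.field
  fun_prop

/-- A cubic neutral saddle in the form `(x (a(x, y) + f(x, y)), -y (b(x, y) + g(x, y)))`. -/
lemma IsCubicNeutralSaddle.exists_remainder {p : CubicCoeffs} {X : ℝ × ℝ → ℝ × ℝ}
    (hX : IsCubicNeutralSaddle p X) :
    ∃ (ρ C : ℝ) (f g : ℝ → ℝ → ℝ) (L : NNReal), 0 < ρ ∧ IsRemainder f g ρ C ∧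
      (∀ x ∈ Icc 0 ρ, ∀ y ∈ Icc 0 ρ,
        X (x, y) = (x * (p.xForm x y + f x y), -(y * (p.yForm x y + g x y)))) ∧
      LipschitzOnWith L X (Icc 0 ρ ×ˢ Icc 0 ρ) ∧
      ((∀ᶠ z in 𝓝 0, X z = p.field z) →
        ∀ x ∈ Icc 0 ρ, ∀ y ∈ Icc 0 ρ, f x y = 0 ∧ g x y = 0) := by
  set r : ℝ × ℝ → ℝ × ℝ := fun w => X w - p.field w with hr
  have hrC : ContDiffAt ℝ 3 r 0 := hX.contDiffAt.sub p.contDiff_field.contDiffAt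
  have ev1 : ∀ᶠ z in 𝓝 (0 : ℝ × ℝ), ContDiffAt ℝ 3 r z := hrC.eventually (by simp)
  obtain ⟨C₁, hC₁⟩ := (hX.remainder 1 (by norm_num)).bound
  obtain ⟨C₂, hC₂⟩ := (hX.remainder 2 (by norm_num)).bound
  obtain ⟨L, s, hs, hLip⟩ := (hX.contDiffAt.of_le (by norm_num : (1 : WithTop ℕ∞) ≤ 3)
    ).exists_lipschitzOnWith
  have ev2 : ∀ᶠ z in 𝓝 (0 : ℝ × ℝ), (∀ᶠ z in 𝓝 0, X z = p.field z) → r z = 0 := by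
    by_cases h : ∀ᶠ z in 𝓝 0, X z = p.field z
    · filter_upwards [h] with z hz _
      simp [hr, hz]
    · exact Eventually.of_forall fun z h' => absurd h' h
  have ev3 : ∀ᶠ z in 𝓝 (0 : ℝ × ℝ), (X (0, z.2)).1 = 0 :=
    (continuous_snd.tendsto (0 : ℝ × ℝ)).eventually hX.vertical_axis
  have ev4 : ∀ᶠ z in 𝓝 (0 : ℝ × ℝ), (X (z.1, 0)).2 = 0 :=
    (continuous_fst.tendsto (0 : ℝ × ℝ)).eventually hX.horizontal_axis
  obtain ⟨R, hR, H⟩ := Metric.eventually_nhds_iff_ball.1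
    (ev1.and (hC₁.and (hC₂.and (ev2.and (ev3.and (ev4.and hs))))))
  obtain ⟨C, hC, hCC₁, hCC₂⟩ : ∃ C : ℝ, 0 ≤ C ∧ C₁ ≤ C ∧ C₂ ≤ C :=
    ⟨max 0 (max C₁ C₂), by simp, by simp, by simp⟩
  -- Balls of radius `x + y ≤ 2ρ` are used for the mean value inequality and must stay in the ball
  -- of radius `R`.
  obtain ⟨ρ, hρ, hρR⟩ : ∃ ρ : ℝ, 0 < ρ ∧ 2 * ρ < R := ⟨R / 3, by positivity, by linarith⟩
  have hball : ∀ {x y : ℝ}, x ∈ Icc 0 ρ → y ∈ Icc 0 ρ → ((x, y) : ℝ × ℝ) ∈ Metric.ball 0 R := by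
    intro x y hx hy
    rw [mem_ball_zero_iff]
    linarith [norm_prod_le_add hx.1 hy.1, hx.2, hy.2]
  have hdiff : ∀ z ∈ Metric.ball (0 : ℝ × ℝ) R, DifferentiableAt ℝ r z := fun z hz =>
    (H z hz).1.differentiableAt (by norm_num)
  have hdiff2 : ∀ z ∈ Metric.ball (0 : ℝ × ℝ) R, DifferentiableAt ℝ (fderiv ℝ r) z := fun z hz =>
    ((H z hz).1.fderiv_right (m := 2) (by norm_num)).differentiableAt (by norm_num)
  have hb1 : ∀ z ∈ Metric.ball (0 : ℝ × ℝ) R, ‖fderiv ℝ r z‖ ≤ C * ‖z‖ ^ 3 := fun z hz => by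
    have := (H z hz).2.1
    rw [norm_iteratedFDeriv_one, norm_pow, norm_norm] at this
    exact this.trans (by norm_num; gcongr)
  have hb2 : ∀ z ∈ Metric.ball (0 : ℝ × ℝ) R, ‖fderiv ℝ (fderiv ℝ r) z‖ ≤ C * ‖z‖ ^ 2 :=
    fun z hz => by
      have := (H z hz).2.2.1
      rw [← norm_iteratedFDeriv_fderiv, norm_iteratedFDeriv_one, norm_pow, norm_norm] at this
      exact this.trans (by norm_num; gcongr)
  have hD1 : ∀ x ∈ Icc 0 ρ, ∀ y ∈ Icc 0 ρ, ‖fderiv ℝ r (x, y)‖ ≤ C * (x + y) ^ 3 := by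
    intro x hx y hy
    refine (hb1 _ (hball hx hy)).trans ?_
    gcongr
    exact norm_prod_le_add hx.1 hy.1
  have hD2 : ∀ x ∈ Icc 0 ρ, ∀ y ∈ Icc 0 ρ, ∀ x' ∈ Icc 0 x, ∀ y' ∈ Icc 0 y,
      ‖fderiv ℝ r (x, y) - fderiv ℝ r (x', y')‖ ≤ C * ((x - x') + (y - y')) * (x + y) ^ 2 := by
    intro x hx y hy x' hx' y' hy'
    have hsub : Metric.closedBall (0 : ℝ × ℝ) (x + y) ⊆ Metric.ball 0 R :=
      Metric.closedBall_subset_ball (by linarith [hx.2, hy.2])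
    have := (convex_closedBall (0 : ℝ × ℝ) (x + y)).norm_image_sub_le_of_norm_fderiv_le
      (f := fderiv ℝ r) (C := C * (x + y) ^ 2) (x := (x', y')) (y := (x, y)) (𝕜 := ℝ)
      (fun z hz => hdiff2 z (hsub hz)) (fun z hz => by
        refine (hb2 z (hsub hz)).trans ?_
        rw [mem_closedBall_zero_iff] at hz
        gcongr)
      (by
        rw [mem_closedBall_zero_iff]
        linarith [norm_prod_le_add hx'.1 hy'.1, hx'.2, hy'.2])
      (by
        rw [mem_closedBall_zero_iff]
        exact norm_prod_le_add hx.1 hy.1)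
    refine this.trans ?_
    have h2 : ‖((x, y) : ℝ × ℝ) - (x', y')‖ ≤ (x - x') + (y - y') := by
      rw [Prod.mk_sub_mk]
      exact norm_prod_le_add (by linarith [hx'.2]) (by linarith [hy'.2])
    calc C * (x + y) ^ 2 * ‖((x, y) : ℝ × ℝ) - (x', y')‖
        ≤ C * (x + y) ^ 2 * ((x - x') + (y - y')) := by gcongr
      _ = _ := by ring
  have n1 : ‖((1, 0) : ℝ × ℝ)‖ = 1 := by simp
  have n2 : ‖((0, 1) : ℝ × ℝ)‖ = 1 := by simp
  have e1 : ∀ A : ℝ × ℝ →L[ℝ] ℝ × ℝ, |(A (1, 0)).1| ≤ ‖A‖ := fun A =>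
    (norm_fst_le (A (1, 0))).trans ((A.le_opNorm _).trans (by rw [n1, mul_one]))
  have e2 : ∀ A : ℝ × ℝ →L[ℝ] ℝ × ℝ, |(A (0, 1)).2| ≤ ‖A‖ := fun A =>
    (norm_snd_le (A (0, 1))).trans ((A.le_opNorm _).trans (by rw [n2, mul_one]))
  set φ₁ : ℝ → ℝ → ℝ := fun x y => (r (x, y)).1 with hφ₁
  set ψ₁ : ℝ → ℝ → ℝ := fun x y => (fderiv ℝ r (x, y) (1, 0)).1 with hψ₁
  -- The second component is transposed and negated, so that the same quotient lemmas apply to both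
  -- components.
  set φ₂ : ℝ → ℝ → ℝ := fun x y => -(r (y, x)).2 with hφ₂
  set ψ₂ : ℝ → ℝ → ℝ := fun x y => -(fderiv ℝ r (y, x) (0, 1)).2 with hψ₂
  have z1 : ∀ y ∈ Icc 0 ρ, φ₁ 0 y = 0 := fun y hy => by
    have := (H _ (hball (x := 0) ⟨le_rfl, hρ.le⟩ hy)).2.2.2.2.1
    simp only at this
    simp [hφ₁, hr, CubicCoeffs.field, this]
  have z2 : ∀ y ∈ Icc 0 ρ, φ₂ 0 y = 0 := fun y hy => by
    have := (H _ (hball (y := 0) hy ⟨le_rfl, hρ.le⟩)).2.2.2.2.2.1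
    simp only at this
    simp [hφ₂, hr, CubicCoeffs.field, this]
  have d1 : ∀ x ∈ Icc 0 ρ, ∀ y ∈ Icc 0 ρ, HasDerivAt (fun s => φ₁ s y) (ψ₁ x y) x := by
    intro x hx y hy
    have h1 : HasDerivAt (fun s : ℝ => ((s, y) : ℝ × ℝ)) (1, 0) x :=
      (hasDerivAt_id x).prodMk (hasDerivAt_const x y)
    have h2 := (hdiff _ (hball hx hy)).hasFDerivAt.comp_hasDerivAt x h1
    exact (hasFDerivAt_fst (𝕜 := ℝ)).comp_hasDerivAt x h2
  have d2 : ∀ x ∈ Icc 0 ρ, ∀ y ∈ Icc 0 ρ, HasDerivAt (fun s => φ₂ s y) (ψ₂ x y) x := by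
    intro x hx y hy
    have h1 : HasDerivAt (fun s : ℝ => ((y, s) : ℝ × ℝ)) (0, 1) x :=
      (hasDerivAt_const x y).prodMk (hasDerivAt_id x)
    have h2 := (hdiff _ (hball hy hx)).hasFDerivAt.comp_hasDerivAt x h1
    exact ((hasFDerivAt_snd (𝕜 := ℝ)).comp_hasDerivAt x h2).neg
  have b1 : ∀ x ∈ Icc 0 ρ, ∀ y ∈ Icc 0 ρ, |ψ₁ x y| ≤ C * (x + y) ^ 3 := fun x hx y hy =>
    (e1 _).trans (hD1 x hx y hy)
  have b2 : ∀ x ∈ Icc 0 ρ, ∀ y ∈ Icc 0 ρ, |ψ₂ x y| ≤ C * (x + y) ^ 3 := fun x hx y hy => by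
    simp only [hψ₂, abs_neg]
    rw [add_comm x y]
    exact (e2 _).trans (hD1 y hy x hx)
  have l1 : ∀ x ∈ Icc 0 ρ, ∀ y ∈ Icc 0 ρ, ∀ x' ∈ Icc 0 x, ∀ y' ∈ Icc 0 y,
      |ψ₁ x y - ψ₁ x' y'| ≤ C * ((x - x') + (y - y')) * (x + y) ^ 2 :=
    fun x hx y hy x' hx' y' hy' =>
      (e1 (fderiv ℝ r (x, y) - fderiv ℝ r (x', y'))).trans (hD2 x hx y hy x' hx' y' hy')
  have l2 : ∀ x ∈ Icc 0 ρ, ∀ y ∈ Icc 0 ρ, ∀ x' ∈ Icc 0 x, ∀ y' ∈ Icc 0 y,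
      |ψ₂ x y - ψ₂ x' y'| ≤ C * ((x - x') + (y - y')) * (x + y) ^ 2 := by
    intro x hx y hy x' hx' y' hy'
    have h1 := (e2 (fderiv ℝ r (y, x) - fderiv ℝ r (y', x'))).trans (hD2 y hy x hx y' hy' x' hx')
    have h2 : ψ₂ x y - ψ₂ x' y' = -((fderiv ℝ r (y, x) - fderiv ℝ r (y', x')) (0, 1)).2 := by
      simp only [hψ₂, sub_apply, Prod.snd_sub]
      ring
    rw [h2, abs_neg, add_comm x y, add_comm (x - x')]
    exact h1
  have hIoc : ∀ y ∈ Ioc 0 ρ, y ∈ Icc 0 ρ := fun y hy => Ioc_subset_Icc_self hy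
  have h0m : (0 : ℝ) ∈ Icc 0 ρ := ⟨le_rfl, hρ.le⟩
  have cont_vert : ∀ y ∈ Icc 0 ρ, ContinuousAt (fun s : ℝ => fderiv ℝ r (0, s)) y := fun y hy =>
    ContinuousAt.comp (f := fun s : ℝ => ((0, s) : ℝ × ℝ)) (g := fderiv ℝ r)
      (hdiff2 _ (hball h0m hy)).continuousAt (by fun_prop)
  have cont_hor : ∀ y ∈ Icc 0 ρ, ContinuousAt (fun s : ℝ => fderiv ℝ r (s, 0)) y := fun y hy =>
    ContinuousAt.comp (f := fun s : ℝ => ((s, 0) : ℝ × ℝ)) (g := fderiv ℝ r)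
      (hdiff2 _ (hball hy h0m)).continuousAt (by fun_prop)
  have q0 : ∀ φ ψ : ℝ → ℝ → ℝ, (∀ y ∈ Icc 0 ρ, ContinuousAt (fun s => ψ 0 s) y) →
      ContinuousOn (fun s => axisQuotient φ ψ 0 s) (Ioc 0 ρ) := by
    intro φ ψ h
    simp only [axisQuotient, if_pos]
    exact fun y hy => (h y (hIoc y hy)).continuousWithinAt
  have q1 : ∀ φ ψ : ℝ → ℝ → ℝ, (∀ x ∈ Icc 0 ρ, ∀ y ∈ Icc 0 ρ,
      HasDerivAt (fun s => φ s y) (ψ x y) x) →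
      ContinuousOn (fun s => axisQuotient φ ψ s 0) (Ioc 0 ρ) := by
    intro φ ψ h
    have : ContinuousOn (fun s => φ s 0 / s) (Ioc 0 ρ) := fun s hs =>
      ((h s (hIoc s hs) 0 h0m).continuousAt.div continuousAt_id hs.1.ne').continuousWithinAt
    refine this.congr fun s hs => ?_
    simp only [axisQuotient, if_neg hs.1.ne']
  refine ⟨ρ, C, axisQuotient φ₁ ψ₁, fun x y => axisQuotient φ₂ ψ₂ y x, L, hρ, ?_, ?_, ?_, ?_⟩
  · refine ⟨abs_axisQuotient_le hC z1 d1 b1, fun x hx y hy => ?_,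
      abs_axisQuotient_sub_left_le hC z1 d1 l1, fun x hx y hy => ?_,
      abs_axisQuotient_sub_bot_le hC z1 d1 l1, fun x hx y hy => ?_, ?_, ?_, ?_, ?_⟩
    · rw [add_comm]; exact abs_axisQuotient_le hC z2 d2 b2 y hy x hx
    · rw [add_comm]; exact abs_axisQuotient_sub_bot_le hC z2 d2 l2 y hy x hx
    · rw [add_comm]; exact abs_axisQuotient_sub_left_le hC z2 d2 l2 y hy x hx
    · exact q0 φ₁ ψ₁ fun y hy =>
        continuous_fst.continuousAt.comp ((cont_vert y hy).clm_apply continuousAt_const)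
    · exact q1 φ₂ ψ₂ d2
    · exact q1 φ₁ ψ₁ d1
    · exact q0 φ₂ ψ₂ fun y hy =>
        (continuous_snd.continuousAt.comp ((cont_hor y hy).clm_apply continuousAt_const)).neg
  · intro x hx y hy
    have h1 : x * axisQuotient φ₁ ψ₁ x y = (r (x, y)).1 := mul_axisQuotient z1 hy
    have h2 : y * axisQuotient φ₂ ψ₂ y x = -(r (x, y)).2 := mul_axisQuotient z2 hx
    have hXr : X (x, y) = p.field (x, y) + r (x, y) := by simp [hr]
    rw [hXr]
    ext
    · simp only [Prod.fst_add, mul_add, h1, CubicCoeffs.field, CubicCoeffs.xForm]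
    · simp only [Prod.snd_add, mul_add, h2, CubicCoeffs.field, CubicCoeffs.yForm]
      ring
  · exact hLip.mono fun z hz => (H z (hball hz.1 hz.2)).2.2.2.2.2.2
  · intro h x hx y hy
    have hz : ∀ z ∈ Metric.ball (0 : ℝ × ℝ) R, r z = 0 := fun z hz => (H z hz).2.2.2.1 h
    have hfz : ∀ z ∈ Metric.ball (0 : ℝ × ℝ) R, fderiv ℝ r z = 0 := fun z hz' => by
      have : r =ᶠ[𝓝 z] fun _ => 0 :=
        mem_of_superset (Metric.isOpen_ball.mem_nhds hz') hz
      rw [this.fderiv_eq]; simp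
    constructor
    · simp only [axisQuotient, hφ₁, hψ₁, hz _ (hball hx hy), hfz _ (hball h0m hy)]
      simp
    · simp only [axisQuotient, hφ₂, hψ₂, hz _ (hball hx hy), hfz _ (hball hx h0m)]
      simp

/-! ### Solutions of Lipschitz equations -/

section ODE

variable {E : Type*} [NormedAddCommGroup E] [NormedSpace ℝ E] {V : E → E} {L : NNReal}

/-- A solution moves at most `M N` in time `N`, so one application of Picard-Lindelöf on a ball of
this radius covers the whole interval. -/
lemma exists_solution_of_lipschitz_of_bounded [CompleteSpace E] (hV : LipschitzWith L V)
    {M : NNReal} (hM : ∀ z, ‖V z‖ ≤ M) (z₀ : E) {N : ℝ} (hN : 0 ≤ N) :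
    ∃ γ : ℝ → E, γ 0 = z₀ ∧ ∀ t ∈ Icc 0 N, HasDerivWithinAt γ (V (γ t)) (Icc 0 N) t := by
  have hpl : IsPicardLindelof (fun _ => V) (⟨0, left_mem_Icc.2 hN⟩ : Icc 0 N) z₀
      (M * N.toNNReal) 0 M L := by
    refine IsPicardLindelof.of_time_independent (fun z _ => hM z) hV.lipschitzOnWith ?_
    simp [max_eq_left hN, Real.coe_toNNReal N hN]
  exact hpl.exists_eq_forall_mem_Icc_hasDerivWithinAt₀

lemma dist_solution_le (hV : LipschitzWith L V) {γ γ' : ℝ → E} {T T' N : ℝ}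
    (hγ : ∀ t ∈ Icc 0 T, HasDerivWithinAt γ (V (γ t)) (Icc 0 T) t)
    (hγ' : ∀ t ∈ Icc 0 T', HasDerivWithinAt γ' (V (γ' t)) (Icc 0 T') t)
    (hT : N ≤ T) (hT' : N ≤ T') :
    ∀ t ∈ Icc 0 N, dist (γ t) (γ' t) ≤ dist (γ 0) (γ' 0) * Real.exp (L * t) := by
  have key : ∀ {γ : ℝ → E} {T : ℝ}, (∀ t ∈ Icc 0 T, HasDerivWithinAt γ (V (γ t)) (Icc 0 T) t) →
      N ≤ T → ContinuousOn γ (Icc 0 N) ∧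
        ∀ t ∈ Ico 0 N, HasDerivWithinAt γ (V (γ t)) (Ici t) t := by
    intro γ T h hT
    refine ⟨fun t ht => ((h t (Icc_subset_Icc_right hT ht)).mono
      (Icc_subset_Icc_right hT)).continuousWithinAt, fun t ht => ?_⟩
    refine (h t ⟨ht.1, ht.2.le.trans hT⟩).mono_of_mem_nhdsWithin ?_
    exact Icc_mem_nhdsGE_of_mem ⟨ht.1, ht.2.trans_le hT⟩
  intro t ht
  have := dist_le_of_trajectories_ODE (v := fun _ => V) (fun _ => hV) (key hγ hT).1 (key hγ hT).2
    (key hγ' hT').1 (key hγ' hT').2 le_rfl t ht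
  rwa [sub_zero] at this

/-- `e^{Mt} u` is nondecreasing and `e^{-Mt} u` is nonincreasing, so positivity spreads both
forwards and backwards in time. -/
lemma pos_of_pos_of_abs_deriv_le {u u' : ℝ → ℝ} {M a b : ℝ}
    (hu : ∀ t ∈ Icc a b, HasDerivWithinAt u (u' t) (Icc a b) t)
    (h : ∀ t ∈ Icc a b, |u' t| ≤ M * u t) {s t : ℝ} (hs : s ∈ Icc a b) (ht : t ∈ Icc a b)
    (hpos : 0 < u s) : 0 < u t := by
  have hexp : ∀ c t : ℝ, HasDerivWithinAt (fun s => Real.exp (c * s)) (Real.exp (c * t) * c)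
      (Icc a b) t := fun c t => by
    have := ((hasDerivAt_id t).const_mul c).exp
    simpa using this.hasDerivWithinAt
  rcases le_total s t with hst | hst
  · have h1 := antitoneOn_Icc_of_hasDerivWithinAt (fun r hr => ((hexp M r).mul (hu r hr)).neg)
      (fun r hr => by
        have := (abs_le.1 (h r hr)).1
        nlinarith [Real.exp_pos (M * r)]) hs ht hst
    simp only [Pi.neg_apply, Pi.mul_apply, neg_le_neg_iff] at h1
    exact (mul_pos_iff_of_pos_left (Real.exp_pos _)).1
      (lt_of_lt_of_le (mul_pos (Real.exp_pos (M * s)) hpos) h1)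
  · have h1 := antitoneOn_Icc_of_hasDerivWithinAt (fun r hr => (hexp (-M) r).mul (hu r hr))
      (fun r hr => by
        have := (abs_le.1 (h r hr)).2
        nlinarith [Real.exp_pos (-M * r)]) ht hs hst
    simp only [Pi.mul_apply] at h1
    exact (mul_pos_iff_of_pos_left (Real.exp_pos _)).1
      (lt_of_lt_of_le (mul_pos (Real.exp_pos (-M * s)) hpos) h1)

end ODE

/-! ### Existence, uniqueness and continuity of passages -/

/-- The retraction of the plane onto the square `[0, ρ]²`. -/
def clampSquare (ρ : ℝ) (z : ℝ × ℝ) : ℝ × ℝ := (max 0 (min ρ z.1), max 0 (min ρ z.2))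

lemma clampSquare_mem {ρ : ℝ} (hρ : 0 ≤ ρ) (z : ℝ × ℝ) :
    clampSquare ρ z ∈ Icc 0 ρ ×ˢ Icc 0 ρ :=
  ⟨⟨le_max_left _ _, max_le hρ (min_le_left _ _)⟩, ⟨le_max_left _ _, max_le hρ (min_le_left _ _)⟩⟩

lemma clampSquare_of_mem {ρ : ℝ} {z : ℝ × ℝ} (hz : z ∈ Icc 0 ρ ×ˢ Icc 0 ρ) :
    clampSquare ρ z = z := by
  ext
  · simp only [clampSquare]; rw [min_eq_right hz.1.2, max_eq_right hz.1.1]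
  · simp only [clampSquare]; rw [min_eq_right hz.2.2, max_eq_right hz.2.1]

lemma lipschitzWith_clampSquare (ρ : ℝ) : LipschitzWith 1 (clampSquare ρ) := by
  have h : LipschitzWith 1 fun t : ℝ => max 0 (min ρ t) :=
    ((LipschitzWith.id (α := ℝ)).const_min ρ).const_max 0
  have h1 := h.comp (LipschitzWith.prod_fst (α := ℝ) (β := ℝ))
  have h2 := h.comp (LipschitzWith.prod_snd (α := ℝ) (β := ℝ))
  simpa using! h1.prodMk h2

/-- `X` has the form `(x (a(x, y) + f(x, y)), -y (b(x, y) + g(x, y)))` on the square `[0, ρ]²` and is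
Lipschitz there. -/
structure IsSaddleOn (p : CubicCoeffs) (X : ℝ × ℝ → ℝ × ℝ) (f g : ℝ → ℝ → ℝ) (ρ : ℝ)
    (L : NNReal) : Prop where
  pos : 0 < ρ
  form : ∀ x ∈ Icc 0 ρ, ∀ y ∈ Icc 0 ρ,
    X (x, y) = (x * (p.xForm x y + f x y), -(y * (p.yForm x y + g x y)))
  lip : LipschitzOnWith L X (Icc 0 ρ ×ˢ Icc 0 ρ)

namespace IsSaddleOn

variable {p : CubicCoeffs} {X : ℝ × ℝ → ℝ × ℝ} {f g : ℝ → ℝ → ℝ} {ρ : ℝ} {L : NNReal}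
  (h : IsSaddleOn p X f g ρ L)
include h

lemma mono {ρ' : ℝ} (h0 : 0 < ρ') (hρ : ρ' ≤ ρ) : IsSaddleOn p X f g ρ' L where
  pos := h0
  form x hx y hy := h.form x ⟨hx.1, hx.2.trans hρ⟩ y ⟨hy.1, hy.2.trans hρ⟩
  lip := h.lip.mono (prod_mono (Icc_subset_Icc_right hρ) (Icc_subset_Icc_right hρ))

lemma lipschitzWith_comp_clampSquare : LipschitzWith L (X ∘ clampSquare ρ) := by
  rw [← lipschitzOnWith_univ]
  have := h.lip.comp (lipschitzWith_clampSquare ρ).lipschitzOnWith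
    (s := univ) (fun z _ => clampSquare_mem h.pos.le z)
  simpa using this

lemma zero_mem : (0 : ℝ) ∈ Icc 0 ρ := ⟨le_rfl, h.pos.le⟩

/-- The component vanishes on the invariant axis and is Lipschitz. This linear bound prevents orbits
from reaching the axis in finite time. -/
lemma abs_fst_le {z : ℝ × ℝ} (hz : z ∈ Icc 0 ρ ×ˢ Icc 0 ρ) : |(X z).1| ≤ L * z.1 := by
  have h1 := h.lip.dist_le_mul z hz (0, z.2) ⟨h.zero_mem, hz.2⟩
  have h2 : (X (0, z.2)).1 = 0 := by rw [h.form 0 h.zero_mem z.2 hz.2]; simp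
  have h3 : dist z (0, z.2) = z.1 := by
    rw [Prod.dist_eq]
    simp [abs_of_nonneg hz.1.1, hz.1.1]
  have h4 : dist (X z).1 (X (0, z.2)).1 ≤ dist (X z) (X (0, z.2)) := by
    rw [Prod.dist_eq]; exact le_max_left _ _
  rw [h2, Real.dist_eq, sub_zero] at h4
  rw [h3] at h1
  exact h4.trans h1

lemma abs_snd_le {z : ℝ × ℝ} (hz : z ∈ Icc 0 ρ ×ˢ Icc 0 ρ) : |(X z).2| ≤ L * z.2 := by
  have h1 := h.lip.dist_le_mul z hz (z.1, 0) ⟨hz.1, h.zero_mem⟩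
  have h2 : (X (z.1, 0)).2 = 0 := by rw [h.form z.1 hz.1 0 h.zero_mem]; simp
  have h3 : dist z (z.1, 0) = z.2 := by
    rw [Prod.dist_eq]
    simp [abs_of_nonneg hz.2.1, hz.2.1]
  have h4 : dist (X z).2 (X (z.1, 0)).2 ≤ dist (X z) (X (z.1, 0)) := by
    rw [Prod.dist_eq]; exact le_max_right _ _
  rw [h2, Real.dist_eq, sub_zero] at h4
  rw [h3] at h1
  exact h4.trans h1

lemma norm_comp_clampSquare_le (z : ℝ × ℝ) :
    ‖(X ∘ clampSquare ρ) z‖ ≤ (L * ρ.toNNReal : NNReal) := by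
  have hz := clampSquare_mem h.pos.le z
  rw [Function.comp_apply, Prod.norm_def, NNReal.coe_mul, Real.coe_toNNReal ρ h.pos.le]
  refine max_le ((h.abs_fst_le hz).trans ?_) ((h.abs_snd_le hz).trans ?_)
  · exact mul_le_mul_of_nonneg_left hz.1.2 L.2
  · exact mul_le_mul_of_nonneg_left hz.2.2 L.2

/-- A curve in the square that is positive at some times is an orbit. -/
lemma isOrbit {γ : ℝ → ℝ × ℝ} {T s₁ s₂ : ℝ}
    (hγ : ∀ t ∈ Icc 0 T, HasDerivWithinAt γ (X (γ t)) (Icc 0 T) t)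
    (hm : ∀ t ∈ Icc 0 T, γ t ∈ Icc 0 ρ ×ˢ Icc 0 ρ) (hs₁ : s₁ ∈ Icc 0 T) (hs₂ : s₂ ∈ Icc 0 T)
    (h1 : 0 < (γ s₁).1) (h2 : 0 < (γ s₂).2) :
    IsOrbit p f g ρ (fun t => (γ t).1) (fun t => (γ t).2) 0 T := by
  have d1 : ∀ t ∈ Icc 0 T, HasDerivWithinAt (fun t => (γ t).1) (X (γ t)).1 (Icc 0 T) t :=
    fun t ht => (hasFDerivAt_fst (𝕜 := ℝ) (p := γ t)).comp_hasDerivWithinAt t (hγ t ht)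
  have d2 : ∀ t ∈ Icc 0 T, HasDerivWithinAt (fun t => (γ t).2) (X (γ t)).2 (Icc 0 T) t :=
    fun t ht => (hasFDerivAt_snd (𝕜 := ℝ) (p := γ t)).comp_hasDerivWithinAt t (hγ t ht)
  refine ⟨fun t ht => ?_, fun t ht => ?_, fun t ht => (hm t ht).1.2, fun t ht => (hm t ht).2.2,
    fun t ht => ?_, fun t ht => ?_⟩
  · exact pos_of_pos_of_abs_deriv_le d1 (fun t ht => h.abs_fst_le (hm t ht)) hs₁ ht h1
  · exact pos_of_pos_of_abs_deriv_le d2 (fun t ht => h.abs_snd_le (hm t ht)) hs₂ ht h2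
  · refine (d1 t ht).congr_deriv ?_
    rw [show γ t = ((γ t).1, (γ t).2) from rfl, h.form _ (hm t ht).1 _ (hm t ht).2]
  · refine (d2 t ht).congr_deriv ?_
    rw [show γ t = ((γ t).1, (γ t).2) from rfl, h.form _ (hm t ht).1 _ (hm t ht).2]

variable {ζ η ξ T ω : ℝ}

lemma exists_orbit_of_passage (hζ : ζ ∈ Ioc 0 ρ) (hη : η ∈ Ioc 0 ρ)
    (hP : DulacPassage X ζ η ξ T ω) :
    ∃ x y : ℝ → ℝ, IsOrbit p f g ρ x y 0 T ∧ x 0 = ξ ∧ y 0 = η ∧ x T = ζ ∧ y T = ω := by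
  obtain ⟨hT, γ, h0, h1, hγ, hm, -⟩ := hP
  refine ⟨fun t => (γ t).1, fun t => (γ t).2, h.isOrbit hγ (fun t ht => ?_) (right_mem_Icc.2 hT)
    (left_mem_Icc.2 hT) (by rw [h1]; exact hζ.1) (by rw [h0]; exact hη.1), by simp [h0],
    by simp [h0], by simp [h1], by simp [h1]⟩
  exact ⟨⟨(hm t ht).1.1, (hm t ht).1.2.trans hζ.2⟩, ⟨(hm t ht).2.1, (hm t ht).2.2.trans hη.2⟩⟩

omit h in
lemma passage_solution (hζ : ζ ≤ ρ) (hη : η ≤ ρ) {γ : ℝ → ℝ × ℝ}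
    (hγ : ∀ t ∈ Icc 0 T, HasDerivWithinAt γ (X (γ t)) (Icc 0 T) t)
    (hm : ∀ t ∈ Icc 0 T, γ t ∈ Icc 0 ζ ×ˢ Icc 0 η) :
    ∀ t ∈ Icc 0 T, HasDerivWithinAt γ ((X ∘ clampSquare ρ) (γ t)) (Icc 0 T) t := by
  intro t ht
  rw [Function.comp_apply, clampSquare_of_mem
    ⟨⟨(hm t ht).1.1, (hm t ht).1.2.trans hζ⟩, ⟨(hm t ht).2.1, (hm t ht).2.2.trans hη⟩⟩]
  exact hγ t ht

/-- The curves agree as long as both are defined, and the shorter one would hit the transversal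
before the first hit of the longer one. -/
lemma passage_unique (hζ : ζ ≤ ρ) (hη : η ≤ ρ) {T' ω' : ℝ} (hP : DulacPassage X ζ η ξ T ω)
    (hP' : DulacPassage X ζ η ξ T' ω') : T = T' ∧ ω = ω' := by
  obtain ⟨hT, γ, h0, h1, hγ, hm, hlt⟩ := hP
  obtain ⟨hT', γ', h0', h1', hγ', hm', hlt'⟩ := hP'
  have s := passage_solution hζ hη hγ hm
  have s' := passage_solution hζ hη hγ' hm'
  have heq : ∀ t, 0 ≤ t → t ≤ T → t ≤ T' → γ t = γ' t := by
    intro t ht htT htT'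
    have := dist_solution_le h.lipschitzWith_comp_clampSquare s s' htT htT' t
      (right_mem_Icc.2 ht)
    rw [h0, h0', dist_self, zero_mul] at this
    exact dist_le_zero.1 this
  rcases lt_trichotomy T T' with hlt1 | rfl | hlt1
  · have e := heq T hT le_rfl hlt1.le
    have := hlt' T ⟨hT, hlt1⟩
    rw [← e, h1] at this
    exact absurd this (lt_irrefl _)
  · have e := heq T hT le_rfl le_rfl
    rw [h1, h1'] at e
    exact ⟨rfl, (Prod.mk.inj e).2⟩
  · have e := heq T' hT' hlt1.le le_rfl
    have := hlt T' ⟨hT', hlt1⟩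
    rw [e, h1'] at this
    exact absurd this (lt_irrefl _)

/-- The passage time depends continuously on the entry coordinate. -/
lemma passage_time_continuous (hζ : ζ ≤ ρ) (hη : η ≤ ρ) (hP : DulacPassage X ζ η ξ T ω)
    (hpos : 0 < (X (ζ, ω)).1) {ε : ℝ} (hε : 0 < ε) :
    ∃ δ : ℝ, 0 < δ ∧ ∀ ξ' T' ω' : ℝ, |ξ' - ξ| < δ → DulacPassage X ζ η ξ' T' ω' →
      |T' - T| < ε := by
  obtain ⟨hT, γ, h0, h1, hγ, hm, hlt⟩ := hP
  have hV := h.lipschitzWith_comp_clampSquare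
  have s := passage_solution hζ hη hγ hm
  -- The passage is continued beyond its exit time under the cut-off field, so that it visibly
  -- crosses the transversal.
  obtain ⟨z, z0, hz⟩ := exists_solution_of_lipschitz_of_bounded hV h.norm_comp_clampSquare_le
    (ξ, η) (by linarith : 0 ≤ T + 1)
  have hTT : T ≤ T + 1 := by linarith
  have heq : ∀ t ∈ Icc 0 T, z t = γ t := by
    intro t ht
    have := dist_solution_le hV hz s hTT le_rfl t ht
    rw [z0, h0, dist_self, zero_mul] at this
    exact dist_le_zero.1 this
  have zT : z T = (ζ, ω) := by rw [heq T (right_mem_Icc.2 hT), h1]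
  have hVT : (X ∘ clampSquare ρ) (z T) = X (ζ, ω) := by
    have := hm T (right_mem_Icc.2 hT)
    rw [h1] at this
    rw [zT, Function.comp_apply, clampSquare_of_mem
      ⟨⟨this.1.1, this.1.2.trans hζ⟩, ⟨this.2.1, this.2.2.trans hη⟩⟩]
  have dz : HasDerivWithinAt (fun t => (z t).1) (X (ζ, ω)).1 (Ioi T) T := by
    have d := hz T ⟨hT, hTT⟩
    rw [hVT] at d
    have d1 := (hasFDerivAt_fst (𝕜 := ℝ) (p := z T)).comp_hasDerivWithinAt T d
    exact d1.mono_of_mem_nhdsWithin (mem_of_superset (Ioc_mem_nhdsGT (by linarith : T < T + 1))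
      (Ioc_subset_Icc_self.trans (Icc_subset_Icc_left hT)))
  obtain ⟨t₂, ht₂, ht₂T, hz2⟩ : ∃ t₂, T < t₂ ∧ (t₂ < T + ε ∧ t₂ ≤ T + 1) ∧ ζ < (z t₂).1 := by
    have hs := (hasDerivWithinAt_iff_tendsto_slope' (by simp : T ∉ Ioi T)).1 dz
    have e1 := hs.eventually (lt_mem_nhds hpos)
    have e2 : ∀ᶠ t in 𝓝[>] T, t < T + min ε 1 := by
      refine mem_nhdsWithin_of_mem_nhds (Iio_mem_nhds ?_)
      have : 0 < min ε 1 := lt_min hε one_pos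
      linarith
    obtain ⟨t, ⟨ht1, ht2⟩, ht3⟩ := ((e1.and e2).and self_mem_nhdsWithin).exists
    have ht3' : T < t := ht3
    refine ⟨t, ht3', ⟨by linarith [min_le_left ε 1], by linarith [min_le_right ε 1]⟩, ?_⟩
    rw [slope_def_field] at ht1
    have := (div_pos_iff_of_pos_right (by linarith : 0 < t - T)).1 ht1
    rw [zT] at this
    linarith
  have hfst : ∀ a b : ℝ × ℝ, |a.1 - b.1| ≤ dist a b := fun a b => by
    rw [Prod.dist_eq, Real.dist_eq]; exact le_max_left _ _
  -- Before `T - ε` the curve has a positive distance from the transversal, by compactness, and at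
  -- `t₂` it has passed it. A nearby curve can therefore exit neither earlier than `T - ε` nor later
  -- than `t₂`.
  obtain ⟨d, hd, hd1⟩ : ∃ d : ℝ, 0 < d ∧ ∀ t, 0 ≤ t → t ≤ T - ε → (z t).1 ≤ ζ - d := by
    rcases lt_or_ge (T - ε) 0 with hneg | hnn
    · exact ⟨1, one_pos, fun t h1 h2 => by linarith⟩
    · have hc : ContinuousOn (fun t => (z t).1) (Icc 0 (T - ε)) := fun t ht =>
        (continuous_fst.continuousAt.comp_continuousWithinAt
          (hz t ⟨ht.1, by linarith [ht.2]⟩).continuousWithinAt).mono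
          (Icc_subset_Icc_right (by linarith))
      obtain ⟨m, hm', hmax⟩ := isCompact_Icc.exists_isMaxOn (nonempty_Icc.2 hnn) hc
      refine ⟨ζ - (z m).1, ?_, fun t h1 h2 => ?_⟩
      · rw [heq m ⟨hm'.1, by linarith [hm'.2]⟩]
        linarith [hlt m ⟨hm'.1, by linarith [hm'.2]⟩]
      · have : (z t).1 ≤ (z m).1 := hmax ⟨h1, h2⟩
        linarith
  have hE := Real.exp_pos (L * (T + 1))
  obtain ⟨δ, hδ, hδ1, hδ2⟩ : ∃ δ : ℝ, 0 < δ ∧ δ * Real.exp (L * (T + 1)) ≤ d ∧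
      δ * Real.exp (L * (T + 1)) ≤ (z t₂).1 - ζ := by
    refine ⟨min d ((z t₂).1 - ζ) / Real.exp (L * (T + 1)),
      div_pos (lt_min hd (by linarith)) hE, ?_, ?_⟩ <;> rw [div_mul_cancel₀ _ hE.ne']
    · exact min_le_left _ _
    · exact min_le_right _ _
  refine ⟨δ, hδ, fun ξ' T' ω' hξ' hP' => ?_⟩
  obtain ⟨hT', γ', h0', h1', hγ', hm', hlt'⟩ := hP'
  have s' := passage_solution hζ hη hγ' hm'
  have close : ∀ t, 0 ≤ t → t ≤ T' → t ≤ T + 1 →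
      |(γ' t).1 - (z t).1| < δ * Real.exp (L * (T + 1)) := by
    intro t ht htT' htT
    have := dist_solution_le hV s' hz htT' htT t (right_mem_Icc.2 ht)
    have h2 : dist (γ' 0) (z 0) = |ξ' - ξ| := by
      rw [h0', z0, Prod.dist_eq, Real.dist_eq]; simp
    rw [h2] at this
    calc _ ≤ |ξ' - ξ| * Real.exp (L * t) := (hfst _ _).trans this
      _ ≤ |ξ' - ξ| * Real.exp (L * (T + 1)) := by gcongr
      _ < _ := by gcongr
  rw [abs_lt]
  constructor
  · by_contra hcon
    push Not at hcon
    have c := abs_lt.1 (close T' hT' le_rfl (by linarith))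
    have := hd1 T' hT' (by linarith)
    rw [h1'] at c
    simp only at c
    linarith [c.2]
  · by_contra hcon
    push Not at hcon
    have ht₂0 : 0 ≤ t₂ := by linarith
    have htT' : t₂ ≤ T' := by linarith [ht₂T.1]
    have c := abs_lt.1 (close t₂ ht₂0 htT' ht₂T.2)
    have := (hm' t₂ ⟨ht₂0, htT'⟩).1.2
    linarith [c.1]

/-- Passages exist for all small entry coordinates. -/
lemma exists_passage {ξ₁ T₀ : ℝ} (hζ : ζ ∈ Ioo 0 ρ) (hη : η ∈ Ioo 0 ρ)
    (hy : ∀ (x y : ℝ → ℝ) (t₁ t₂ : ℝ), IsOrbit p f g ρ x y t₁ t₂ → y t₁ = η →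
        x t₁ < ξ₁ → ∀ t ∈ Icc t₁ t₂, y t ≤ η)
    (hξ : 0 < ξ) (hξ₁ : ξ < ξ₁) (hξζ : ξ < ζ)
    (ht : ∀ (x y : ℝ → ℝ) (t₁ t₂ : ℝ), t₁ ≤ t₂ →
      IsOrbit p f g ρ x y t₁ t₂ → ξ ≤ x t₁ → t₂ - t₁ ≤ T₀) :
    ∃ T ω : ℝ, DulacPassage X ζ η ξ T ω := by
  have hV := h.lipschitzWith_comp_clampSquare
  have hN : 0 ≤ max T₀ 0 + 1 := by
    have := le_max_right T₀ 0
    linarith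
  have hNT : T₀ < max T₀ 0 + 1 := by
    have := le_max_left T₀ 0
    linarith
  obtain ⟨N, hNdef⟩ : ∃ N, N = max T₀ 0 + 1 := ⟨_, rfl⟩
  rw [← hNdef] at hN hNT
  obtain ⟨z, z0, hz⟩ := exists_solution_of_lipschitz_of_bounded hV h.norm_comp_clampSquare_le
    (ξ, η) hN
  have hc : ContinuousOn z (Icc 0 N) := fun t ht => (hz t ht).continuousWithinAt
  have hc1 : ContinuousOn (fun t => (z t).1) (Icc 0 N) := continuous_fst.comp_continuousOn hc
  have hc2 : ContinuousOn (fun t => (z t).2) (Icc 0 N) := continuous_snd.comp_continuousOn hc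
  have horbit : ∀ T ∈ Icc 0 N, (∀ t ∈ Icc 0 T, z t ∈ Icc 0 ρ ×ˢ Icc 0 ρ) →
      (∀ t ∈ Icc 0 T, HasDerivWithinAt z (X (z t)) (Icc 0 T) t) ∧
      IsOrbit p f g ρ (fun t => (z t).1) (fun t => (z t).2) 0 T := by
    intro T hT hm
    have hd : ∀ t ∈ Icc 0 T, HasDerivWithinAt z (X (z t)) (Icc 0 T) t := by
      intro t ht
      have := (hz t ⟨ht.1, ht.2.trans hT.2⟩).mono (Icc_subset_Icc_right hT.2)
      rwa [Function.comp_apply, clampSquare_of_mem (hm t ht)] at this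
    have h0 : (0 : ℝ) ∈ Icc 0 T := left_mem_Icc.2 hT.1
    exact ⟨hd, h.isOrbit hd hm h0 h0 (by rw [z0]; exact hξ) (by rw [z0]; exact hη.1)⟩
  -- The height of the open rectangle is `ρ` and not `η`, because the starting point has height `η`
  -- and must be interior.
  set U : Set (ℝ × ℝ) := Ioo 0 ζ ×ˢ Ioo 0 ρ with hU
  have hUopen : IsOpen U := isOpen_Ioo.prod isOpen_Ioo
  have hUsub : ∀ w ∈ U, w ∈ Icc 0 ρ ×ˢ Icc 0 ρ := fun w hw =>
    ⟨⟨hw.1.1.le, (hw.1.2.trans hζ.2).le⟩, ⟨hw.2.1.le, hw.2.2.le⟩⟩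
  have hcomp : IsCompact (Icc 0 N ∩ z ⁻¹' Uᶜ) := by
    refine isCompact_Icc.of_isClosed_subset ?_ inter_subset_left
    exact hc.preimage_isClosed_of_isClosed isClosed_Icc hUopen.isClosed_compl
  have hne : (Icc 0 N ∩ z ⁻¹' Uᶜ).Nonempty := by
    by_contra hcon
    rw [not_nonempty_iff_eq_empty] at hcon
    have hin : ∀ t ∈ Icc 0 N, z t ∈ U := fun t ht => by
      by_contra hzU
      have : t ∈ Icc 0 N ∩ z ⁻¹' Uᶜ := ⟨ht, hzU⟩
      rw [hcon] at this
      exact this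
    have := ht _ _ 0 N hN (horbit N (right_mem_Icc.2 hN) fun t ht => hUsub _ (hin t ht)).2
      (by simp [z0])
    linarith
  obtain ⟨T, ⟨hTN, hTU⟩, hleast⟩ := hcomp.exists_isLeast hne
  have hbefore : ∀ t ∈ Ico 0 T, z t ∈ U := fun t ht => by
    by_contra hzU
    have := hleast ⟨⟨ht.1, ht.2.le.trans hTN.2⟩, hzU⟩
    linarith [ht.2]
  have hT0 : 0 < T := by
    rcases hTN.1.eq_or_lt with e | hlt
    · exfalso
      apply hTU
      rw [← e, z0]
      exact ⟨⟨hξ, hξζ⟩, hη⟩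
    · exact hlt
  have hclos : T ∈ closure (Ico 0 T) := by
    rw [closure_Ico hT0.ne]; exact right_mem_Icc.2 hT0.le
  have hsub : Ico 0 T ⊆ Icc 0 N := fun t ht => ⟨ht.1, ht.2.le.trans hTN.2⟩
  have w1 : ContinuousWithinAt (fun t => (z t).1) (Ico 0 T) T := (hc1 T hTN).mono hsub
  have w2 : ContinuousWithinAt (fun t => (z t).2) (Ico 0 T) T := (hc2 T hTN).mono hsub
  have hTle : (z T).1 ≤ ζ := ContinuousWithinAt.closure_le hclos w1 continuousWithinAt_const
    fun t ht => (hbefore t ht).1.2.le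
  have hTle2 : (z T).2 ≤ ρ := ContinuousWithinAt.closure_le hclos w2 continuousWithinAt_const
    fun t ht => (hbefore t ht).2.2.le
  have hTge : 0 ≤ (z T).1 := ContinuousWithinAt.closure_le hclos continuousWithinAt_const w1
    fun t ht => (hbefore t ht).1.1.le
  have hTge2 : 0 ≤ (z T).2 := ContinuousWithinAt.closure_le hclos continuousWithinAt_const w2
    fun t ht => (hbefore t ht).2.1.le
  have hbox : ∀ t ∈ Icc 0 T, z t ∈ Icc 0 ρ ×ˢ Icc 0 ρ := by
    intro t ht
    rcases ht.2.eq_or_lt with rfl | hlt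
    · exact ⟨⟨hTge, hTle.trans hζ.2.le⟩, ⟨hTge2, hTle2⟩⟩
    · exact hUsub _ (hbefore t ⟨ht.1, hlt⟩)
  obtain ⟨hd, ho⟩ := horbit T hTN hbox
  have hyle : ∀ t ∈ Icc 0 T, (z t).2 ≤ η := hy _ _ 0 T ho (by simp [z0]) (by simpa [z0] using hξ₁)
  have mT := right_mem_Icc.2 hT0.le
  -- At the first time outside `U` the coordinates are positive and the height is at most `η < ρ`;
  -- only the side `x = ζ` remains.
  have hTζ : (z T).1 = ζ := by
    refine le_antisymm hTle ?_
    by_contra hcon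
    push Not at hcon
    exact hTU ⟨⟨ho.x_pos T mT, hcon⟩, ⟨ho.y_pos T mT, (hyle T mT).trans_lt hη.2⟩⟩
  refine ⟨T, (z T).2, hT0.le, z, z0, by rw [← hTζ], hd, fun t ht => ?_, fun t ht =>
    (hbefore t ht).1.2⟩
  refine ⟨⟨(ho.x_pos t ht).le, ?_⟩, ⟨(ho.y_pos t ht).le, hyle t ht⟩⟩
  rcases ht.2.eq_or_lt with rfl | hlt
  · exact hTle
  · exact (hbefore t ⟨ht.1, hlt⟩).1.2.le

end IsSaddleOn

end

/-! ### Assembly of the theorem -/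

lemma exists_rpow_lt {m : ℝ} (hm : 0 < m) (C : ℝ) {ε : ℝ} (hε : 0 < ε) :
    ∃ δ : ℝ, 0 < δ ∧ ∀ ξ : ℝ, 0 < ξ → ξ < δ → C * ξ ^ m < ε := by
  have hlim : Tendsto (fun z : ℝ => C * z ^ m) (𝓝 0) (𝓝 0) := by
    have : ContinuousAt (fun z : ℝ => C * z ^ m) 0 :=
      continuousAt_const.mul (Real.continuousAt_rpow_const 0 m (Or.inr hm.le))
    simpa [ContinuousAt, Real.zero_rpow hm.ne'] using this
  obtain ⟨δ, hδ, H⟩ := Metric.eventually_nhds_iff.1 (hlim.eventually (gt_mem_nhds hε))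
  exact ⟨δ, hδ, fun ξ h1 h2 => H (by rwa [Real.dist_eq, sub_zero, abs_of_pos h1])⟩

/-- Close to the horizontal axis, the field crosses the outgoing transversal. -/
lemma IsSaddleOn.exists_fst_pos {p : CubicCoeffs} {X : ℝ × ℝ → ℝ × ℝ} {f g : ℝ → ℝ → ℝ} {ρ C : ℝ}
    {L : NNReal} (h : IsSaddleOn p X f g ρ L) (hR : IsRemainder f g ρ C) (hC : C * ρ < p.a₀)
    {ζ : ℝ} (hζ : ζ ∈ Ioc 0 ρ) :
    ∃ ε : ℝ, 0 < ε ∧ ∀ ω ∈ Icc 0 ρ, ω < ε → 0 < (X (ζ, ω)).1 := by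
  have hζ0 := hζ.1
  have hζm : ζ ∈ Icc 0 ρ := Ioc_subset_Icc_self hζ
  have h0 : 0 < (X (ζ, 0)).1 := by
    rw [h.form ζ hζm 0 h.zero_mem]
    refine mul_pos hζ0 ?_
    have h1 := (abs_le.1 (hR.f_le ζ hζm 0 h.zero_mem)).1
    simp only [add_zero] at h1
    have hC0 : 0 ≤ C := by
      have h2 := (abs_nonneg _).trans (hR.f_le ζ hζm 0 h.zero_mem)
      rw [add_zero] at h2
      exact nonneg_of_mul_nonneg_left h2 (by positivity)
    have h2 : C * ζ < p.a₀ := (mul_le_mul_of_nonneg_left hζ.2 hC0).trans_lt hC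
    have h3 : 0 < (p.a₀ - C * ζ) * ζ ^ 2 := mul_pos (by linarith) (by positivity)
    simp only [CubicCoeffs.xForm]
    nlinarith
  have hL : (0 : ℝ) < L + 1 := by positivity
  refine ⟨(X (ζ, 0)).1 / (L + 1), by positivity, fun ω hω hlt => ?_⟩
  rw [lt_div_iff₀ hL] at hlt
  have h1 := h.lip.dist_le_mul (ζ, ω) ⟨hζm, hω⟩ (ζ, 0) ⟨hζm, h.zero_mem⟩
  have h2 : dist ((ζ, ω) : ℝ × ℝ) (ζ, 0) = ω := by
    rw [Prod.dist_eq]; simp [abs_of_nonneg hω.1, hω.1]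
  have h3 : |(X (ζ, ω)).1 - (X (ζ, 0)).1| ≤ dist (X (ζ, ω)) (X (ζ, 0)) := by
    rw [Prod.dist_eq, Real.dist_eq]; exact le_max_left _ _
  rw [h2] at h1
  have h4 := (abs_le.1 (h3.trans h1)).1
  have : ω * (L + 1) = L * ω + ω := by ring
  linarith [hω.1]

set_option maxHeartbeats 1000000 in
theorem theorem1p1 (p : CubicCoeffs) (hp : p.Admissible) (hL : p.FirstIntegralCondition)
    (X : ℝ × ℝ → ℝ × ℝ) (hX : IsCubicNeutralSaddle p X) :
    ∃ r : ℝ, 0 < r ∧ ∀ ζ₀ ∈ Ioo 0 r, ∃ ξ₀ ω₀ : ℝ → ℝ, ∀ η ∈ Ioo 0 r,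
      0 < ξ₀ η ∧ 0 < ω₀ η ∧
      -- the asymptotics of the entry and exit coordinates in terms of the Dulac time
      (∃ C T₁ : ℝ, ∀ T : ℝ, T₁ ≤ T →
        (∃ ξ ω : ℝ, DulacPassage X ζ₀ η ξ T ω) ∧
        ∀ ξ ω : ℝ, DulacPassage X ζ₀ η ξ T ω →
          (∃ e : ℝ, |e| ≤ C * max (T ^ (-p.βstar)) (T ^ (-(1 / 2) : ℝ) * Real.log T) ∧
            ξ = ξ₀ η * T ^ (-p.β₂) * (1 + e)) ∧
          (∃ e : ℝ, |e| ≤ C * max (T ^ (-p.βstar)) (T ^ (-(1 / 2) : ℝ) * Real.log T) ∧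
            ω = ω₀ η * T ^ (-p.β₀) * (1 + e))) ∧
      -- the Dulac map
      (∃ C ξ₁ : ℝ, 0 < ξ₁ ∧ ∀ ξ ∈ Ioo 0 ξ₁,
        (∃! q : ℝ × ℝ, DulacPassage X ζ₀ η ξ q.1 q.2) ∧
        ∀ T ω : ℝ, DulacPassage X ζ₀ η ξ T ω →
          ∃ e : ℝ, |e| ≤ C * max (ξ ^ (p.βstar / p.β₂)) (-ξ ^ (1 / (2 * p.β₂)) * Real.log ξ) ∧
            ω = ω₀ η * ξ₀ η ^ (-p.β₀ / p.β₂) * ξ ^ (p.β₀ / p.β₂) * (1 + e)) ∧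
      -- the values of the constants if there are no terms of order four and higher
      ((∀ᶠ z in 𝓝 0, X z = p.field z) → ξ₀ η = p.entryConst η ∧ ω₀ η = p.exitConst ζ₀) := by
  obtain ⟨ρ₀, C, f, g, L, hρ₀, hR, hform, hlip, hzero⟩ := hX.exists_remainder
  have hS₀ : IsSaddleOn p X f g ρ₀ L := ⟨hρ₀, hform, hlip⟩
  obtain ⟨ρ₁, k, hρ₁, hρ₁₀, hb⟩ := hp.exists_fieldBounds hρ₀ hR
  obtain ⟨ρ₂, hρ₂, hρ₂₀, HT⟩ := hp.exists_time_bound hρ₀ hR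
  obtain ⟨ρ₃, hρ₃, hρ₃₀, HY⟩ := hp.exists_y_le_entry hL hρ₀ hR
  obtain ⟨ρ₄, hρ₄, hρ₄₀, K₁, K₂, hK, HA⟩ := hp.exists_passage_asymptotics hL hρ₀ hR
  have ha := hp.a₀_pos
  have hμ := hp.μ_pos
  have hν := hp.ν_pos
  obtain ⟨ρ, hρ, h1, h2, h3, h4, h5⟩ : ∃ ρ : ℝ, 0 < ρ ∧ ρ ≤ ρ₁ ∧ ρ ≤ ρ₂ ∧ ρ ≤ ρ₃ ∧ ρ ≤ ρ₄ ∧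
      C * ρ < p.a₀ := by
    refine ⟨min ρ₁ (min ρ₂ (min ρ₃ (min ρ₄ (p.a₀ / (2 * (|C| + 1)))))), ?_, by simp, by simp,
      by simp, by simp, ?_⟩
    · exact lt_min hρ₁ (lt_min hρ₂ (lt_min hρ₃ (lt_min hρ₄ (by positivity))))
    · obtain ⟨m, hm⟩ : ∃ m, m = min ρ₁ (min ρ₂ (min ρ₃ (min ρ₄ (p.a₀ / (2 * (|C| + 1)))))) :=
        ⟨_, rfl⟩
      have hm0 : 0 < m := by
        rw [hm]; exact lt_min hρ₁ (lt_min hρ₂ (lt_min hρ₃ (lt_min hρ₄ (by positivity))))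
      have hm1 : m ≤ p.a₀ / (2 * (|C| + 1)) := by rw [hm]; simp
      rw [← hm]
      calc C * m ≤ (|C| + 1) * m := by gcongr; linarith [le_abs_self C]
        _ ≤ (|C| + 1) * (p.a₀ / (2 * (|C| + 1))) := by gcongr
        _ = p.a₀ / 2 := by field_simp
        _ < p.a₀ := by linarith
  replace hb := hb.mono h1
  have hS := hS₀.mono hρ (h1.trans hρ₁₀)
  have hRρ : IsRemainder f g ρ C := by
    have hi : ∀ x ∈ Icc 0 ρ, x ∈ Icc 0 ρ₀ := fun x hx => ⟨hx.1, hx.2.trans (h1.trans hρ₁₀)⟩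
    have ho : Ioc 0 ρ ⊆ Ioc 0 ρ₀ := Ioc_subset_Ioc_right (h1.trans hρ₁₀)
    exact ⟨fun x hx y hy => hR.f_le x (hi x hx) y (hi y hy),
      fun x hx y hy => hR.g_le x (hi x hx) y (hi y hy),
      fun x hx y hy => hR.f_left x (hi x hx) y (hi y hy),
      fun x hx y hy => hR.g_left x (hi x hx) y (hi y hy),
      fun x hx y hy => hR.f_bot x (hi x hx) y (hi y hy),
      fun x hx y hy => hR.g_bot x (hi x hx) y (hi y hy),
      hR.f_left_cont.mono ho, hR.g_left_cont.mono ho, hR.f_bot_cont.mono ho,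
      hR.g_bot_cont.mono ho⟩
  obtain ⟨J, hJdef⟩ : ∃ J, J = p.timeIntegral 1 + p.swap.timeIntegral 1 := ⟨_, rfl⟩
  have hJ : 0 < J := by
    rw [hJdef]; exact add_pos hp.timeIntegral_one_pos hp.swap.timeIntegral_one_pos
  -- The constants arise from `μ log ξ = A₂ + S` and `ν log ω = A₁ + S` with `2S = log J - log T`.
  refine ⟨ρ, hρ, fun ζ hζ => ⟨fun η => Real.exp
    ((-((1 - p.μ) * Real.log η + p.σ * Real.log p.c₂) + K₂ η + Real.log J / 2) / p.μ),
    fun _ => Real.exp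
    ((-((1 - p.ν) * Real.log ζ + p.σ * Real.log p.c₀) + K₁ ζ + Real.log J / 2) / p.ν),
    fun η hη => ⟨Real.exp_pos _, Real.exp_pos _, ?_⟩⟩⟩
  obtain ⟨A₂, hA₂⟩ : ∃ A, A = -((1 - p.μ) * Real.log η + p.σ * Real.log p.c₂) + K₂ η := ⟨_, rfl⟩
  obtain ⟨A₁, hA₁⟩ : ∃ A, A = -((1 - p.ν) * Real.log ζ + p.σ * Real.log p.c₀) + K₁ ζ := ⟨_, rfl⟩
  simp only [← hA₂, ← hA₁]
  have hζm : ζ ∈ Ioc 0 ρ := Ioo_subset_Ioc_self hζ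
  have hηm : η ∈ Ioc 0 ρ := Ioo_subset_Ioc_self hη
  obtain ⟨C', ξa, hC', hξa, HA'⟩ := HA ζ ⟨hζ.1, hζ.2.le.trans h4⟩ η ⟨hη.1, hη.2.le.trans h4⟩
  obtain ⟨δ₁, C₁, hδ₁, hC₁, B₁⟩ := exists_coordinate_asymptotics hJ hC' hμ A₂
  obtain ⟨δ₂, C₂, hδ₂, hC₂, B₂⟩ := exists_coordinate_asymptotics hJ hC' hν A₁
  obtain ⟨δ₃, C₃, hδ₃, hC₃, B₃⟩ := exists_power_law hC' hμ hν A₂ A₁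
  have asymptotics : ∀ ξ T ω : ℝ, DulacPassage X ζ η ξ T ω → 0 < ξ ∧ 0 < ω ∧ (ξ < ξa → ∃ S : ℝ,
      Real.exp S ≤ C' * ξ ^ p.μ ∧
      |p.μ * Real.log ξ - A₂ - S| ≤ C' * (Real.exp S * (1 + |S|)) ∧
      |p.ν * Real.log ω - A₁ - S| ≤ C' * (Real.exp S * (1 + |S|)) ∧
      |T * Real.exp (2 * S) - J| ≤ C' * Real.exp S) := by
    intro ξ T ω hP
    obtain ⟨x, y, ho, rfl, hy0, hxT, rfl⟩ := hS.exists_orbit_of_passage hζm hηm hP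
    have m0 := left_mem_Icc.2 hP.1
    have mT := right_mem_Icc.2 hP.1
    refine ⟨ho.x_pos 0 m0, ho.y_pos T mT, fun hlt => ?_⟩
    obtain ⟨S, s1, s2, s3, s4⟩ := HA' x y 0 T hP.1 (ho.mono h4 le_rfl le_rfl) hy0 hxT hlt
    rw [← hJdef, sub_zero] at s4
    refine ⟨S, s1, ?_, ?_, s4⟩
    · convert s2 using 2; rw [hA₂]; ring
    · convert s3 using 2; rw [hA₁]; ring
  obtain ⟨εt, hεt, Ht⟩ := hS.exists_fst_pos hRρ h5 hζm
  obtain ⟨ξt, hξt, Hξt⟩ := hp.exists_y_lt hL hb η (Real.log ρ - Real.log ζ) hεt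
  obtain ⟨ξy, hξy, Hξy⟩ := HY η hη.1
  obtain ⟨ξδ, hξδ, Hξδ⟩ := exists_rpow_lt hμ C' (lt_min hδ₁ (lt_min hδ₂ hδ₃))
  obtain ⟨ξs, hξs, l1, l2, l3, l4, l5, l6⟩ : ∃ ξs : ℝ, 0 < ξs ∧ ξs ≤ ξa ∧ ξs ≤ ξt ∧ ξs ≤ ξy ∧
      ξs ≤ ξδ ∧ ξs ≤ ζ ∧ ξs ≤ Real.exp (-1) :=
    ⟨min ξa (min ξt (min ξy (min ξδ (min ζ (Real.exp (-1)))))),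
      lt_min hξa (lt_min hξt (lt_min hξy (lt_min hξδ (lt_min hζ.1 (Real.exp_pos _))))),
      by simp, by simp, by simp, by simp, by simp, by simp⟩
  have transversal : ∀ ξ T ω : ℝ, ξ < ξs → DulacPassage X ζ η ξ T ω → 0 < (X (ζ, ω)).1 := by
    intro ξ T ω hlt hP
    obtain ⟨x, y, ho, rfl, hy0, hxT, rfl⟩ := hS.exists_orbit_of_passage hζm hηm hP
    have mT := right_mem_Icc.2 hP.1
    refine Ht _ ⟨(ho.y_pos T mT).le, ho.y_le T mT⟩
      (Hξt x y 0 T ho hy0 (hlt.trans_le l2) T mT ?_)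
    rw [hxT]
    linarith [Real.log_le_log (ho.y_pos T mT) (ho.y_le T mT)]
  have exist : ∀ ξ ∈ Ioo 0 ξs, ∃ T ω : ℝ, DulacPassage X ζ η ξ T ω := by
    intro ξ hξ
    obtain ⟨T₀, hT₀⟩ := HT ξ hξ.1
    exact hS.exists_passage hζ hη
      (fun x y t₁ t₂ ho => Hξy x y t₁ t₂ (ho.mono h3 le_rfl le_rfl)) hξ.1
      (hξ.2.trans_le l3) (hξ.2.trans_le l5)
      (fun x y t₁ t₂ h12 ho => hT₀ x y t₁ t₂ h12 (ho.mono h2 le_rfl le_rfl))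
  choose! τ w hτ using exist
  refine ⟨?_, ?_, ?_⟩
  · obtain ⟨Tb, hTb⟩ := HT ξs hξs
    have hhalf : ξs / 2 ∈ Ioo 0 ξs := ⟨by linarith, by linarith⟩
    have hτc : ContinuousOn τ (Ioo 0 ξs) := by
      intro ξ hξ
      refine ContinuousAt.continuousWithinAt (Metric.continuousAt_iff.2 fun ε hε => ?_)
      obtain ⟨δ, hδ, hd⟩ := hS.passage_time_continuous hζm.2 hηm.2 (hτ ξ hξ)
        (transversal ξ _ _ hξ.2 (hτ ξ hξ)) hε
      obtain ⟨δ', hδ', hsub⟩ := Metric.isOpen_iff.1 isOpen_Ioo ξ hξ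
      refine ⟨min δ δ', lt_min hδ hδ', fun {ξ'} hξ' => ?_⟩
      rw [Real.dist_eq]
      refine hd ξ' _ _ ?_ (hτ ξ' (hsub ?_))
      · rw [← Real.dist_eq]; exact hξ'.trans_le (min_le_left _ _)
      · rw [Metric.mem_ball]; exact hξ'.trans_le (min_le_right _ _)
    -- The threshold `3` serves the logarithm, `Tb + 1` excludes entries with `ξ ≥ ξs`, and `τ (ξs /
    -- 2)` is the lower value for the intermediate value theorem.
    refine ⟨max C₁ C₂, max 3 (max (Tb + 1) (τ (ξs / 2))), fun T hT => ?_⟩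
    have hT3 : 3 ≤ T := (le_max_left _ _).trans hT
    have hTb1 : Tb + 1 ≤ T := (le_max_left _ _).trans ((le_max_right _ _).trans hT)
    have hTτ : τ (ξs / 2) ≤ T := (le_max_right _ _).trans ((le_max_right _ _).trans hT)
    have hT0 : 0 < T := by linarith
    constructor
    -- If `e^S < ε`, then `τ e^{2S} ≥ J - C' e^S ≥ J / 2 ≥ T e^{2S}`, so the passage takes at least
    -- the time `T`.
    · obtain ⟨ε, hε, hε1, hε2⟩ : ∃ ε : ℝ, 0 < ε ∧ C' * ε ≤ J / 2 ∧ T * ε ^ 2 ≤ J / 2 := by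
        refine ⟨min (J / (2 * C')) (Real.sqrt (J / (2 * T))), lt_min (by positivity)
          (Real.sqrt_pos.2 (by positivity)), ?_, ?_⟩
        · calc C' * min (J / (2 * C')) (Real.sqrt (J / (2 * T))) ≤ C' * (J / (2 * C')) := by
                gcongr; exact min_le_left _ _
            _ = J / 2 := by field_simp
        · have hmin : 0 ≤ min (J / (2 * C')) (Real.sqrt (J / (2 * T))) :=
            le_min (by positivity) (Real.sqrt_nonneg _)
          calc T * min (J / (2 * C')) (Real.sqrt (J / (2 * T))) ^ 2
              ≤ T * Real.sqrt (J / (2 * T)) ^ 2 := by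
                gcongr; exact min_le_right _ _
            _ = J / 2 := by rw [Real.sq_sqrt (by positivity)]; field_simp
      obtain ⟨ξe, hξe, Hξe⟩ := exists_rpow_lt hμ C' hε
      obtain ⟨ξ', hξ', k1, k2⟩ : ∃ ξ' : ℝ, 0 < ξ' ∧ ξ' < ξe ∧ ξ' ≤ ξs / 2 :=
        ⟨min (ξe / 2) (ξs / 2), lt_min (by linarith) (by linarith),
          (min_le_left _ _).trans_lt (by linarith), min_le_right _ _⟩
      have hξ'm : ξ' ∈ Ioo 0 ξs := ⟨hξ', by linarith⟩
      have hTle : T ≤ τ ξ' := by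
        obtain ⟨S, s1, -, -, s4⟩ := (asymptotics _ _ _ (hτ ξ' hξ'm)).2.2 (hξ'm.2.trans_le l1)
        have hSε : Real.exp S < ε := s1.trans_lt (Hξe ξ' hξ' k1)
        have e2 : Real.exp (2 * S) = Real.exp S ^ 2 := by rw [sq, ← Real.exp_add]; ring_nf
        rw [e2] at s4
        have i1 := (abs_le.1 s4).1
        have i2 : C' * Real.exp S ≤ J / 2 := le_trans (by gcongr) hε1
        have i3 : T * Real.exp S ^ 2 ≤ J / 2 := le_trans (by gcongr) hε2
        have i4 : T * Real.exp S ^ 2 ≤ τ ξ' * Real.exp S ^ 2 := by linarith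
        exact le_of_mul_le_mul_right i4 (by positivity)
      have hsub : Icc ξ' (ξs / 2) ⊆ Ioo 0 ξs := fun s hs =>
        ⟨hξ'.trans_le hs.1, by linarith [hs.2]⟩
      obtain ⟨ξ, hξ, e⟩ := intermediate_value_Icc' k2 (hτc.mono hsub) ⟨hTτ, hTle⟩
      exact ⟨ξ, w ξ, e ▸ hτ ξ (hsub hξ)⟩
    · intro ξ ω hP
      obtain ⟨hξ0, hω0, hS'⟩ := asymptotics ξ T ω hP
      have hξlt : ξ < ξs := by
        by_contra hcon
        push Not at hcon
        obtain ⟨x, y, ho, rfl, -⟩ := hS.exists_orbit_of_passage hζm hηm hP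
        have := hTb x y 0 T hP.1 (ho.mono h2 le_rfl le_rfl) hcon
        linarith
      obtain ⟨S, s1, s2, s3, s4⟩ := hS' (hξlt.trans_le l1)
      have hSδ := s1.trans (Hξδ ξ hξ0 (hξlt.trans_le l4)).le
      have hlog : 0 ≤ T ^ (-(1 / 2) : ℝ) * Real.log T := by
        have := Real.log_nonneg (by linarith : 1 ≤ T)
        positivity
      obtain ⟨e₁, he₁, q₁⟩ := B₁ S T ξ hξ0 (hSδ.trans (min_le_left _ _)) hT3 s4 s2
      obtain ⟨e₂, he₂, q₂⟩ := B₂ S T ω hω0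
        (hSδ.trans ((min_le_right _ _).trans (min_le_left _ _))) hT3 s4 s3
      refine ⟨⟨e₁, he₁.trans ?_, by rw [hp.β₂_eq]; exact q₁⟩,
        ⟨e₂, he₂.trans ?_, by rw [hp.β₀_eq]; exact q₂⟩⟩
      · exact mul_le_mul (le_max_left _ _) (le_max_right _ _) hlog (hC₁.le.trans (le_max_left _ _))
      · exact mul_le_mul (le_max_right _ _) (le_max_right _ _) hlog (hC₁.le.trans (le_max_left _ _))
  · refine ⟨C₃, ξs, hξs, fun ξ hξ => ⟨⟨(τ ξ, w ξ), hτ ξ hξ, ?_⟩, ?_⟩⟩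
    · rintro ⟨T, ω⟩ hP
      obtain ⟨e1, e2⟩ := hS.passage_unique hζm.2 hηm.2 hP (hτ ξ hξ)
      exact Prod.ext e1 e2
    · intro T ω hP
      obtain ⟨hξ0, hω0, hS'⟩ := asymptotics ξ T ω hP
      obtain ⟨S, s1, s2, s3, -⟩ := hS' (hξ.2.trans_le l1)
      have hSδ := s1.trans (Hξδ ξ hξ0 (hξ.2.trans_le l4)).le
      obtain ⟨e, he, q⟩ := B₃ S ξ ω hξ0 hω0 (hξ.2.le.trans l6)
        (hSδ.trans ((min_le_right _ _).trans (min_le_right _ _))) s1 s2 s3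
      refine ⟨e, he.trans ?_, ?_⟩
      · rw [hp.one_div_two_β₂]
        gcongr
        exact le_max_right _ _
      · have r1 : p.β₀ / p.β₂ = p.μ / p.ν := by
          rw [hp.β₀_eq, hp.β₂_eq]; field_simp
        -- In the product `ω₀ ξ₀^{-β₀/β₂}` the terms with `log J` cancel, which leaves `exp ((A₁ -
        -- A₂) / ν)`.
        rw [neg_div, r1, ← Real.exp_mul, ← Real.exp_add]
        refine q.trans ?_
        congr 3
        field_simp
        ring
  · intro hev
    have h0 := hK (hzero hev)
    have z1 := (h0 ζ ⟨hζ.1, hζ.2.le.trans h4⟩).1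
    have z2 := (h0 η ⟨hη.1, hη.2.le.trans h4⟩).2
    rw [hp.entryConst_eq hη.1, hp.exitConst_eq hζ.1, ← hJdef, hA₁, hA₂, z1, z2]
    simp
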